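/- **Setting.** Let $H$ be a complex Hilbert space, $A$ a self-adjoint (possibly unbounded) operator in $H$, and $\gamma\in\mathcal L(H)$ with $$\gamma^*=-\gamma,\qquad \gamma^2=-I,\qquad \gamma(\mathcal D(A))=\mathcal D(A),\qquad \gamma A+A\gamma=0 \text{ on } \mathcal D(A).$$ For $s\ge 0$ let $H_s=H_s(A)=\mathcal D(|A|^s)$ with norm $\|x\|_s=\|(1+A^2)^{s/2}x\|$ (equivalent to the graph norm of $|A|^s$), let $H_\infty=\bigcap_{s\ge 0}H_s$, and for $s<0$ and $x\in H_\infty$ also put $\|x\|_s=\|(1+A^2)^{s/2}x\|$. Let $\mathrm{Op}^0(A)$ be the set of linear maps $B:H_\infty\to H_\infty$ such that for each $s\in\mathbb R$ there is $C(s)$ with $\|Bx\|_s\le C(s)\|x\|_s$ for all $x\in H_\infty$; each such $B$ is identified with its extension to a bounded operator in $H$. Let $\Psi^0(A)\subset\mathrm{Op}^0(A)$ be a $*$-subalgebra of $\mathcal L(H)$ such that * ($\Psi$1) $\Psi^0(A)$ has holomorphic functional calculus: $f(B)\in\Psi^0(A)$ whenever $B\in\Psi^0(A)$ and $f$ is holomorphic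 in a neighbourhood of the spectrum of $B$ in $\mathcal L(H)$, with $f(B)$ defined by the Cauchy integral; * ($\Psi$2) $\Psi^0(A)$ contains an orthogonal projection $P_+(A)$ with $I-P_+(A)=\gamma^*P_+(A)\gamma$ and $P_{(0,\infty)}(A)\le P_+(A)\le P_{[0,\infty)}(A)$, where $P_J(A)$ denotes the spectral projection of $A$ for $J\subset\mathbb R$. Let $\mathbb R_+=[0,\infty)$ and let $\mathcal H_1(\mathbb R_+,A)$ be the space of all $f\in L^2(\mathbb R_+,H)$ which have a weak derivative $f'\in L^2(\mathbb R_+,H)$ and which satisfy $f\in L^2(\mathbb R_+,H_1)$; such an $f$ has a continuous representative on $[0,\infty)$, whose value at $0$ is denoted $f(0)$. For an orthogonal projection $P$ in $H$ let $D_P=\gamma\left(\frac{d}{dx}+A\right)$, as an operator in $L^2(\mathbb R_+,H)$ with domain $$\{f\in C_0^\infty(\mathbb R_+,H_1): Pf(0)=0\}$$ (functions smooth up to $0$ with compact support in $[0,\infty)$). A pair $(P,Q)$ of orthogonal projections in $H$ is a Fredholm pair if the map $Q:P(H)\to Q(H)$ is Fredholm. The operator $A$ is called discrete if it has compact resolvent.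 **Theorem.** (1) Let $P\in\Psi^0(A)$ be an orthogonal projection with $$\gamma^*P\gamma=I-P \qquad\text{and}\qquad (P,P_+(A)) \text{ a Fredholm pair}. \tag{$*$}$$ Then $D_P$ is essentially self-adjoint in $L^2(\mathbb R_+,H)$, and the domain of its closure is $\{f\in\mathcal H_1(\mathbb R_+,A): Pf(0)=0\}$. (2) Conversely, if $A$ is discrete and $P\in\Psi^0(A)$ is an orthogonal projection such that the operator $\gamma\left(\frac{d}{dx}+A\right)$ is self-adjoint in $L^2(\mathbb R_+,H)$ on the domain $\{f\in\mathcal H_1(\mathbb R_+,A): Pf(0)=0\}$, then both conditions in $(*)$ hold. -/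

import Mathlib

open MeasureTheory Set Filter Topology
open scoped ContDiff

noncomputable section

namespace ModelOp

section Unbounded

variable {H : Type*} [NormedAddCommGroup H] [InnerProductSpace ℂ H]

/-- `R` is the resolvent `(A - z)⁻¹` of the (unbounded) operator `A`: for every `x` one has
`R x ∈ 𝒟(A)` and `(A - z) R x = x`, and `R (A u - z u) = u` for every `u ∈ 𝒟(A)`. -/
def IsResolventAt (A : H →ₗ.[ℂ] H) (z : ℂ) (R : H →L[ℂ] H) : Prop :=
  (∀ x : H, (R x, x + z • R x) ∈ A.graph) ∧ ∀ u : A.domain, R (A u - z • (u : H)) = u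

open Classical in
/-- The resolvent `(A - z)⁻¹` (zero if `z` is in the spectrum of `A`). -/
def resolventAt (A : H →ₗ.[ℂ] H) (z : ℂ) : H →L[ℂ] H :=
  if h : ∃ R, IsResolventAt A z R then h.choose else 0

theorem IsResolventAt.unique {A : H →ₗ.[ℂ] H} {z : ℂ} {R S : H →L[ℂ] H}
    (hR : IsResolventAt A z R) (hS : IsResolventAt A z S) : R = S := by
  ext x
  obtain ⟨u, hu, hAu⟩ := (LinearPMap.mem_graph_iff _).1 (hR.1 x)
  have h := hS.2 u
  simp only at hu hAu
  rw [hAu, hu] at h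
  simpa using h.symm

theorem isResolventAt_resolventAt_of_exists {A : H →ₗ.[ℂ] H} {z : ℂ}
    (h : ∃ R, IsResolventAt A z R) : IsResolventAt A z (resolventAt A z) := by
  rw [resolventAt, dif_pos h]
  exact h.choose_spec

/-- `A` is discrete: it has compact resolvent. -/
def IsDiscreteOp (A : H →ₗ.[ℂ] H) : Prop :=
  ∃ (z : ℂ) (R : H →L[ℂ] H), IsResolventAt A z R ∧ IsCompactOperator R

/-- `T` is essentially self-adjoint: it is closable and its closure is self-adjoint. -/
def IsEssentiallySelfAdjoint [CompleteSpace H] (T : H →ₗ.[ℂ] H) : Prop :=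
  T.IsClosable ∧ IsSelfAdjoint T.closure

variable [CompleteSpace H]

/-- Non-real numbers belong to the resolvent set of a self-adjoint operator. -/
theorem exists_resolvent {A : H →ₗ.[ℂ] H} (hA : IsSelfAdjoint A) {z : ℂ} (hz : z.im ≠ 0) :
    ∃ R, IsResolventAt A z R := by
  have hd : Dense (A.domain : Set H) := hA.dense_domain
  have hadj : A.adjoint = A := hA
  have hsymm : ∀ u v : A.domain, inner ℂ (A u) (v : H) = inner ℂ (u : H) (A v) := by
    have h := LinearPMap.adjoint_isFormalAdjoint (T := A) hd
    rw [hadj] at h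
    exact fun u v => h u v
  have hlow : ∀ (w : ℂ) (u : A.domain), |w.im| * ‖(u : H)‖ ≤ ‖A u - w • (u : H)‖ := by
    intro w u
    have him : (inner ℂ (u : H) (A u)).im = 0 := by
      have h1 := hsymm u u
      have h2 := inner_conj_symm (𝕜 := ℂ) (u : H) (A u)
      rw [h1] at h2
      exact Complex.conj_eq_iff_im.1 h2
    have h3 : (inner ℂ (u : H) (A u - w • (u : H))).im = - (w.im * ‖(u : H)‖ ^ 2) := by
      rw [inner_sub_right, inner_smul_right, inner_self_eq_norm_sq_to_K, Complex.sub_im, him]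
      have : ((‖(u : H)‖ : ℂ) ^ 2) = ((‖(u : H)‖ ^ 2 : ℝ) : ℂ) := by push_cast; rfl
      simp only [Complex.coe_algebraMap]
      rw [this, Complex.im_mul_ofReal]
      ring
    have h4 : |w.im| * ‖(u : H)‖ ^ 2 ≤ ‖(u : H)‖ * ‖A u - w • (u : H)‖ := by
      have h5 := (Complex.abs_im_le_norm (inner ℂ (u : H) (A u - w • (u : H)))).trans
        (norm_inner_le_norm _ _)
      rw [h3, abs_neg, abs_mul, abs_of_nonneg (sq_nonneg ‖(u : H)‖)] at h5
      exact h5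
    rcases (norm_nonneg (u : H)).eq_or_lt with h0 | h0
    · rw [← h0]; simp
    · have : ‖(u : H)‖ * (|w.im| * ‖(u : H)‖) ≤ ‖(u : H)‖ * ‖A u - w • (u : H)‖ := by
        calc _ = |w.im| * ‖(u : H)‖ ^ 2 := by ring
          _ ≤ _ := h4
      exact le_of_mul_le_mul_left this h0
  have hclosed : IsClosed (A.graph : Set (H × H)) := hA.isClosed
  have : CompleteSpace A.graph := hclosed.completeSpace_coe
  let T : A.graph →L[ℂ] H :=
    ((ContinuousLinearMap.snd ℂ H H) - z • (ContinuousLinearMap.fst ℂ H H)).comp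
      A.graph.subtypeL
  have hT : ∀ p : A.graph, T p = p.1.2 - z • p.1.1 := fun p => rfl
  have hTlow : ∀ p : A.graph, |z.im| * ‖p.1.1‖ ≤ ‖T p‖ := by
    rintro ⟨⟨a, b⟩, hp⟩
    obtain ⟨u, hu, hAu⟩ := (LinearPMap.mem_graph_iff _).1 hp
    simp only at hu hAu
    rw [hT]
    simp only
    rw [← hu, ← hAu]
    exact hlow z u
  have hzpos : 0 < |z.im| := abs_pos.2 hz
  have hfst : ∀ p : A.graph, ‖p.1.1‖ ≤ |z.im|⁻¹ * ‖T p‖ := by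
    intro p
    rw [inv_mul_eq_div, le_div_iff₀ hzpos, mul_comm]
    exact hTlow p
  have hsnd : ∀ p : A.graph, ‖p.1.2‖ ≤ (1 + ‖z‖ * |z.im|⁻¹) * ‖T p‖ := by
    intro p
    have h1 : p.1.2 = T p + z • p.1.1 := by rw [hT]; abel
    calc ‖p.1.2‖ ≤ ‖T p‖ + ‖z • p.1.1‖ := by
          conv_lhs => rw [h1]
          exact norm_add_le _ _
      _ ≤ ‖T p‖ + ‖z‖ * (|z.im|⁻¹ * ‖T p‖) := by
          rw [norm_smul]
          have := hfst p
          gcongr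
      _ = _ := by ring
  let K : ℝ := |z.im|⁻¹ + (1 + ‖z‖ * |z.im|⁻¹)
  have hK : 0 ≤ K := by positivity
  have hanti : ∀ p : A.graph, ‖p‖ ≤ K * ‖T p‖ := by
    intro p
    have h1 := hfst p
    have h2 := hsnd p
    have h3 : 0 ≤ |z.im|⁻¹ * ‖T p‖ := by positivity
    have h4 : 0 ≤ (1 + ‖z‖ * |z.im|⁻¹) * ‖T p‖ := by positivity
    have h5 : ‖p‖ = max ‖p.1.1‖ ‖p.1.2‖ := rfl
    rw [h5, add_mul]
    exact max_le (by linarith) (by linarith)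
  have hal : AntilipschitzWith ⟨K, hK⟩ T :=
    ContinuousLinearMap.antilipschitz_of_bound T hanti
  have hrc : IsClosed (Set.range T) := hal.isClosed_range T.uniformContinuous
  have hker : T.ker = ⊥ := LinearMap.ker_eq_bot.2 hal.injective
  have hrange : T.range = ⊤ := by
    have hc : IsClosed (T.range : Set H) := hrc
    have : CompleteSpace T.range := hc.completeSpace_coe
    rw [← Submodule.orthogonal_eq_bot_iff, Submodule.eq_bot_iff]
    intro y hy
    have horth : ∀ u : A.domain, inner ℂ y (A u) = z * inner ℂ y (u : H) := by
      intro u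
      have h1 : inner ℂ (T ⟨((u : H), A u), A.mem_graph u⟩) y = 0 :=
        (Submodule.mem_orthogonal _ _).1 hy _ ⟨_, rfl⟩
      rw [hT] at h1
      have h2 : inner ℂ y (A u - z • (u : H)) = 0 := by
        rw [← inner_conj_symm, h1, map_zero]
      rw [inner_sub_right, inner_smul_right, sub_eq_zero] at h2
      exact h2
    have hw : ∀ u : A.domain, inner ℂ ((starRingEnd ℂ z) • y) (u : H) = inner ℂ y (A u) := by
      intro u
      rw [inner_smul_left, horth u]
      simp
    have hmem : y ∈ A.adjoint.domain := LinearPMap.mem_adjoint_domain_of_exists _ ⟨_, hw⟩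
    have hval : A.adjoint ⟨y, hmem⟩ = (starRingEnd ℂ z) • y :=
      LinearPMap.adjoint_apply_eq hd ⟨y, hmem⟩ hw
    have hg : (y, (starRingEnd ℂ z) • y) ∈ A.graph := by
      rw [← hadj, LinearPMap.mem_graph_iff]
      exact ⟨⟨y, hmem⟩, rfl, hval⟩
    obtain ⟨u, hu, hAu⟩ := (LinearPMap.mem_graph_iff _).1 hg
    have h6 := hlow (starRingEnd ℂ z) u
    simp only at hu hAu
    rw [hAu, hu, sub_self, norm_zero, Complex.conj_im, abs_neg] at h6
    have h7 : ‖y‖ ≤ 0 := by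
      by_contra hcon
      push Not at hcon
      have := mul_pos hzpos hcon
      linarith
    exact norm_le_zero_iff.1 h7
  let e : A.graph ≃L[ℂ] H := ContinuousLinearEquiv.ofBijective T hker hrange
  have he : ∀ p, e p = T p := fun p => rfl
  refine ⟨((ContinuousLinearMap.fst ℂ H H).comp A.graph.subtypeL).comp
    (e.symm : H →L[ℂ] A.graph), ?_, ?_⟩
  · intro x
    have h1 : T (e.symm x) = x := by rw [← he]; exact e.apply_symm_apply x
    have h2 : x + z • (e.symm x).1.1 = (e.symm x).1.2 := by
      rw [hT] at h1
      exact (sub_eq_iff_eq_add.1 h1).symm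
    change ((e.symm x).1.1, x + z • (e.symm x).1.1) ∈ A.graph
    rw [h2]
    exact (e.symm x).2
  · intro u
    have h1 : A u - z • (u : H) = e ⟨((u : H), A u), A.mem_graph u⟩ := rfl
    change (e.symm (A u - z • (u : H))).1.1 = u
    rw [h1, e.symm_apply_apply]

theorem isResolventAt_resolventAt {A : H →ₗ.[ℂ] H} (hA : IsSelfAdjoint A) {z : ℂ}
    (hz : z.im ≠ 0) : IsResolventAt A z (resolventAt A z) :=
  isResolventAt_resolventAt_of_exists (exists_resolvent hA hz)

theorem star_resolventAt {A : H →ₗ.[ℂ] H} (hA : IsSelfAdjoint A) {z : ℂ} (hz : z.im ≠ 0) :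
    star (resolventAt A z) = resolventAt A (starRingEnd ℂ z) := by
  have hz' : (starRingEnd ℂ z).im ≠ 0 := by simpa using hz
  have h1 := isResolventAt_resolventAt hA hz
  have h2 := isResolventAt_resolventAt hA hz'
  set R := resolventAt A z
  set S := resolventAt A (starRingEnd ℂ z)
  have hsymm := LinearPMap.adjoint_isFormalAdjoint (T := A) hA.dense_domain
  rw [show A.adjoint = A from hA] at hsymm
  rw [ContinuousLinearMap.star_eq_adjoint, eq_comm, ContinuousLinearMap.eq_adjoint_iff]
  intro x y
  obtain ⟨u, hu, hAu⟩ := (LinearPMap.mem_graph_iff _).1 (h2.1 x)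
  obtain ⟨v, hv, hAv⟩ := (LinearPMap.mem_graph_iff _).1 (h1.1 y)
  have h := hsymm u v
  simp only at hu hAu hv hAv
  rw [hAu, hAv, hu, hv, inner_add_left, inner_add_right, inner_smul_left, inner_smul_right,
    Complex.conj_conj] at h
  exact (add_right_cancel h).symm

/-- `(A - i)⁻¹ (A + i)⁻¹` is a nonnegative operator. -/
theorem resolvent_mul_resolvent_nonneg {A : H →ₗ.[ℂ] H} (hA : IsSelfAdjoint A) :
    0 ≤ resolventAt A Complex.I * resolventAt A (-Complex.I) := by
  have h := star_resolventAt hA (z := Complex.I) (by simp)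
  rw [Complex.conj_I] at h
  rw [← h]
  exact mul_star_self_nonneg _

/-- `(A - i)⁻¹ (A + i)⁻¹` is the inverse of `1 + A²`. -/
theorem resolvent_mul_resolvent_spec {A : H →ₗ.[ℂ] H} (hA : IsSelfAdjoint A) (x : H) :
    ∃ w : H, ((resolventAt A Complex.I * resolventAt A (-Complex.I)) x, w) ∈ A.graph ∧
      (w, x - (resolventAt A Complex.I * resolventAt A (-Complex.I)) x) ∈ A.graph := by
  have h1 := isResolventAt_resolventAt hA (z := Complex.I) (by simp)
  have h2 := isResolventAt_resolventAt hA (z := -Complex.I) (by simp)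
  set R := resolventAt A Complex.I
  set S := resolventAt A (-Complex.I)
  refine ⟨S x + Complex.I • R (S x), h1.1 (S x), ?_⟩
  have h3 := A.graph.add_mem (h2.1 x) (A.graph.smul_mem Complex.I (h1.1 (S x)))
  convert h3 using 1
  simp only [Prod.smul_mk, Prod.mk_add_mk, Prod.mk.injEq, true_and,
    smul_add, smul_smul, Complex.I_mul_I, mul_apply_eq_comp]
  module

end Unbounded

section Scale

variable {H : Type*} [NormedAddCommGroup H] [InnerProductSpace ℂ H] [CompleteSpace H]

/-- The bounded operator `(1 + A²)^(-s/2)` for `s ≥ 0`, where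
`(1 + A²)⁻¹ = (A - i)⁻¹ (A + i)⁻¹`; the power is that of the continuous functional calculus. -/
def invJapanesePow (A : H →ₗ.[ℂ] H) (s : ℝ) : H →L[ℂ] H :=
  (resolventAt A Complex.I * resolventAt A (-Complex.I)) ^ (s / 2)

/-- The space `H_s(A)` for `s ≥ 0`, the domain of `(1 + A²)^(s/2)`, which is the domain
of `|A|^s`. -/
def sobolevSpace (A : H →ₗ.[ℂ] H) (s : ℝ) : Submodule ℂ H :=
  (invJapanesePow A s).range

/-- `H_∞(A)`, the intersection of all `H_s(A)`. -/
def smoothSpace (A : H →ₗ.[ℂ] H) : Submodule ℂ H :=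
  ⨅ (s : ℝ) (_ : 0 ≤ s), sobolevSpace A s

/-- The norm `‖x‖_s = ‖(1 + A²)^(s/2) x‖` of `H_s(A)`, used for `x ∈ H_∞(A)` and all real `s`.
For `s ≥ 0` it is the norm of the unique `y` with `(1 + A²)^(-s/2) y = x`; this is equivalent
to the graph norm of `|A|^s`. For `s < 0` it is the dual norm of `H_{-s}(A)` with respect
to the inner product of `H`. -/
def scaleNorm (A : H →ₗ.[ℂ] H) (s : ℝ) (x : H) : ℝ :=
  if 0 ≤ s then sInf {r : ℝ | ∃ y : H, invJapanesePow A s y = x ∧ r = ‖y‖}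
  else ‖invJapanesePow A (-s) x‖

/-- The linear map `B : H_∞ → H_∞` is an operator of order `μ` on the scale `(H_s(A))`. -/
def HasOrder (A : H →ₗ.[ℂ] H) (μ : ℝ) (B : smoothSpace A →ₗ[ℂ] smoothSpace A) : Prop :=
  ∀ s : ℝ, ∃ C : ℝ, ∀ x : smoothSpace A, scaleNorm A s (B x) ≤ C * scaleNorm A (s + μ) x

/-- `Op⁰(A)`: the operators of order `0` on the scale, each identified with its continuous
extension to a bounded operator in `H = H_0`. -/
def OpZero (A : H →ₗ.[ℂ] H) : Set (H →L[ℂ] H) :=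
  {T | ∃ B : smoothSpace A →ₗ[ℂ] smoothSpace A, HasOrder A 0 B ∧
    ∀ x : smoothSpace A, T (x : H) = (B x : H)}

/-- The bounded self-adjoint operator `A (1 + A²)⁻¹ = ((A - i)⁻¹ + (A + i)⁻¹) / 2`. -/
def boundedSign (A : H →ₗ.[ℂ] H) : H →L[ℂ] H :=
  (1 / 2 : ℂ) • (resolventAt A Complex.I + resolventAt A (-Complex.I))

theorem isSelfAdjoint_boundedSign {A : H →ₗ.[ℂ] H} (hA : IsSelfAdjoint A) :
    IsSelfAdjoint (boundedSign A) := by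
  have h1 := star_resolventAt hA (z := Complex.I) (by simp)
  have h2 := star_resolventAt hA (z := -Complex.I) (by simp)
  rw [Complex.conj_I] at h1
  rw [map_neg, Complex.conj_I, neg_neg] at h2
  rw [isSelfAdjoint_iff, boundedSign, star_smul, star_add, h1, h2, add_comm]
  simp

/-- The spectral projection `P_{(0,∞)}(A)`. As `λ / (1 + λ²)` is positive exactly for `λ > 0`,
this is the projection `P_{(0,∞)}(G)` of `G = A (1 + A²)⁻¹`, i.e. the orthogonal projection onto
the closure of the range of the positive part `G⁺`. -/
def positiveProj (A : H →ₗ.[ℂ] H) : H →L[ℂ] H :=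
  ((boundedSign A)⁺).range.topologicalClosure.starProjection

/-- The spectral projection `P_{[0,∞)}(A) = I - P_{(-∞,0)}(A)`: the orthogonal projection onto
the kernel of the negative part `G⁻` of `G = A (1 + A²)⁻¹`. -/
def nonnegProj (A : H →ₗ.[ℂ] H) : H →L[ℂ] H :=
  ((boundedSign A)⁻).ker.starProjection

/-- The pair `(P, Q)` of projections is a Fredholm pair: the map `Q : P(H) → Q(H)` is
Fredholm. -/
def IsFredholmPair (P Q : H →L[ℂ] H) : Prop :=
  ((Q.comp P.range.subtypeL).codRestrict Q.range
    (fun _ => LinearMap.mem_range_self _ _)).IsFredholm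

end Scale

section HolomorphicCalculus

/-- `c` is a Cauchy cycle for `K` in `U`: a finite family of closed `C¹` curves
(parametrized by `[0,1]`) in `U \ K` whose total winding number is `1` about each point
of `K` and `0` about each point outside `U`. -/
structure IsCauchyCycle (K U : Set ℂ) {n : ℕ} (c : Fin n → ℝ → ℂ) : Prop where
  contDiff : ∀ j, ContDiff ℝ 1 (c j)
  closed : ∀ j, c j 0 = c j 1
  mapsTo : ∀ j, ∀ t ∈ Icc (0 : ℝ) 1, c j t ∈ U \ K
  winding_one : ∀ w ∈ K,
    (2 * Real.pi * Complex.I)⁻¹ * ∑ j, ∫ t in (0 : ℝ)..1, deriv (c j) t / (c j t - w) = 1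
  winding_zero : ∀ w ∉ U,
    (2 * Real.pi * Complex.I)⁻¹ * ∑ j, ∫ t in (0 : ℝ)..1, deriv (c j) t / (c j t - w) = 0

variable {H : Type*} [NormedAddCommGroup H] [InnerProductSpace ℂ H]

/-- The Cauchy integral `(2πi)⁻¹ ∫_c f(z) (z - B)⁻¹ dz`. -/
def cauchyIntegral (B : H →L[ℂ] H) (f : ℂ → ℂ) {n : ℕ} (c : Fin n → ℝ → ℂ) : H →L[ℂ] H :=
  (2 * Real.pi * Complex.I)⁻¹ •
    ∑ j, ∫ t in (0 : ℝ)..1, (deriv (c j) t * f (c j t)) • resolvent B (c j t)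

/-- The set `S` of bounded operators has holomorphic functional calculus: `f(B) ∈ S` for every
`B ∈ S` and every `f` holomorphic in a neighbourhood `U` of the spectrum of `B` in `ℒ(H)`. -/
def HasHolomorphicCalculus (S : Set (H →L[ℂ] H)) : Prop :=
  ∀ B ∈ S, ∀ (U : Set ℂ) (f : ℂ → ℂ), IsOpen U → spectrum ℂ B ⊆ U → DifferentiableOn ℂ f U →
    ∀ (n : ℕ) (c : Fin n → ℝ → ℂ), IsCauchyCycle (spectrum ℂ B) U c → cauchyIntegral B f c ∈ S

end HolomorphicCalculus

section ModelOperator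

/-- A function on `[0,∞)` that is continuous on `[0,∞)` and vanishes near infinity
is in `L²(ℝ₊)`. -/
theorem memLp_of_continuousOn {E : Type*} [NormedAddCommGroup E] {f : ℝ → E} (hf : ContinuousOn f (Ici 0)) {b : ℝ}
    (hb : ∀ x, b ≤ x → f x = 0) : MemLp f 2 (volume.restrict (Ioi (0 : ℝ))) := by
  have hm : AEStronglyMeasurable f (volume.restrict (Ioi (0 : ℝ))) :=
    (hf.mono Ioi_subset_Ici_self).aestronglyMeasurable measurableSet_Ioi
  obtain ⟨C, hC⟩ := (isCompact_Icc (a := (0 : ℝ)) (b := b)).exists_bound_of_continuousOn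
    (hf.mono Icc_subset_Ici_self)
  have hg : MemLp ((Icc (0 : ℝ) b).indicator (fun _ => C)) 2
      (volume.restrict (Ioi (0 : ℝ))) := by
    refine memLp_indicator_const 2 measurableSet_Icc C (Or.inr ?_)
    exact ((Measure.restrict_apply_le _ _).trans_lt (by simp)).ne
  refine hg.mono hm ?_
  filter_upwards [ae_restrict_mem measurableSet_Ioi] with x hx
  by_cases hxb : x ≤ b
  · have hxm : x ∈ Icc (0 : ℝ) b := ⟨le_of_lt hx, hxb⟩
    rw [indicator_of_mem hxm]
    exact (hC x hxm).trans (le_abs_self C)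
  · rw [hb x (le_of_not_ge hxb), norm_zero]
    exact norm_nonneg _

variable {H : Type*} [NormedAddCommGroup H] [InnerProductSpace ℂ H]

/-- `L²(ℝ₊, H)`. -/
abbrev L2Half (H : Type*) [NormedAddCommGroup H] : Type _ :=
  Lp H 2 (volume.restrict (Ioi (0 : ℝ)))

/-- `F ∈ C₀^∞(ℝ₊, H₁)`: smooth on `[0,∞)` up to the boundary, with compact support in `[0,∞)`.
The space `H₁ = 𝒟(A)` with its graph norm is represented by the graph of `A`, so that
`F x = (f x, A (f x))`. -/
structure IsTestFunction (A : H →ₗ.[ℂ] H) (F : ℝ → A.graph) : Prop where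
  smooth : ContDiffOn ℝ ∞ F (Ici 0)
  compact_support : ∃ b : ℝ, ∀ x, b ≤ x → F x = 0

/-- The `H`-valued function `f` underlying `F = (f, A f)`. -/
def baseFun {A : H →ₗ.[ℂ] H} (F : ℝ → A.graph) (x : ℝ) : H := (F x).1.1

/-- The function `γ (f' + A f)`, where `F = (f, A f)`. -/
def diracFun (γ : H →L[ℂ] H) {A : H →ₗ.[ℂ] H} (F : ℝ → A.graph) (x : ℝ) : H :=
  γ (derivWithin (baseFun F) (Ici 0) x + (F x).1.2)

theorem IsTestFunction.add {A : H →ₗ.[ℂ] H} {F G : ℝ → A.graph} (hF : IsTestFunction A F)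
    (hG : IsTestFunction A G) : IsTestFunction A (F + G) := by
  obtain ⟨a, ha⟩ := hF.compact_support
  obtain ⟨b, hb⟩ := hG.compact_support
  refine ⟨hF.smooth.add hG.smooth, max a b, fun x hx => ?_⟩
  rw [Pi.add_apply, ha x ((le_max_left _ _).trans hx), hb x ((le_max_right _ _).trans hx),
    add_zero]

theorem IsTestFunction.smul {A : H →ₗ.[ℂ] H} {F : ℝ → A.graph} (hF : IsTestFunction A F)
    (c : ℂ) : IsTestFunction A (c • F) := by
  obtain ⟨a, ha⟩ := hF.compact_support
  refine ⟨hF.smooth.const_smul c, a, fun x hx => ?_⟩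
  rw [Pi.smul_apply, ha x hx, smul_zero]

theorem IsTestFunction.contDiffOn_baseFun {A : H →ₗ.[ℂ] H} {F : ℝ → A.graph}
    (hF : IsTestFunction A F) : ContDiffOn ℝ ∞ (baseFun F) (Ici 0) :=
  ((((ContinuousLinearMap.fst ℂ H H).comp A.graph.subtypeL).restrictScalars
    ℝ).contDiff).comp_contDiffOn hF.smooth

theorem IsTestFunction.contDiffOn_snd {A : H →ₗ.[ℂ] H} {F : ℝ → A.graph}
    (hF : IsTestFunction A F) : ContDiffOn ℝ ∞ (fun x => (F x).1.2) (Ici 0) :=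
  ((((ContinuousLinearMap.snd ℂ H H).comp A.graph.subtypeL).restrictScalars
    ℝ).contDiff).comp_contDiffOn hF.smooth

theorem IsTestFunction.differentiableWithinAt {A : H →ₗ.[ℂ] H} {F : ℝ → A.graph}
    (hF : IsTestFunction A F) {x : ℝ} (hx : x ∈ Ici (0 : ℝ)) :
    DifferentiableWithinAt ℝ (baseFun F) (Ici 0) x :=
  (hF.contDiffOn_baseFun.differentiableOn (by simp)) x hx

/-- The graph of `D_P = γ (d/dx + A)` with domain `{f ∈ C₀^∞(ℝ₊, H₁) | P f(0) = 0}`. -/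
def modelGraph (γ : H →L[ℂ] H) (A : H →ₗ.[ℂ] H) (P : H →L[ℂ] H) :
    Submodule ℂ (L2Half H × L2Half H) where
  carrier := {p | ∃ F : ℝ → A.graph, IsTestFunction A F ∧ P (baseFun F 0) = 0 ∧
    p.1 =ᵐ[volume.restrict (Ioi (0 : ℝ))] baseFun F ∧
    p.2 =ᵐ[volume.restrict (Ioi (0 : ℝ))] diracFun γ F}
  zero_mem' := by
    refine ⟨0, ⟨contDiffOn_const, 0, fun _ _ => rfl⟩, by simp [baseFun], ?_, ?_⟩
    · exact Lp.coeFn_zero _ _ _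
    · filter_upwards [Lp.coeFn_zero H 2 (volume.restrict (Ioi (0 : ℝ)))] with x hx
      have : baseFun (0 : ℝ → A.graph) = fun _ => (0 : H) := rfl
      change ((0 : L2Half H) : ℝ → H) x = _
      rw [hx, diracFun, this]
      simp
  add_mem' := by
    rintro p q ⟨F, hF, hF0, hF1, hF2⟩ ⟨G, hG, hG0, hG1, hG2⟩
    have hb : baseFun (F + G) = baseFun F + baseFun G := rfl
    refine ⟨F + G, hF.add hG, ?_, ?_, ?_⟩
    · rw [hb, Pi.add_apply, map_add, hF0, hG0, add_zero]
    · filter_upwards [Lp.coeFn_add p.1 q.1, hF1, hG1] with x h1 h2 h3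
      change (p.1 + q.1 : L2Half H) x = _
      rw [h1, hb, Pi.add_apply, h2, h3]
      rfl
    · filter_upwards [Lp.coeFn_add p.2 q.2, hF2, hG2, ae_restrict_mem measurableSet_Ioi]
        with x h1 h2 h3 hx
      have hx' : x ∈ Ici (0 : ℝ) := Ioi_subset_Ici_self hx
      change (p.2 + q.2 : L2Half H) x = _
      rw [h1, Pi.add_apply, h2, h3, diracFun, diracFun, diracFun, hb,
        derivWithin_add (hF.differentiableWithinAt hx') (hG.differentiableWithinAt hx'),
        ← map_add]
      congr 1
      simp only [Pi.add_apply, Submodule.coe_add, Prod.snd_add]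
      abel
  smul_mem' := by
    rintro c p ⟨F, hF, hF0, hF1, hF2⟩
    have hb : baseFun (c • F) = c • baseFun F := rfl
    refine ⟨c • F, hF.smul c, ?_, ?_, ?_⟩
    · rw [hb, Pi.smul_apply, map_smul, hF0, smul_zero]
    · filter_upwards [Lp.coeFn_smul c p.1, hF1] with x h1 h2
      change (c • p.1 : L2Half H) x = _
      rw [h1, hb, Pi.smul_apply, h2]
      rfl
    · filter_upwards [Lp.coeFn_smul c p.2, hF2, ae_restrict_mem measurableSet_Ioi]
        with x h1 h2 hx
      have hx' : x ∈ Ici (0 : ℝ) := Ioi_subset_Ici_self hx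
      change (c • p.2 : L2Half H) x = _
      rw [h1, Pi.smul_apply, h2, diracFun, diracFun, hb,
        derivWithin_const_smul c (hF.differentiableWithinAt hx'), ← map_smul]
      congr 1
      simp only [Pi.smul_apply, Submodule.coe_smul, Prod.smul_snd, smul_add]

theorem modelGraph_singleValued (γ : H →L[ℂ] H) (A : H →ₗ.[ℂ] H) (P : H →L[ℂ] H)
    (p : L2Half H × L2Half H) (hp : p ∈ modelGraph γ A P) (h0 : p.1 = 0) : p.2 = 0 := by
  obtain ⟨F, hF, -, h1, h2⟩ := hp
  have hz : (fun _ => (0 : H)) =ᵐ[volume.restrict (Ioi (0 : ℝ))] baseFun F := by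
    rw [h0] at h1
    exact (Lp.coeFn_zero _ _ _).symm.trans h1
  have hEq : EqOn (fun _ => (0 : H)) (baseFun F) (Ioi 0) :=
    Measure.eqOn_open_of_ae_eq hz isOpen_Ioi continuousOn_const
      (hF.contDiffOn_baseFun.continuousOn.mono Ioi_subset_Ici_self)
  refine (Lp.eq_zero_iff_ae_eq_zero).2 ?_
  filter_upwards [h2, ae_restrict_mem measurableSet_Ioi] with x hx hx0
  have hd : derivWithin (baseFun F) (Ici 0) x = 0 := by
    have hn : Ici (0 : ℝ) ∈ 𝓝 x := Ici_mem_nhds hx0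
    rw [derivWithin_of_mem_nhds hn]
    have he : baseFun F =ᶠ[𝓝 x] fun _ => (0 : H) := by
      filter_upwards [Ioi_mem_nhds hx0] with y hy
      exact (hEq hy).symm
    rw [he.deriv_eq]
    simp
  have hs : (F x).1.2 = 0 := A.graph_fst_eq_zero_snd (F x).2 (hEq hx0).symm
  rw [hx, diracFun, hd, hs]
  simp

/-- The operator `D_P = γ (d/dx + A)` in `L²(ℝ₊, H)` with domain
`{f ∈ C₀^∞(ℝ₊, H₁) | P f(0) = 0}`. -/
def modelOp (γ : H →L[ℂ] H) (A : H →ₗ.[ℂ] H) (P : H →L[ℂ] H) :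
    L2Half H →ₗ.[ℂ] L2Half H :=
  (modelGraph γ A P).toLinearPMap

theorem modelOp_graph (γ : H →L[ℂ] H) (A : H →ₗ.[ℂ] H) (P : H →L[ℂ] H) :
    (modelOp γ A P).graph = modelGraph γ A P :=
  Submodule.toLinearPMap_graph_eq _ (modelGraph_singleValued γ A P)

/-- Every `f ∈ C₀^∞(ℝ₊, H₁)` with `P f(0) = 0` belongs to the domain of `D_P`. -/
theorem IsTestFunction.exists_mem_domain (γ : H →L[ℂ] H) {A : H →ₗ.[ℂ] H} (P : H →L[ℂ] H)
    {F : ℝ → A.graph} (hF : IsTestFunction A F) (h0 : P (baseFun F 0) = 0) :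
    ∃ u ∈ (modelOp γ A P).domain, u =ᵐ[volume.restrict (Ioi (0 : ℝ))] baseFun F := by
  obtain ⟨b, hb⟩ := hF.compact_support
  have h1 : MemLp (baseFun F) 2 (volume.restrict (Ioi (0 : ℝ))) :=
    memLp_of_continuousOn hF.contDiffOn_baseFun.continuousOn
      (b := b) (fun x hx => by simp [baseFun, hb x hx])
  have h2 : MemLp (diracFun γ F) 2 (volume.restrict (Ioi (0 : ℝ))) := by
    refine memLp_of_continuousOn (b := max b 0 + 1) ?_ ?_
    · refine γ.continuous.comp_continuousOn (ContinuousOn.add ?_ hF.contDiffOn_snd.continuousOn)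
      exact hF.contDiffOn_baseFun.continuousOn_derivWithin (uniqueDiffOn_Ici 0) (by simp)
    · intro x hx
      have hxb : b < x := by linarith [le_max_left b 0]
      have hx0 : 0 < x := by linarith [le_max_right b 0]
      have he : baseFun F =ᶠ[𝓝 x] fun _ => (0 : H) := by
        filter_upwards [Ioi_mem_nhds hxb] with y hy
        simp [baseFun, hb y (le_of_lt hy)]
      rw [diracFun, derivWithin_of_mem_nhds (Ici_mem_nhds hx0), he.deriv_eq, hb x hxb.le]
      simp
  refine ⟨h1.toLp _, ?_, h1.coeFn_toLp⟩
  exact ⟨(h1.toLp _, h2.toLp _), ⟨F, hF, h0, h1.coeFn_toLp, h2.coeFn_toLp⟩, rfl⟩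

/-- `g` is the weak derivative of `f` on `(0,∞)`. -/
def HasWeakDeriv (f g : L2Half H) : Prop :=
  ∀ φ : ℝ → ℝ, ContDiff ℝ ∞ φ → HasCompactSupport φ → tsupport φ ⊆ Ioi 0 →
    ∫ x in Ioi (0 : ℝ), deriv φ x • f x = - ∫ x in Ioi (0 : ℝ), φ x • g x

/-- `f ∈ L²(ℝ₊, H₁)` and `A f = h`, with `h ∈ L²(ℝ₊, H)`. -/
def IsPointwiseImage (A : H →ₗ.[ℂ] H) (f h : L2Half H) : Prop :=
  ∀ᵐ x ∂(volume.restrict (Ioi (0 : ℝ))), (f x, h x) ∈ A.graph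

/-- The continuous representative of `f` on `[0,∞)` exists and takes the value `v` at `0`. -/
def HasBoundaryValue (f : L2Half H) (v : H) : Prop :=
  ∃ F : ℝ → H, ContinuousOn F (Ici 0) ∧ f =ᵐ[volume.restrict (Ioi (0 : ℝ))] F ∧ F 0 = v

/-- `ℋ₁(ℝ₊, A) = L²(ℝ₊, H₁) ∩ H¹(ℝ₊, H)`: the `f ∈ L²(ℝ₊, H)` with weak derivative
in `L²(ℝ₊, H)` and with `A f ∈ L²(ℝ₊, H)`. -/
def sobolevOne (A : H →ₗ.[ℂ] H) : Set (L2Half H) :=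
  {f | (∃ g, HasWeakDeriv f g) ∧ ∃ h, IsPointwiseImage A f h}

/-- `{f ∈ ℋ₁(ℝ₊, A) | P f(0) = 0}`. -/
def sobolevDomain (A : H →ₗ.[ℂ] H) (P : H →L[ℂ] H) : Set (L2Half H) :=
  {f | f ∈ sobolevOne A ∧ ∃ v, HasBoundaryValue f v ∧ P v = 0}

theorem integrable_smul_of_test {φ : ℝ → ℝ} (h1 : Continuous φ) (h2 : HasCompactSupport φ)
    (f : L2Half H) :
    Integrable (fun x => φ x • f x) (volume.restrict (Ioi (0 : ℝ))) :=
  ((Lp.memLp f).locallyIntegrable (by norm_num)).integrable_smul_left_of_hasCompactSupport h1 h2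

theorem HasWeakDeriv.add {f g f' g' : L2Half H} (hf : HasWeakDeriv f f')
    (hg : HasWeakDeriv g g') : HasWeakDeriv (f + g) (f' + g') := by
  intro φ h1 h2 h3
  have hd : Continuous (deriv φ) := h1.continuous_deriv (by simp)
  have e1 : ∫ x in Ioi (0 : ℝ), deriv φ x • (f + g : L2Half H) x =
      ∫ x in Ioi (0 : ℝ), (deriv φ x • f x + deriv φ x • g x) := by
    refine integral_congr_ae ?_
    filter_upwards [Lp.coeFn_add f g] with x hx
    rw [hx, Pi.add_apply, smul_add]
  have e2 : ∫ x in Ioi (0 : ℝ), φ x • (f' + g' : L2Half H) x =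
      ∫ x in Ioi (0 : ℝ), (φ x • f' x + φ x • g' x) := by
    refine integral_congr_ae ?_
    filter_upwards [Lp.coeFn_add f' g'] with x hx
    rw [hx, Pi.add_apply, smul_add]
  rw [e1, e2, integral_add (integrable_smul_of_test hd h2.deriv f)
      (integrable_smul_of_test hd h2.deriv g),
    integral_add (integrable_smul_of_test h1.continuous h2 f')
      (integrable_smul_of_test h1.continuous h2 g'), hf φ h1 h2 h3, hg φ h1 h2 h3, neg_add]

theorem HasWeakDeriv.smul {f f' : L2Half H} (hf : HasWeakDeriv f f') (c : ℂ) :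
    HasWeakDeriv (c • f) (c • f') := by
  intro φ h1 h2 h3
  have e1 : ∫ x in Ioi (0 : ℝ), deriv φ x • (c • f : L2Half H) x =
      ∫ x in Ioi (0 : ℝ), c • (deriv φ x • f x) := by
    refine integral_congr_ae ?_
    filter_upwards [Lp.coeFn_smul c f] with x hx
    rw [hx, Pi.smul_apply, smul_comm]
  have e2 : ∫ x in Ioi (0 : ℝ), φ x • (c • f' : L2Half H) x =
      ∫ x in Ioi (0 : ℝ), c • (φ x • f' x) := by
    refine integral_congr_ae ?_
    filter_upwards [Lp.coeFn_smul c f'] with x hx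
    rw [hx, Pi.smul_apply, smul_comm]
  rw [e1, e2, integral_smul, integral_smul, hf φ h1 h2 h3, smul_neg]

theorem HasWeakDeriv.eq_zero [CompleteSpace H] {f' : L2Half H} (hf : HasWeakDeriv 0 f') :
    f' = 0 := by
  have hloc : LocallyIntegrable f' (volume.restrict (Ioi (0 : ℝ))) :=
    (Lp.memLp f').locallyIntegrable (by norm_num)
  have h := isOpen_Ioi.ae_eq_zero_of_integral_contDiff_smul_eq_zero (U := Ioi (0 : ℝ))
    (μ := volume.restrict (Ioi (0 : ℝ))) (hloc.locallyIntegrableOn _) (fun φ h1 h2 h3 => by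
      have h4 := hf φ h1 h2 h3
      have h5 : ∫ x in Ioi (0 : ℝ), deriv φ x • (0 : L2Half H) x = 0 := by
        rw [← integral_zero ℝ H (μ := volume.restrict (Ioi (0 : ℝ)))]
        refine integral_congr_ae ?_
        filter_upwards [Lp.coeFn_zero H 2 (volume.restrict (Ioi (0 : ℝ)))] with x hx
        rw [hx]
        simp
      rw [h5] at h4
      exact neg_eq_zero.1 h4.symm)
  refine (Lp.eq_zero_iff_ae_eq_zero).2 ?_
  filter_upwards [h, ae_restrict_mem measurableSet_Ioi] with x hx hx0
  exact hx hx0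

/-- The graph of `γ (d/dx + A)` with domain `{f ∈ ℋ₁(ℝ₊, A) | P f(0) = 0}`. -/
def sobolevGraph (γ : H →L[ℂ] H) (A : H →ₗ.[ℂ] H) (P : H →L[ℂ] H) :
    Submodule ℂ (L2Half H × L2Half H) where
  carrier := {p | ∃ f' h : L2Half H, HasWeakDeriv p.1 f' ∧ IsPointwiseImage A p.1 h ∧
    (∃ v, HasBoundaryValue p.1 v ∧ P v = 0) ∧ p.2 = γ.compLp (f' + h)}
  zero_mem' := by
    have h0 := Lp.coeFn_zero H 2 (volume.restrict (Ioi (0 : ℝ)))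
    refine ⟨0, 0, ?_, ?_, ⟨0, ⟨0, continuousOn_const, h0, rfl⟩, map_zero _⟩, ?_⟩
    · intro φ h1 h2 h3
      have e1 : ∫ x in Ioi (0 : ℝ), deriv φ x • (0 : L2Half H) x = 0 := by
        rw [← integral_zero ℝ H (μ := volume.restrict (Ioi (0 : ℝ)))]
        refine integral_congr_ae ?_
        filter_upwards [h0] with x hx
        rw [hx]
        simp
      have e2 : ∫ x in Ioi (0 : ℝ), φ x • (0 : L2Half H) x = 0 := by
        rw [← integral_zero ℝ H (μ := volume.restrict (Ioi (0 : ℝ)))]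
        refine integral_congr_ae ?_
        filter_upwards [h0] with x hx
        rw [hx]
        simp
      change ∫ x in Ioi (0 : ℝ), deriv φ x • (0 : L2Half H) x = _
      rw [e1, e2, neg_zero]
    · filter_upwards [h0] with x hx
      change ((0 : L2Half H) x, (0 : L2Half H) x) ∈ A.graph
      rw [hx]
      exact A.graph.zero_mem
    · change (0 : L2Half H) = _
      rw [add_zero]
      exact (map_zero (γ.compLpₗ 2 (volume.restrict (Ioi (0 : ℝ))))).symm
  add_mem' := by
    rintro p q ⟨f', h, hf, hh, ⟨v, ⟨F, hF, hF', hFv⟩, hv⟩, hp⟩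
      ⟨g', k, hg, hk, ⟨w, ⟨G, hG, hG', hGw⟩, hw⟩, hq⟩
    refine ⟨f' + g', h + k, hf.add hg, ?_, ⟨v + w, ⟨F + G, hF.add hG, ?_, ?_⟩, ?_⟩, ?_⟩
    · filter_upwards [hh, hk, Lp.coeFn_add p.1 q.1, Lp.coeFn_add h k] with x h1 h2 h3 h4
      change ((p.1 + q.1 : L2Half H) x, _) ∈ _
      rw [h3, h4]
      exact A.graph.add_mem h1 h2
    · filter_upwards [hF', hG', Lp.coeFn_add p.1 q.1] with x h1 h2 h3
      change (p.1 + q.1 : L2Half H) x = _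
      rw [h3, Pi.add_apply, Pi.add_apply, h1, h2]
    · rw [Pi.add_apply, hFv, hGw]
    · rw [map_add, hv, hw, add_zero]
    · change p.2 + q.2 = _
      rw [hp, hq, add_add_add_comm]
      exact (map_add (γ.compLpₗ 2 (volume.restrict (Ioi (0 : ℝ)))) _ _).symm
  smul_mem' := by
    rintro c p ⟨f', h, hf, hh, ⟨v, ⟨F, hF, hF', hFv⟩, hv⟩, hp⟩
    refine ⟨c • f', c • h, hf.smul c, ?_, ⟨c • v, ⟨c • F, hF.const_smul c, ?_, ?_⟩, ?_⟩, ?_⟩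
    · filter_upwards [hh, Lp.coeFn_smul c p.1, Lp.coeFn_smul c h] with x h1 h3 h4
      change ((c • p.1 : L2Half H) x, _) ∈ _
      rw [h3, h4]
      exact A.graph.smul_mem c h1
    · filter_upwards [hF', Lp.coeFn_smul c p.1] with x h1 h3
      change (c • p.1 : L2Half H) x = _
      rw [h3, Pi.smul_apply, Pi.smul_apply, h1]
    · rw [Pi.smul_apply, hFv]
    · rw [map_smul, hv, smul_zero]
    · change c • p.2 = _
      rw [hp, ← smul_add]
      exact (map_smul (γ.compLpₗ 2 (volume.restrict (Ioi (0 : ℝ)))) _ _).symm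

theorem sobolevGraph_singleValued [CompleteSpace H] (γ : H →L[ℂ] H) (A : H →ₗ.[ℂ] H)
    (P : H →L[ℂ] H) (p : L2Half H × L2Half H) (hp : p ∈ sobolevGraph γ A P) (h0 : p.1 = 0) :
    p.2 = 0 := by
  obtain ⟨f', h, hf, hh, -, h2⟩ := hp
  rw [h0] at hf
  have h3 : h = 0 := by
    refine (Lp.eq_zero_iff_ae_eq_zero).2 ?_
    filter_upwards [hh, Lp.coeFn_zero H 2 (volume.restrict (Ioi (0 : ℝ)))] with x h1 h4
    rw [h0] at h1
    exact A.graph_fst_eq_zero_snd h1 h4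
  rw [h2, hf.eq_zero, h3, add_zero]
  exact map_zero (γ.compLpₗ 2 (volume.restrict (Ioi (0 : ℝ))))

/-- The operator `γ (d/dx + A)` in `L²(ℝ₊, H)`, with the weak derivative, on the domain
`{f ∈ ℋ₁(ℝ₊, A) | P f(0) = 0}`. -/
def sobolevOp (γ : H →L[ℂ] H) (A : H →ₗ.[ℂ] H) (P : H →L[ℂ] H) :
    L2Half H →ₗ.[ℂ] L2Half H :=
  (sobolevGraph γ A P).toLinearPMap

theorem sobolevOp_graph [CompleteSpace H] (γ : H →L[ℂ] H) (A : H →ₗ.[ℂ] H) (P : H →L[ℂ] H) :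
    (sobolevOp γ A P).graph = sobolevGraph γ A P :=
  Submodule.toLinearPMap_graph_eq _ (sobolevGraph_singleValued γ A P)

theorem sobolevOp_domain (γ : H →L[ℂ] H) (A : H →ₗ.[ℂ] H) (P : H →L[ℂ] H) :
    ((sobolevOp γ A P).domain : Set (L2Half H)) = sobolevDomain A P := by
  ext u
  constructor
  · rintro ⟨p, ⟨f', h, hf, hh, hv, -⟩, rfl⟩
    exact ⟨⟨⟨f', hf⟩, ⟨h, hh⟩⟩, hv⟩
  · rintro ⟨⟨⟨f', hf⟩, ⟨h, hh⟩⟩, hv⟩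
    exact ⟨(u, γ.compLp (f' + h)), ⟨f', h, hf, hh, hv, rfl⟩, rfl⟩

end ModelOperator

end ModelOp

end

/-!
Write `j = (1 + A²)^(-1/4)`, `J = j²` and `Λ = A (1 + A²)^(-1/2)`, so that `A = Λ J⁻¹` and all
analysis takes place with bounded operators (`BoundedTransform`, `ModelData`). The range of `j` is
`H_{1/2}`, that of `J` is `H_1`, and `H_{-1/2}` is represented by `H` itself, `v` standing for
`j⁻¹ v`. An element of `Ψ` induces operators on `H_{-1/2}` and `H_{1/2}`, by
`exists_mul_quarterPow_eq` and `exists_quarterPow_mul_eq`.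

For both parts, Green's formula (`ModelData.green`) gives the boundary form `⟪γ v, w⟫`, and the
elements of `ℋ₁` have their boundary values in `H_{1/2}` (`HasTrace.exists_quarterPow_eq`).
A function `u` in the domain of the adjoint of `D_P` solves `u' + A u = h` weakly
(`MaxSolution`), with a boundary value in `H_{-1/2}` only. By an energy identity, `u` is in
`ℋ₁` as soon as its boundary value `v` is regular enough (`MaxSolution.exists_lift_eq`); the part
of `v` where `A ≤ 0` always is (`ModelData.exists_sq_eq_of_nonpos`).

Part (1). Let `Q = P_+(A)`. The boundary condition says `P v = 0` in `H_{-1/2}`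
(`ModelData.flat_apply_eq_zero`), so that `S = Q P Q + (1 - Q)` maps `Q v` into `H_{1/2}`. Since
`(P, Q)` is a Fredholm pair, `S ≥ 0` has a finite-dimensional kernel and a spectral gap at `0`
(`IsFredholmPair.exists_gap`). Its pseudo-inverse is the Cauchy integral of the function that is
`0` near `0` and `z⁻¹` near the rest of the spectrum, hence lies in `Ψ` (`exists_pseudoInverse`),
and the projection onto `ker S` is smoothing. Therefore `Q v` is in `H_{1/2}`
(`exists_sq_eq_of_gap`), `u` is in `ℋ₁`, and the adjoint of `D_P` is the symmetric operator on
`{f ∈ ℋ₁ | P f(0) = 0}`, which is then the closure of `D_P`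
(`isEssentiallySelfAdjoint_of_adjoint_le`).

Part (2). Self-adjointness makes `ker P` a Lagrangian subspace for `⟪γ v, w⟫`, whence
`γ* P γ = 1 - P` (`ModelData.star_mul_mul_eq`). Each element of `H_{-1/2}` in the range of `Q` is
the boundary value of a maximal solution, and Green's formula for such solutions shows that `S`
is regular: `y ∈ H_{-1/2}` and `S y ∈ H_{1/2}` imply `y ∈ H_{1/2}`
(`ModelData.exists_sq_eq_of_folded`). As `A` is discrete, `J` is compact; regularity and
compactness make `S + F` invertible on `H_{1/2}`, for some `F` of finite rank, and by
a theorem of Lax on symmetrizable operators also on `H` (`exists_isUnit_add_of_regular`). Then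
`T T*` is invertible up to finite rank for `T = Q : P(H) → Q(H)`, and `γ` turns `ker T` into a
subspace of `ker S`, so that `T` is Fredholm (`isFredholmPair_of_isUnit`).
-/

noncomputable section

set_option linter.unusedSectionVars false

namespace ModelOp

/-! ### Products of primitives of integrable functions -/

section AbsCont

variable {X Y : Type*} [PseudoMetricSpace X] [PseudoMetricSpace Y]

theorem absCont_of_dist_le {f : ℝ → X} {Φ : ℝ → Y} {a b : ℝ}
    (hΦ : AbsolutelyContinuousOnInterval Φ a b)
    (h : ∀ x ∈ uIcc a b, ∀ y ∈ uIcc a b, dist (f x) (f y) ≤ dist (Φ x) (Φ y)) :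
    AbsolutelyContinuousOnInterval f a b := by
  rw [absolutelyContinuousOnInterval_iff] at hΦ ⊢
  intro ε hε
  obtain ⟨δ, hδ, H⟩ := hΦ ε hε
  refine ⟨δ, hδ, fun E hE hlt => lt_of_le_of_lt (Finset.sum_le_sum fun i hi => ?_) (H E hE hlt)⟩
  exact h _ (hE.1 i hi).1 _ (hE.1 i hi).2

variable {E F G : Type*} [NormedAddCommGroup E] [NormedSpace ℝ E] [CompleteSpace E]
  [NormedAddCommGroup F] [NormedSpace ℝ F] [CompleteSpace F]
  [NormedAddCommGroup G] [NormedSpace ℝ G] [CompleteSpace G]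

theorem intervalIntegrable_sub {E : Type*} [NormedAddCommGroup E] {g : ℝ → E} {a b x y : ℝ}
    (hg : IntervalIntegrable g volume a b)
    (hx : x ∈ uIcc a b) (hy : y ∈ uIcc a b) : IntervalIntegrable g volume x y :=
  hg.mono_set (uIcc_subset_uIcc hx hy)

theorem dist_intervalIntegral_le {g : ℝ → E} {φ : ℝ → ℝ} {a b : ℝ}
    (hg : IntervalIntegrable g volume a b) (hφ : IntervalIntegrable φ volume a b)
    (hle : ∀ x, ‖g x‖ ≤ φ x) {x y : ℝ} (hx : x ∈ uIcc a b) (hy : y ∈ uIcc a b) :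
    dist (∫ t in a..x, g t) (∫ t in a..y, g t) ≤ dist (∫ t in a..x, φ t) (∫ t in a..y, φ t) := by
  have ha : a ∈ uIcc a b := left_mem_uIcc
  rw [dist_eq_norm, dist_eq_norm,
    intervalIntegral.integral_interval_sub_left (intervalIntegrable_sub hg ha hx)
      (intervalIntegrable_sub hg ha hy),
    intervalIntegral.integral_interval_sub_left (intervalIntegrable_sub hφ ha hx)
      (intervalIntegrable_sub hφ ha hy)]
  refine (intervalIntegral.norm_integral_le_abs_of_norm_le (Eventually.of_forall fun t => hle t)
    (intervalIntegrable_sub hφ hy hx)).trans ?_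
  rfl

theorem absCont_integral {g : ℝ → E} {a b : ℝ}
    (hg : IntervalIntegrable g volume a b) :
    AbsolutelyContinuousOnInterval (fun x => ∫ t in a..x, g t) a b :=
  absCont_of_dist_le
    (hg.norm.absolutelyContinuousOnInterval_intervalIntegral left_mem_uIcc)
    fun _ hx _ hy => dist_intervalIntegral_le hg hg.norm (fun _ => le_rfl) hx hy

/-- The product rule for primitives of integrable functions, integrated over an interval. -/
theorem integral_bilin_primitive {B : E × F → G} (hB : IsBoundedBilinearMap ℝ B) {g₁ : ℝ → E}
    {g₂ : ℝ → F} {a b : ℝ} (h₁ : IntervalIntegrable g₁ volume a b)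
    (h₂ : IntervalIntegrable g₂ volume a b) (c₁ : E) (c₂ : F) :
    IntervalIntegrable (fun x => B (c₁ + ∫ t in a..x, g₁ t, g₂ x) +
        B (g₁ x, c₂ + ∫ t in a..x, g₂ t)) volume a b ∧
    ∫ x in a..b, (B (c₁ + ∫ t in a..x, g₁ t, g₂ x) + B (g₁ x, c₂ + ∫ t in a..x, g₂ t)) =
      B (c₁ + ∫ t in a..b, g₁ t, c₂ + ∫ t in a..b, g₂ t) - B (c₁, c₂) := by
  obtain ⟨C, hC, hBC⟩ := hB.bound
  set f₁ : ℝ → E := fun x => c₁ + ∫ t in a..x, g₁ t with hf₁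
  set f₂ : ℝ → F := fun x => c₂ + ∫ t in a..x, g₂ t with hf₂
  have hc₁ : ContinuousOn f₁ (uIcc a b) :=
    continuousOn_const.add (absCont_integral h₁).continuousOn
  have hc₂ : ContinuousOn f₂ (uIcc a b) :=
    continuousOn_const.add (absCont_integral h₂).continuousOn
  obtain ⟨M₁, hM₁⟩ := isCompact_uIcc.exists_bound_of_continuousOn hc₁
  obtain ⟨M₂, hM₂⟩ := isCompact_uIcc.exists_bound_of_continuousOn hc₂
  have hi₁ : IntervalIntegrable (fun x => B (f₁ x, g₂ x)) volume a b := by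
    rw [intervalIntegrable_iff]
    refine Integrable.mono' (g := fun x => C * M₁ * ‖g₂ x‖)
      ((intervalIntegrable_iff.1 h₂.norm).const_mul _) ?_ ?_
    · exact hB.continuous.comp_aestronglyMeasurable
        (((hc₁.mono uIoc_subset_uIcc).aestronglyMeasurable measurableSet_uIoc).prodMk
          (intervalIntegrable_iff.1 h₂).aestronglyMeasurable)
    · filter_upwards [ae_restrict_mem measurableSet_uIoc] with x hx
      refine (hBC _ _).trans ?_
      have := hM₁ x (uIoc_subset_uIcc hx)
      gcongr
  have hi₂ : IntervalIntegrable (fun x => B (g₁ x, f₂ x)) volume a b := by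
    rw [intervalIntegrable_iff]
    refine Integrable.mono' (g := fun x => C * ‖g₁ x‖ * M₂)
      (((intervalIntegrable_iff.1 h₁.norm).const_mul _).mul_const _) ?_ ?_
    · exact hB.continuous.comp_aestronglyMeasurable
        ((intervalIntegrable_iff.1 h₁).aestronglyMeasurable.prodMk
          ((hc₂.mono uIoc_subset_uIcc).aestronglyMeasurable measurableSet_uIoc))
    · filter_upwards [ae_restrict_mem measurableSet_uIoc] with x hx
      refine (hBC _ _).trans ?_
      have := hM₂ x (uIoc_subset_uIcc hx)
      gcongr
  have hi := hi₁.add hi₂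
  refine ⟨hi, ?_⟩
  have hM₁0 : 0 ≤ M₁ := (norm_nonneg _).trans (hM₁ a left_mem_uIcc)
  have hM₂0 : 0 ≤ M₂ := (norm_nonneg _).trans (hM₂ a left_mem_uIcc)
  set φ : ℝ → ℝ := fun x => C * M₂ * ‖g₁ x‖ + C * M₁ * ‖g₂ x‖ with hφ
  have hφi : IntervalIntegrable φ volume a b := (h₁.norm.const_mul _).add (h₂.norm.const_mul _)
  have hφ0 : ∀ x, 0 ≤ φ x := fun x => by positivity
  have hac : AbsolutelyContinuousOnInterval (fun x => B (f₁ x, f₂ x)) a b := by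
    refine absCont_of_dist_le
      (hφi.absolutelyContinuousOnInterval_intervalIntegral left_mem_uIcc) fun x hx y hy => ?_
    have e : B (f₁ x, f₂ x) - B (f₁ y, f₂ y) = B (f₁ x - f₁ y, f₂ x) + B (f₁ y, f₂ x - f₂ y) := by
      rw [hB.map_sub_left, hB.map_sub_right]; abel
    have ha : a ∈ uIcc a b := left_mem_uIcc
    have d₁ : f₁ x - f₁ y = ∫ t in y..x, g₁ t := by
      rw [hf₁]
      simp only [add_sub_add_left_eq_sub]
      exact intervalIntegral.integral_interval_sub_left (intervalIntegrable_sub h₁ ha hx)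
        (intervalIntegrable_sub h₁ ha hy)
    have d₂ : f₂ x - f₂ y = ∫ t in y..x, g₂ t := by
      rw [hf₂]
      simp only [add_sub_add_left_eq_sub]
      exact intervalIntegral.integral_interval_sub_left (intervalIntegrable_sub h₂ ha hx)
        (intervalIntegrable_sub h₂ ha hy)
    have n₁ : ‖f₁ x - f₁ y‖ ≤ |∫ t in y..x, ‖g₁ t‖| := by
      rw [d₁]; exact intervalIntegral.norm_integral_le_abs_integral_norm
    have n₂ : ‖f₂ x - f₂ y‖ ≤ |∫ t in y..x, ‖g₂ t‖| := by
      rw [d₂]; exact intervalIntegral.norm_integral_le_abs_integral_norm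
    have k₁ := intervalIntegrable_sub h₁ hy hx
    have k₂ := intervalIntegrable_sub h₂ hy hx
    rw [dist_eq_norm, e, dist_eq_norm,
      intervalIntegral.integral_interval_sub_left (intervalIntegrable_sub hφi ha hx)
      (intervalIntegrable_sub hφi ha hy), hφ, intervalIntegral.integral_add (k₁.norm.const_mul _)
      (k₂.norm.const_mul _), intervalIntegral.integral_const_mul,
      intervalIntegral.integral_const_mul, Real.norm_eq_abs]
    have hs : |C * M₂ * ∫ t in y..x, ‖g₁ t‖| + |C * M₁ * ∫ t in y..x, ‖g₂ t‖| =
        |C * M₂ * (∫ t in y..x, ‖g₁ t‖) + C * M₁ * ∫ t in y..x, ‖g₂ t‖| := by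
      rcases le_total y x with hyx | hyx
      · have p₁ : 0 ≤ ∫ t in y..x, ‖g₁ t‖ :=
          intervalIntegral.integral_nonneg hyx fun _ _ => norm_nonneg _
        have p₂ : 0 ≤ ∫ t in y..x, ‖g₂ t‖ :=
          intervalIntegral.integral_nonneg hyx fun _ _ => norm_nonneg _
        rw [abs_of_nonneg, abs_of_nonneg, abs_of_nonneg] <;> positivity
      · have p₁ : ∫ t in y..x, ‖g₁ t‖ ≤ 0 := by
          rw [intervalIntegral.integral_symm, neg_nonpos]
          exact intervalIntegral.integral_nonneg hyx fun _ _ => norm_nonneg _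
        have p₂ : ∫ t in y..x, ‖g₂ t‖ ≤ 0 := by
          rw [intervalIntegral.integral_symm, neg_nonpos]
          exact intervalIntegral.integral_nonneg hyx fun _ _ => norm_nonneg _
        have q₁ := mul_nonpos_of_nonneg_of_nonpos (mul_nonneg hC.le hM₂0) p₁
        have q₂ := mul_nonpos_of_nonneg_of_nonpos (mul_nonneg hC.le hM₁0) p₂
        rw [abs_of_nonpos q₁, abs_of_nonpos q₂, abs_of_nonpos (add_nonpos q₁ q₂)]
        ring
    rw [← hs, abs_mul (C * M₂), abs_mul (C * M₁), abs_of_nonneg (mul_nonneg hC.le hM₂0),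
      abs_of_nonneg (mul_nonneg hC.le hM₁0)]
    refine (norm_add_le _ _).trans (add_le_add ?_ ?_)
    · refine (hBC _ _).trans ?_
      calc C * ‖f₁ x - f₁ y‖ * ‖f₂ x‖ ≤ C * |∫ t in y..x, ‖g₁ t‖| * M₂ := by
            have := hM₂ x hx
            gcongr
        _ = _ := by ring
    · refine (hBC _ _).trans ?_
      have := hM₁ y hy
      gcongr
  have hac2 := hac.fun_sub (absCont_integral hi)
  obtain ⟨K, hK⟩ := hac2.const_of_ae_hasDerivAt_zero (by
    filter_upwards [h₁.ae_hasDerivAt_integral, h₂.ae_hasDerivAt_integral,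
      hi.ae_hasDerivAt_integral] with x hx₁ hx₂ hx₃ hx
    have a₁ : HasDerivAt f₁ (g₁ x) x := (hx₁ hx a left_mem_uIcc).const_add c₁
    have a₂ : HasDerivAt f₂ (g₂ x) x := (hx₂ hx a left_mem_uIcc).const_add c₂
    have a₃ := hx₃ hx a left_mem_uIcc
    have a₄ : HasDerivAt (fun x => B (f₁ x, f₂ x)) (B (f₁ x, g₂ x) + B (g₁ x, f₂ x)) x := by
      have := (hB.hasFDerivAt (f₁ x, f₂ x)).comp_hasDerivAt x (a₁.prodMk a₂)
      exact this
    have a₅ := a₄.sub a₃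
    rwa [sub_self] at a₅)
  have hKa := hK a left_mem_uIcc
  have hKb := hK b right_mem_uIcc
  simp only [intervalIntegral.integral_same, sub_zero] at hKa
  have e0 : B (f₁ a, f₂ a) = B (c₁, c₂) := by simp [hf₁, hf₂]
  rw [← e0, hKa, ← hKb, sub_sub_cancel]

end AbsCont

/-! ### Weak derivatives and boundary values on the half-line -/

section HalfLine

variable {H : Type*} [NormedAddCommGroup H] [InnerProductSpace ℂ H]

theorem integrable_test_smul {φ : ℝ → ℝ} (h1 : Continuous φ) (h2 : HasCompactSupport φ)
    {k : ℝ → H} (hk : LocallyIntegrable k (volume.restrict (Ioi (0 : ℝ)))) :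
    Integrable (fun x => φ x • k x) (volume.restrict (Ioi (0 : ℝ))) :=
  hk.integrable_smul_left_of_hasCompactSupport h1 h2

/-- A test function on `(0,∞)` with vanishing integral is the derivative of a test function. -/
theorem exists_test_deriv_eq {η : ℝ → ℝ} (h1 : ContDiff ℝ ∞ η) (h2 : HasCompactSupport η)
    (h3 : tsupport η ⊆ Ioi 0) (h0 : ∫ x in Ioi (0 : ℝ), η x = 0) :
    ∃ ψ : ℝ → ℝ, ContDiff ℝ ∞ ψ ∧ HasCompactSupport ψ ∧ tsupport ψ ⊆ Ioi 0 ∧ deriv ψ = η := by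
  set ψ : ℝ → ℝ := fun x => ∫ t in (0 : ℝ)..x, η t with hψ
  have hd : ∀ x, HasDerivAt ψ (η x) x := fun x =>
    intervalIntegral.integral_hasDerivAt_right (h1.continuous.intervalIntegrable _ _)
      (h1.continuous.stronglyMeasurableAtFilter _ _) h1.continuous.continuousAt
  have hde : deriv ψ = η := funext fun x => (hd x).deriv
  have hc : ContDiff ℝ ∞ ψ := by
    rw [contDiff_infty_iff_deriv, hde]
    exact ⟨fun x => (hd x).differentiableAt, h1⟩
  -- The support of `ψ` lies in the interval spanned by the support of `η`.
  obtain ⟨a, b, ha, hab⟩ : ∃ a b : ℝ, 0 < a ∧ tsupport η ⊆ Icc a b := by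
    rcases (tsupport η).eq_empty_or_nonempty with he | hne
    · exact ⟨1, 1, one_pos, by simp [he]⟩
    · obtain ⟨a, ha, hal⟩ := h2.isCompact.exists_isLeast hne
      obtain ⟨b, hb, hbl⟩ := h2.isCompact.exists_isGreatest hne
      exact ⟨a, b, h3 ha, fun x hx => ⟨hal hx, hbl hx⟩⟩
  have hz : ∀ x, x ∉ Icc a b → η x = 0 := fun x hx =>
    image_eq_zero_of_notMem_tsupport fun h => hx (hab h)
  have hsupp : Function.support ψ ⊆ Icc a b := by
    intro x hx
    by_contra hxa
    apply hx
    rcases lt_or_ge x a with h | h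
    · have : ∀ t ∈ uIcc 0 x, η t = 0 := fun t ht => hz t fun h' => by
        have := (mem_uIcc.1 ht)
        rcases this with h'' | h'' <;> linarith [h'.1]
      rw [hψ]
      simp only
      rw [intervalIntegral.integral_congr this]
      simp
    · have hb : b < x := by
        by_contra hcon
        exact hxa ⟨h, le_of_not_gt hcon⟩
      have hx0 : 0 ≤ x := ha.le.trans h
      rw [hψ]
      simp only
      rw [intervalIntegral.integral_of_le hx0]
      refine Eq.trans ?_ h0
      refine (setIntegral_eq_of_subset_of_forall_sdiff_eq_zero measurableSet_Ioi
        Ioc_subset_Ioi_self fun t ht => hz t fun h' => ht.2 ⟨ht.1, h'.2.trans hb.le⟩).symm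
  have hts : tsupport ψ ⊆ Icc a b := closure_minimal hsupp isClosed_Icc
  exact ⟨ψ, hc, isCompact_Icc.of_isClosed_subset isClosed_closure hts,
    fun x hx => ha.trans_le (hts hx).1, hde⟩

/-- Du Bois-Reymond: a function on `(0,∞)` with vanishing weak derivative is constant. -/
theorem ae_eq_const_of_integral_deriv_smul_eq_zero [CompleteSpace H] {k : ℝ → H}
    (hk : LocallyIntegrable k (volume.restrict (Ioi (0 : ℝ))))
    (h : ∀ φ : ℝ → ℝ, ContDiff ℝ ∞ φ → HasCompactSupport φ → tsupport φ ⊆ Ioi 0 →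
      ∫ x in Ioi (0 : ℝ), deriv φ x • k x = 0) :
    ∃ c : H, k =ᵐ[volume.restrict (Ioi (0 : ℝ))] fun _ => c := by
  -- Subtracting a multiple of `ρ` makes the integral of a test function vanish.
  let β : ContDiffBump (2 : ℝ) := ⟨1 / 2, 1, by norm_num, by norm_num⟩
  set ρ : ℝ → ℝ := β.normed volume with hρ
  have hρ1 : ContDiff ℝ ∞ ρ := β.contDiff_normed
  have hρ2 : HasCompactSupport ρ := β.hasCompactSupport_normed
  have hρ3 : tsupport ρ ⊆ Ioi 0 := by
    rw [hρ, β.tsupport_normed_eq]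
    intro x hx
    rw [Metric.mem_closedBall, Real.dist_eq] at hx
    have h5 : |x - 2| ≤ 1 := hx
    have := (abs_le.1 h5).1
    simp only [mem_Ioi]
    linarith
  have hρ4 : ∫ x in Ioi (0 : ℝ), ρ x = 1 := by
    rw [setIntegral_eq_integral_of_forall_compl_eq_zero, hρ, β.integral_normed]
    intro x hx
    exact image_eq_zero_of_notMem_tsupport fun h' => hx (hρ3 h')
  refine ⟨∫ x in Ioi (0 : ℝ), ρ x • k x, ?_⟩
  set c := ∫ x in Ioi (0 : ℝ), ρ x • k x with hc
  have hint : ∀ φ : ℝ → ℝ, ContDiff ℝ ∞ φ → HasCompactSupport φ →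
      Integrable φ (volume.restrict (Ioi (0 : ℝ))) := fun φ g1 g2 =>
    (g1.continuous.integrable_of_hasCompactSupport g2).restrict
  have key := isOpen_Ioi.ae_eq_zero_of_integral_contDiff_smul_eq_zero (U := Ioi (0 : ℝ))
    (μ := volume.restrict (Ioi (0 : ℝ))) (f := fun x => k x - c)
    ((hk.sub (locallyIntegrable_const c)).locallyIntegrableOn _) (fun φ g1 g2 g3 => by
      set m := ∫ x in Ioi (0 : ℝ), φ x with hm
      obtain ⟨ψ, p1, p2, p3, p4⟩ := exists_test_deriv_eq (η := fun x => φ x - m * ρ x)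
        (g1.sub (contDiff_const.mul hρ1)) (g2.sub (hρ2.mul_left))
        ((tsupport_sub _ _).trans (union_subset g3
          ((tsupport_mul_subset_right).trans hρ3))) (by
          rw [integral_sub (hint φ g1 g2) ((hint ρ hρ1 hρ2).const_mul m), integral_const_mul,
            hρ4, mul_one, sub_self])
      have h5 := h ψ p1 p2 p3
      rw [p4] at h5
      simp only [sub_smul, mul_smul] at h5
      have i1 : Integrable (fun x => m • ρ x • k x) (volume.restrict (Ioi (0 : ℝ))) :=
        (integrable_test_smul hρ1.continuous hρ2 hk).smul m
      rw [integral_sub (integrable_test_smul g1.continuous g2 hk) i1, integral_smul, ← hc] at h5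
      simp only [smul_sub]
      rw [integral_sub (integrable_test_smul g1.continuous g2 hk)
        ((hint φ g1 g2).smul_const c), integral_smul_const]
      exact h5)
  filter_upwards [key, ae_restrict_mem measurableSet_Ioi] with x hx hx0
  exact sub_eq_zero.1 (hx hx0)

/-- `f` is absolutely continuous on `[0,∞)` with derivative `g` and boundary value `f(0) = v`. -/
def HasTrace (f g : L2Half H) (v : H) : Prop :=
  f =ᵐ[volume.restrict (Ioi (0 : ℝ))] fun x => v + ∫ t in (0 : ℝ)..x, g t

theorem L2Half.intervalIntegrable (g : L2Half H) {x : ℝ} (hx : 0 ≤ x) :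
    IntervalIntegrable g volume 0 x := by
  rw [intervalIntegrable_iff, uIoc_of_le hx]
  have h1 : MemLp g 2 (volume.restrict (Ioc 0 x)) :=
    (Lp.memLp g).mono_measure (Measure.restrict_mono Ioc_subset_Ioi_self le_rfl)
  have h2 : IsFiniteMeasure (volume.restrict (Ioc 0 x)) :=
    ⟨by rw [Measure.restrict_apply_univ]; exact measure_Ioc_lt_top⟩
  exact h1.integrable (by norm_num)

variable [CompleteSpace H]

theorem continuousOn_primitive (g : L2Half H) (v : H) :
    ContinuousOn (fun x => v + ∫ t in (0 : ℝ)..x, g t) (Ici 0) := by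
  intro x hx
  have hx0 : (0 : ℝ) ≤ x := hx
  have h1 := (absCont_integral (L2Half.intervalIntegrable g (x := x + 1)
    (by linarith))).continuousOn
  rw [uIcc_of_le (by linarith)] at h1
  refine continuousWithinAt_const.add ?_
  refine (h1 x ⟨hx0, by linarith⟩).mono_of_mem_nhdsWithin ?_
  rw [← Ici_inter_Iic]
  exact inter_mem self_mem_nhdsWithin (mem_nhdsWithin_of_mem_nhds (Iic_mem_nhds (by linarith)))

theorem HasTrace.hasBoundaryValue {f g : L2Half H} {v : H} (h : HasTrace f g v) :
    HasBoundaryValue f v :=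
  ⟨_, continuousOn_primitive g v, h, by simp⟩

omit [CompleteSpace H] in
theorem HasBoundaryValue.unique {f : L2Half H} {v w : H} (hv : HasBoundaryValue f v)
    (hw : HasBoundaryValue f w) : v = w := by
  obtain ⟨F, hF, hF1, rfl⟩ := hv
  obtain ⟨G, hG, hG1, rfl⟩ := hw
  have h := Measure.eqOn_open_of_ae_eq (hF1.symm.trans hG1) isOpen_Ioi
    (hF.mono Ioi_subset_Ici_self) (hG.mono Ioi_subset_Ici_self)
  have h0 : closure (Ioi (0 : ℝ)) = Ici 0 := closure_Ioi 0
  exact (h.of_subset_closure hF hG Ioi_subset_Ici_self h0.ge) self_mem_Ici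

theorem locallyIntegrable_of_continuousOn {F : ℝ → H} (hF : ContinuousOn F (Ici 0)) :
    LocallyIntegrable F (volume.restrict (Ioi (0 : ℝ))) := by
  have h1 : LocallyIntegrableOn F (Ici (0 : ℝ)) volume :=
    hF.locallyIntegrableOn measurableSet_Ici
  have h2 : LocallyIntegrable F (volume.restrict (Ici (0 : ℝ))) :=
    (locallyIntegrableOn_iff_locallyIntegrable_restrict isClosed_Ici).1 h1
  rwa [← restrict_Ioi_eq_restrict_Ici] at h2

/-- Integration by parts of a primitive against a test function on the line, restricted to the
half-line. -/
theorem integral_test_primitive (g : L2Half H) (v : H) {φ : ℝ → ℝ}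
    (h1 : ContDiff ℝ ∞ φ) (h2 : HasCompactSupport φ) :
    ∫ x in Ioi (0 : ℝ), (deriv φ x • (v + ∫ t in (0 : ℝ)..x, g t) + φ x • g x) =
      - (φ 0 • v) := by
  obtain ⟨b, hb0, hb⟩ : ∃ b : ℝ, 0 ≤ b ∧ ∀ x, b ≤ x → φ x = 0 := by
    obtain ⟨R, hR⟩ := h2.isCompact.isBounded.subset_closedBall 0
    refine ⟨max R 0 + 1, by positivity, fun x hx => image_eq_zero_of_notMem_tsupport fun h' => ?_⟩
    have := hR h'
    rw [Metric.mem_closedBall, dist_zero_right, Real.norm_eq_abs] at this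
    linarith [le_abs_self x, le_max_left R 0]
  have hd : Continuous (deriv φ) := h1.continuous_deriv (by simp)
  have hdφ : ∀ x, HasDerivAt φ (deriv φ x) x := fun x =>
    ((h1.differentiable (by simp)) x).hasDerivAt
  have hφ : ∀ x, φ x = φ 0 + ∫ t in (0 : ℝ)..x, deriv φ t := fun x => by
    rw [intervalIntegral.integral_eq_sub_of_hasDerivAt (fun t _ => hdφ t)
      (hd.intervalIntegrable _ _)]
    ring
  have key := (integral_bilin_primitive (isBoundedBilinearMap_smul (𝕜 := ℝ) (A := ℝ) (E := H))
    (hd.intervalIntegrable 0 b) (L2Half.intervalIntegrable g hb0) (φ 0) v).2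
  simp only [← hφ] at key
  rw [hb b le_rfl, zero_smul, zero_sub, intervalIntegral.integral_of_le hb0] at key
  rw [← key]
  simp only [add_comm (φ _ • g _)]
  refine setIntegral_eq_of_subset_of_forall_sdiff_eq_zero measurableSet_Ioi
    Ioc_subset_Ioi_self fun t ht => ?_
  have htb : b < t := by
    by_contra hcon
    exact ht.2 ⟨ht.1, le_of_not_gt hcon⟩
  have he : φ =ᶠ[𝓝 t] fun _ => (0 : ℝ) := by
    filter_upwards [Ioi_mem_nhds htb] with y hy
    exact hb y (le_of_lt hy)
  rw [hb t htb.le, he.deriv_eq]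
  simp

theorem HasTrace.integral_test {f g : L2Half H} {v : H} (h : HasTrace f g v) {φ : ℝ → ℝ}
    (h1 : ContDiff ℝ ∞ φ) (h2 : HasCompactSupport φ) :
    ∫ x in Ioi (0 : ℝ), (deriv φ x • f x + φ x • g x) = - (φ 0 • v) := by
  rw [← integral_test_primitive g v h1 h2]
  refine integral_congr_ae ?_
  filter_upwards [h] with x hx
  rw [hx]

theorem HasTrace.hasWeakDeriv {f g : L2Half H} {v : H} (h : HasTrace f g v) :
    HasWeakDeriv f g := by
  intro φ h1 h2 h3
  have h4 := h.integral_test h1 h2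
  have h5 : φ 0 = 0 := image_eq_zero_of_notMem_tsupport fun h' => lt_irrefl (0 : ℝ) (h3 h')
  rw [h5, zero_smul, neg_zero, integral_add (integrable_smul_of_test
    (h1.continuous_deriv (by simp)) h2.deriv f) (integrable_smul_of_test h1.continuous h2 g)] at h4
  exact eq_neg_of_add_eq_zero_left h4

theorem HasWeakDeriv.exists_hasTrace {f g : L2Half H} (h : HasWeakDeriv f g) :
    ∃ v, HasTrace f g v := by
  set F : ℝ → H := fun x => 0 + ∫ t in (0 : ℝ)..x, g t with hF
  have hFl := locallyIntegrable_of_continuousOn (continuousOn_primitive g 0)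
  have hfl : LocallyIntegrable f (volume.restrict (Ioi (0 : ℝ))) :=
    (Lp.memLp f).locallyIntegrable (by norm_num)
  obtain ⟨c, hc⟩ := ae_eq_const_of_integral_deriv_smul_eq_zero (k := fun x => f x - F x)
    (hfl.sub hFl) (fun φ h1 h2 h3 => by
      have hd : Continuous (deriv φ) := h1.continuous_deriv (by simp)
      simp only [smul_sub]
      rw [integral_sub (integrable_test_smul hd h2.deriv hfl)
        (integrable_test_smul hd h2.deriv hFl), h φ h1 h2 h3]
      have h5 := integral_test_primitive g 0 h1 h2
      rw [smul_zero, neg_zero, integral_add (integrable_test_smul hd h2.deriv hFl)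
        (integrable_smul_of_test h1.continuous h2 g)] at h5
      rw [eq_neg_of_add_eq_zero_left h5, sub_self])
  refine ⟨c, ?_⟩
  filter_upwards [hc] with x hx
  rw [← hx, hF]
  simp

/-- The weak form of `HasTrace`: test functions on the line detect derivative and boundary
value. -/
theorem HasTrace.of_integral_test {f g : L2Half H} {v : H}
    (h : ∀ φ : ℝ → ℝ, ContDiff ℝ ∞ φ → HasCompactSupport φ →
      ∫ x in Ioi (0 : ℝ), (deriv φ x • f x + φ x • g x) = - (φ 0 • v)) : HasTrace f g v := by
  have hw : HasWeakDeriv f g := by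
    intro φ h1 h2 h3
    have h4 := h φ h1 h2
    have h5 : φ 0 = 0 := image_eq_zero_of_notMem_tsupport fun h' => lt_irrefl (0 : ℝ) (h3 h')
    rw [h5, zero_smul, neg_zero, integral_add (integrable_smul_of_test
      (h1.continuous_deriv (by simp)) h2.deriv f)
      (integrable_smul_of_test h1.continuous h2 g)] at h4
    exact eq_neg_of_add_eq_zero_left h4
  obtain ⟨w, hf⟩ := hw.exists_hasTrace
  let β : ContDiffBump (0 : ℝ) := ⟨1 / 2, 1, by norm_num, by norm_num⟩
  have hβ0 : β 0 = 1 := β.one_of_mem_closedBall (by simpa using β.rIn_pos.le)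
  have h1 := h β β.contDiff β.hasCompactSupport
  rw [hf.integral_test β.contDiff β.hasCompactSupport, hβ0, one_smul, one_smul, neg_inj] at h1
  rwa [← h1]

theorem HasTrace.unique {f g g' : L2Half H} {v v' : H} (h : HasTrace f g v)
    (h' : HasTrace f g' v') : g = g' ∧ v = v' := by
  refine ⟨?_, h.hasBoundaryValue.unique h'.hasBoundaryValue⟩
  have h1 := h.hasWeakDeriv.add (h'.hasWeakDeriv.smul (-1))
  have h2 : f + (-1 : ℂ) • f = 0 := by rw [neg_one_smul, add_neg_cancel]
  rw [h2] at h1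
  have h3 := h1.eq_zero
  rw [neg_one_smul] at h3
  exact add_neg_eq_zero.1 h3

theorem HasTrace.add {f g f' g' : L2Half H} {v v' : H} (h : HasTrace f g v)
    (h' : HasTrace f' g' v') : HasTrace (f + f') (g + g') (v + v') := by
  rw [HasTrace] at h h' ⊢
  filter_upwards [h, h', Lp.coeFn_add f f', ae_restrict_mem measurableSet_Ioi] with x h1 h2 h3 hx
  have hx0 : (0 : ℝ) ≤ x := le_of_lt hx
  have e : ∫ t in (0 : ℝ)..x, (g + g' : L2Half H) t = ∫ t in (0 : ℝ)..x, (g t + g' t) := by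
    rw [intervalIntegral.integral_of_le hx0, intervalIntegral.integral_of_le hx0]
    exact integral_congr_ae (ae_mono (Measure.restrict_mono Ioc_subset_Ioi_self le_rfl)
      (Lp.coeFn_add g g'))
  rw [h3, Pi.add_apply, h1, h2, e, intervalIntegral.integral_add
    (L2Half.intervalIntegrable g hx0) (L2Half.intervalIntegrable g' hx0)]
  abel

/-- The action of a bounded operator on `L²(ℝ₊, H)`, pointwise in `ℝ₊`. -/
def lift (K : H →L[ℂ] H) : L2Half H →L[ℂ] L2Half H :=
  K.compLpL 2 (volume.restrict (Ioi (0 : ℝ)))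

theorem coeFn_lift (K : H →L[ℂ] H) (f : L2Half H) :
    lift K f =ᵐ[volume.restrict (Ioi (0 : ℝ))] fun x => K (f x) :=
  K.coeFn_compLp' f

theorem lift_add (K L : H →L[ℂ] H) : lift (K + L) = lift K + lift L :=
  ContinuousLinearMap.add_compLpL K L

theorem lift_smul (c : ℂ) (K : H →L[ℂ] H) : lift (c • K) = c • lift K :=
  ContinuousLinearMap.smul_compLpL c K

theorem lift_neg (K : H →L[ℂ] H) : lift (-K) = -lift K := by
  rw [← neg_one_smul ℂ K, lift_smul, neg_one_smul]

theorem lift_sub (K L : H →L[ℂ] H) : lift (K - L) = lift K - lift L := by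
  rw [sub_eq_add_neg, lift_add, lift_neg, sub_eq_add_neg]

theorem lift_mul (K L : H →L[ℂ] H) : lift (K * L) = lift K * lift L := by
  ext1 f
  refine Lp.ext ?_
  filter_upwards [coeFn_lift (K * L) f, coeFn_lift K (lift L f), coeFn_lift L f] with x h1 h2 h3
  change _ = (lift K (lift L f)) x
  rw [h1, h2, h3]
  rfl

theorem lift_one : lift (1 : H →L[ℂ] H) = 1 := by
  ext1 f
  refine Lp.ext ?_
  filter_upwards [coeFn_lift (1 : H →L[ℂ] H) f] with x h1
  rw [h1]
  rfl

theorem lift_star (K : H →L[ℂ] H) : lift (star K) = star (lift K) := by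
  rw [ContinuousLinearMap.star_eq_adjoint, ContinuousLinearMap.star_eq_adjoint,
    ContinuousLinearMap.eq_adjoint_iff]
  intro f g
  rw [L2.inner_def, L2.inner_def]
  refine integral_congr_ae ?_
  filter_upwards [coeFn_lift (ContinuousLinearMap.adjoint K) f, coeFn_lift K g] with x h1 h2
  rw [h1, h2, ContinuousLinearMap.adjoint_inner_left]

theorem lift_injective {K : H →L[ℂ] H} (hK : Function.Injective K) :
    Function.Injective (lift K) := by
  intro f g h
  refine Lp.ext ?_
  filter_upwards [coeFn_lift K f, coeFn_lift K g] with x h1 h2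
  apply hK
  rw [← h1, ← h2, h]

theorem HasTrace.map {f g : L2Half H} {v : H} (h : HasTrace f g v) (K : H →L[ℂ] H) :
    HasTrace (lift K f) (lift K g) (K v) := by
  rw [HasTrace] at h ⊢
  filter_upwards [h, coeFn_lift K f, ae_restrict_mem measurableSet_Ioi] with x h1 h2 hx
  have hx0 : (0 : ℝ) ≤ x := le_of_lt hx
  have e : ∫ t in (0 : ℝ)..x, (lift K g : L2Half H) t = ∫ t in (0 : ℝ)..x, K (g t) := by
    rw [intervalIntegral.integral_of_le hx0, intervalIntegral.integral_of_le hx0]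
    exact integral_congr_ae (ae_mono (Measure.restrict_mono Ioc_subset_Ioi_self le_rfl)
      (coeFn_lift K g))
  rw [h2, h1, e, K.intervalIntegral_comp_comm (L2Half.intervalIntegrable g hx0), map_add]

theorem HasTrace.smul {f g : L2Half H} {v : H} (h : HasTrace f g v) (c : ℂ) :
    HasTrace (c • f) (c • g) (c • v) := by
  have := h.map (c • (1 : H →L[ℂ] H))
  simpa [lift_smul, lift_one] using this

/-- If `K f` has a derivative of the form `K g`, with `K` injective, then `f` has derivative `g`. -/
theorem HasTrace.of_lift {K : H →L[ℂ] H} (hK : Function.Injective K) {f g : L2Half H} {w : H}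
    (h : HasTrace (lift K f) (lift K g) w) : ∃ v, HasTrace f g v ∧ K v = w := by
  have hw : HasWeakDeriv f g := by
    intro φ h1 h2 h3
    have hd : Continuous (deriv φ) := h1.continuous_deriv (by simp)
    apply hK
    have h4 := h.hasWeakDeriv φ h1 h2 h3
    have e1 : ∫ x in Ioi (0 : ℝ), deriv φ x • (lift K f : L2Half H) x =
        K (∫ x in Ioi (0 : ℝ), deriv φ x • f x) := by
      rw [← K.integral_comp_comm (integrable_smul_of_test hd h2.deriv f)]
      refine integral_congr_ae ?_
      filter_upwards [coeFn_lift K f] with x hx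
      rw [hx, ← Complex.coe_smul, ← Complex.coe_smul, map_smul]
    have e2 : ∫ x in Ioi (0 : ℝ), φ x • (lift K g : L2Half H) x =
        K (∫ x in Ioi (0 : ℝ), φ x • g x) := by
      rw [← K.integral_comp_comm (integrable_smul_of_test h1.continuous h2 g)]
      refine integral_congr_ae ?_
      filter_upwards [coeFn_lift K g] with x hx
      rw [hx, ← Complex.coe_smul, ← Complex.coe_smul, map_smul]
    rw [e1, e2] at h4
    rw [h4, map_neg]
  obtain ⟨v, hv⟩ := hw.exists_hasTrace
  exact ⟨v, hv, (hv.map K).unique h |>.2⟩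

/-- Integration by parts on the half-line. -/
theorem HasTrace.inner_add_inner {f₁ g₁ f₂ g₂ : L2Half H} {v₁ v₂ : H} (h₁ : HasTrace f₁ g₁ v₁)
    (h₂ : HasTrace f₂ g₂ v₂) :
    inner ℂ f₁ g₂ + inner ℂ g₁ f₂ = - inner ℂ v₁ v₂ := by
  set F₁ : ℝ → H := fun x => v₁ + ∫ t in (0 : ℝ)..x, g₁ t with hF₁
  set F₂ : ℝ → H := fun x => v₂ + ∫ t in (0 : ℝ)..x, g₂ t with hF₂
  have hi1 : Integrable (fun x => inner ℂ (f₁ x) (g₂ x)) (volume.restrict (Ioi (0 : ℝ))) :=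
    L2.integrable_inner f₁ g₂
  have hi2 : Integrable (fun x => inner ℂ (g₁ x) (f₂ x)) (volume.restrict (Ioi (0 : ℝ))) :=
    L2.integrable_inner g₁ f₂
  have hi3 : Integrable (fun x => inner ℂ (f₁ x) (f₂ x)) (volume.restrict (Ioi (0 : ℝ))) :=
    L2.integrable_inner f₁ f₂
  have hI : Integrable (fun x => inner ℂ (F₁ x) (g₂ x) + inner ℂ (g₁ x) (F₂ x))
      (volume.restrict (Ioi (0 : ℝ))) := by
    refine (hi1.add hi2).congr ?_
    filter_upwards [h₁, h₂] with x e1 e2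
    simp only [Pi.add_apply]
    rw [e1, e2]
  have hJ : IntegrableOn (fun x => (inner ℂ (F₁ x) (F₂ x) : ℂ)) (Ioi (0 : ℝ)) := by
    refine hi3.congr ?_
    filter_upwards [h₁, h₂] with x e1 e2
    rw [e1, e2]
  have hlim := intervalIntegral_tendsto_integral_Ioi (0 : ℝ) hI tendsto_id
  have hlim2 : Tendsto (fun x => (inner ℂ (F₁ x) (F₂ x) : ℂ)) atTop
      (𝓝 ((∫ x in Ioi (0 : ℝ), (inner ℂ (F₁ x) (g₂ x) + inner ℂ (g₁ x) (F₂ x))) +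
        inner ℂ v₁ v₂)) := by
    refine (hlim.add_const (inner ℂ v₁ v₂)).congr' ?_
    filter_upwards [eventually_ge_atTop 0] with x hx
    have := (integral_bilin_primitive (isBoundedBilinearMap_inner (𝕜 := ℂ) (E := H))
      (L2Half.intervalIntegrable g₁ hx) (L2Half.intervalIntegrable g₂ hx) v₁ v₂).2
    simp only [id]
    rw [hF₁, hF₂]
    simp only at this ⊢
    rw [this]
    ring
  have h0 := IntegrableAtFilter.eq_zero_of_tendsto (l := atTop)
    ⟨Ioi 0, Ioi_mem_atTop 0, hJ⟩ (by
      intro s hs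
      obtain ⟨a, ha⟩ := mem_atTop_sets.1 hs
      exact top_le_iff.1 ((Real.volume_Ici (a := a)).symm.le.trans (measure_mono (fun x hx => ha x hx)))) hlim2
  rw [L2.inner_def, L2.inner_def, ← integral_add hi1 hi2, eq_neg_iff_add_eq_zero, ← h0]
  congr 1
  refine integral_congr_ae ?_
  filter_upwards [h₁, h₂] with x e1 e2
  rw [e1, e2]

end HalfLine

/-! ### Operators on a Hilbert space -/

section General

variable {H : Type*} [NormedAddCommGroup H] [InnerProductSpace ℂ H] [CompleteSpace H]

theorem inner_map_left {K : H →L[ℂ] H} (hK : star K = K) (x y : H) :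
    inner ℂ (K x) y = inner ℂ x (K y) := by
  conv_lhs => rw [← hK, ContinuousLinearMap.star_eq_adjoint,
    ContinuousLinearMap.adjoint_inner_left]

theorem inner_star_left (K : H →L[ℂ] H) (x y : H) :
    inner ℂ (star K x) y = inner ℂ x (K y) := by
  rw [ContinuousLinearMap.star_eq_adjoint, ContinuousLinearMap.adjoint_inner_left]

theorem inner_star_right (K : H →L[ℂ] H) (x y : H) :
    inner ℂ x (star K y) = inner ℂ (K x) y := by
  rw [ContinuousLinearMap.star_eq_adjoint, ContinuousLinearMap.adjoint_inner_right]

theorem denseRange_of_star_injective {K : H →L[ℂ] H} (h : Function.Injective (star K : H →L[ℂ] H)) :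
    DenseRange K := by
  have h1 : K.rangeᗮ = ⊥ := by
    rw [Submodule.eq_bot_iff]
    intro y hy
    apply h
    rw [map_zero]
    refine ext_inner_left ℂ fun x => ?_
    rw [inner_star_right, inner_zero_right]
    exact (Submodule.mem_orthogonal _ _).1 hy _ ⟨x, rfl⟩
  have h2 := (Submodule.topologicalClosure_eq_top_iff (K := K.range)).2 h1
  have h3 : Dense (K.range : Set H) := Submodule.dense_iff_topologicalClosure_eq_top.2 h2
  rwa [LinearMap.coe_range] at h3

theorem denseRange_of_isSelfAdjoint {K : H →L[ℂ] H} (hK : star K = K)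
    (h : Function.Injective K) : DenseRange K :=
  denseRange_of_star_injective (by rwa [hK])

/-- Two bounded operators that agree after composition with one of dense range are equal. -/
theorem eq_of_mul_eq_mul_right {K L S : H →L[ℂ] H} (hS : DenseRange S) (h : K * S = L * S) :
    K = L := by
  refine ContinuousLinearMap.coeFn_injective (hS.equalizer K.continuous L.continuous ?_)
  ext x
  exact DFunLike.congr_fun h x

theorem eq_of_mul_eq_mul_left {K L S : H →L[ℂ] H} (hS : Function.Injective S)
    (h : S * K = S * L) : K = L := by
  ext x
  exact hS (DFunLike.congr_fun h x)

/-- Douglas' factorization: if `‖K x‖ ≤ C ‖S x‖` for all `x`, then `K` factors through `S`. -/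
theorem exists_mul_eq_of_norm_le {K S : H →L[ℂ] H} (hS : DenseRange S) {C : ℝ}
    (h : ∀ x, ‖K x‖ ≤ C * ‖S x‖) : ∃ X : H →L[ℂ] H, X * S = K := by
  refine ⟨(K : H →ₗ[ℂ] H).extendOfNorm (S : H →ₗ[ℂ] H), ?_⟩
  ext x
  exact LinearMap.extendOfNorm_eq (f := (K : H →ₗ[ℂ] H)) (e := (S : H →ₗ[ℂ] H)) hS ⟨C, h⟩ x

/-- Riesz representation of a functional that is bounded with respect to a linear map. -/
theorem exists_inner_eq_of_norm_le {X : Type*} [AddCommGroup X] [Module ℂ X]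
    {E : Type*} [NormedAddCommGroup E] [InnerProductSpace ℂ E] [CompleteSpace E]
    (L : X →ₗ[ℂ] E) (ℓ : X →ₗ[ℂ] ℂ) {C : ℝ} (h : ∀ x, ‖ℓ x‖ ≤ C * ‖L x‖) :
    ∃ u : E, ∀ x, inner ℂ u (L x) = ℓ x := by
  obtain ⟨g, hg, -⟩ := exists_extension_norm_eq (LinearMap.range L) (ℓ.compLeftInverse L)
  refine ⟨(InnerProductSpace.toDual ℂ E).symm g, fun x => ?_⟩
  rw [InnerProductSpace.toDual_symm_apply]
  rw [hg ⟨L x, LinearMap.mem_range_self L x⟩]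
  exact LinearMap.compLeftInverse_apply_of_bdd ℓ L ⟨C, h⟩ x (L x) rfl

/-- A vector `y` belongs to the range of `S` if `|⟪y, z⟫| ≤ C ‖S* z‖` for all `z`. -/
theorem mem_range_of_norm_inner_le {S : H →L[ℂ] H} {y : H} {C : ℝ}
    (h : ∀ z, ‖inner ℂ y z‖ ≤ C * ‖star S z‖) : ∃ u, S u = y := by
  obtain ⟨u, hu⟩ := exists_inner_eq_of_norm_le ((star S : H →L[ℂ] H) : H →ₗ[ℂ] H)
    (innerSL ℂ y : H →ₗ[ℂ] ℂ) (C := C) h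
  refine ⟨u, ext_inner_right ℂ fun z => ?_⟩
  have := hu z
  simp only [ContinuousLinearMap.coe_coe, innerSL_apply_apply] at this
  rw [← this, inner_star_right]

end General

/-! ### The bounded transform of a self-adjoint operator -/

section Transform

variable {H : Type*} [NormedAddCommGroup H] [InnerProductSpace ℂ H] [CompleteSpace H]

/-- `A` in terms of commuting bounded self-adjoint operators: `J = j²` stands for `(1 + A²)^(-1/2)`
and `Λ` for `A (1 + A²)^(-1/2)`, so that `A = Λ J⁻¹`. -/
structure BoundedTransform (A : H →ₗ.[ℂ] H) (j Λ : H →L[ℂ] H) : Prop where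
  star_j : star j = j
  star_Λ : star Λ = Λ
  injective_j : Function.Injective j
  commute : Commute j Λ
  sq_add_sq : (j * j) * (j * j) + Λ * Λ = 1
  mem_graph_iff : ∀ p : H × H, p ∈ A.graph ↔ ∃ x, (j * j) x = p.1 ∧ Λ x = p.2

variable {A : H →ₗ.[ℂ] H}

/-- The operator `(1 + A²)⁻¹`. -/
def invJapaneseSq (A : H →ₗ.[ℂ] H) : H →L[ℂ] H :=
  resolventAt A Complex.I * resolventAt A (-Complex.I)

theorem resolvent_sub_resolvent (hA : IsSelfAdjoint A) {z w : ℂ} (hz : z.im ≠ 0)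
    (hw : w.im ≠ 0) :
    resolventAt A z - resolventAt A w = (z - w) • (resolventAt A w * resolventAt A z) := by
  have h1 := isResolventAt_resolventAt hA hz
  have h2 := isResolventAt_resolventAt hA hw
  ext x
  obtain ⟨u, hu, hAu⟩ := (LinearPMap.mem_graph_iff _).1 (h1.1 x)
  have h3 := h2.2 u
  simp only at hu hAu
  rw [hAu, hu] at h3
  change resolventAt A z x - resolventAt A w x = (z - w) • resolventAt A w (resolventAt A z x)
  rw [← map_smul, sub_smul]
  nth_rw 1 [← h3]
  rw [← map_sub]
  congr 1
  abel

theorem invJapaneseSq_eq (hA : IsSelfAdjoint A) :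
    resolventAt A Complex.I - resolventAt A (-Complex.I) =
      (2 * Complex.I) • invJapaneseSq A := by
  have h := resolvent_sub_resolvent hA (z := -Complex.I) (w := Complex.I) (by simp) (by simp)
  rw [← neg_sub, h, invJapaneseSq, ← neg_smul]
  congr 1
  ring

theorem resolvent_commute (hA : IsSelfAdjoint A) :
    Commute (resolventAt A Complex.I) (resolventAt A (-Complex.I)) := by
  have h1 := resolvent_sub_resolvent hA (z := Complex.I) (w := -Complex.I) (by simp) (by simp)
  have h2 := invJapaneseSq_eq hA
  rw [h1] at h2
  have h3 : (Complex.I - -Complex.I) = 2 * Complex.I := by ring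
  rw [h3] at h2
  exact (smul_right_injective _ (by simp) h2).symm

theorem resolvent_eq (hA : IsSelfAdjoint A) :
    resolventAt A Complex.I = boundedSign A + Complex.I • invJapaneseSq A := by
  have h := invJapaneseSq_eq hA
  have h2 : Complex.I • invJapaneseSq A =
      (1 / 2 : ℂ) • (resolventAt A Complex.I - resolventAt A (-Complex.I)) := by
    rw [h, smul_smul]; congr 1; ring
  rw [h2, boundedSign, ← smul_add]
  module

/-- With `b = (1 + A²)⁻¹`, this is `(A b)² = b - b²`. -/
theorem boundedSign_sq (hA : IsSelfAdjoint A) :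
    boundedSign A * boundedSign A =
      invJapaneseSq A - invJapaneseSq A * invJapaneseSq A := by
  have h := invJapaneseSq_eq hA
  have hc := resolvent_commute hA
  have h2 : invJapaneseSq A = (-(Complex.I) / 2) •
      (resolventAt A Complex.I - resolventAt A (-Complex.I)) := by
    rw [h, smul_smul]
    have : -Complex.I / 2 * (2 * Complex.I) = 1 := by
      ring_nf; simp
    rw [this, one_smul]
  have h3 : invJapaneseSq A * invJapaneseSq A = (-(1 : ℂ) / 4) •
      ((resolventAt A Complex.I - resolventAt A (-Complex.I)) *
        (resolventAt A Complex.I - resolventAt A (-Complex.I))) := by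
    rw [h2, smul_mul_smul_comm]
    congr 1
    ring_nf
    simp
    norm_num
  rw [h3, invJapaneseSq, boundedSign, smul_mul_smul_comm]
  simp only [mul_add, add_mul, mul_sub, sub_mul, hc.eq]
  module

theorem invJapaneseSq_nonneg (hA : IsSelfAdjoint A) : 0 ≤ invJapaneseSq A :=
  resolvent_mul_resolvent_nonneg hA

theorem invJapaneseSq_mem_graph (hA : IsSelfAdjoint A) (x : H) :
    (invJapaneseSq A x, boundedSign A x) ∈ A.graph := by
  have h1 := (isResolventAt_resolventAt hA (z := Complex.I) (by simp)).1 x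
  have h2 := (isResolventAt_resolventAt hA (z := -Complex.I) (by simp)).1 x
  have h3 := A.graph.smul_mem (-Complex.I / 2) (A.graph.sub_mem h1 h2)
  have h4 := DFunLike.congr_fun (invJapaneseSq_eq hA) x
  convert h3 using 1
  simp only [Prod.mk_sub_mk, Prod.smul_mk, Prod.mk.injEq]
  constructor
  · change _ = (-Complex.I / 2) • ((resolventAt A Complex.I - resolventAt A (-Complex.I)) x)
    rw [h4]
    change _ = (-Complex.I / 2) • ((2 * Complex.I) • invJapaneseSq A x)
    rw [smul_smul]
    have : -Complex.I / 2 * (2 * Complex.I) = 1 := by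
      ring_nf; simp
    rw [this, one_smul]
  · change (1 / 2 : ℂ) • (resolventAt A Complex.I x + resolventAt A (-Complex.I) x) = _
    have : -Complex.I / 2 * Complex.I = 1 / 2 := by
      ring_nf; simp; norm_num
    simp only [add_sub_add_left_eq_sub, neg_smul, sub_neg_eq_add, ← smul_add, smul_smul, this]

theorem invJapaneseSq_injective (hA : IsSelfAdjoint A) : Function.Injective (invJapaneseSq A) := by
  rw [injective_iff_map_eq_zero]
  intro x hx
  have h1 := invJapaneseSq_mem_graph hA x
  have h2 : boundedSign A x = 0 := A.graph_fst_eq_zero_snd h1 hx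
  have h3 := (isResolventAt_resolventAt hA (z := Complex.I) (by simp)).1 x
  have h4 : resolventAt A Complex.I x = 0 := by
    rw [resolvent_eq hA]
    simp [h2, hx]
  have h5 := A.graph_fst_eq_zero_snd h3 h4
  simpa [h4] using h5

/-- `(1 + A²)^(-1/4)`. -/
abbrev quarterPow (A : H →ₗ.[ℂ] H) : H →L[ℂ] H := invJapanesePow A (1 / 2)

theorem quarterPow_nonneg (A : H →ₗ.[ℂ] H) : 0 ≤ quarterPow A := CFC.rpow_nonneg

theorem star_quarterPow (A : H →ₗ.[ℂ] H) : star (quarterPow A) = quarterPow A :=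
  (IsSelfAdjoint.of_nonneg (quarterPow_nonneg A)).star_eq

theorem invJapanesePow_one (A : H →ₗ.[ℂ] H) :
    invJapanesePow A 1 = quarterPow A * quarterPow A := by
  have h : invJapaneseSq A ^ ((1 / 4 : NNReal) + (1 / 4 : NNReal)) = _ :=
    CFC.nnrpow_add (a := invJapaneseSq A) (x := 1 / 4) (y := 1 / 4) (by positivity) (by positivity)
  rw [CFC.nnrpow_eq_rpow (by positivity), CFC.nnrpow_eq_rpow (by positivity)] at h
  rw [quarterPow, invJapanesePow, invJapanesePow]
  change invJapaneseSq A ^ _ = invJapaneseSq A ^ _ * invJapaneseSq A ^ _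
  convert h using 2 <;> push_cast <;> norm_num

theorem quarterPow_four (hA : IsSelfAdjoint A) :
    (quarterPow A * quarterPow A) * (quarterPow A * quarterPow A) = invJapaneseSq A := by
  rw [← invJapanesePow_one A]
  have h : invJapaneseSq A ^ ((1 / 2 : NNReal) + (1 / 2 : NNReal)) = _ :=
    CFC.nnrpow_add (a := invJapaneseSq A) (x := 1 / 2) (y := 1 / 2) (by positivity) (by positivity)
  rw [CFC.nnrpow_eq_rpow (by positivity), CFC.nnrpow_eq_rpow (by positivity)] at h
  rw [invJapanesePow]
  change invJapaneseSq A ^ _ * invJapaneseSq A ^ _ = invJapaneseSq A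
  have h2 : invJapaneseSq A ^ (1 : ℝ) = invJapaneseSq A := CFC.rpow_one _ (invJapaneseSq_nonneg hA)
  have e1 : (((1 / 2 : NNReal) + (1 / 2 : NNReal) : NNReal) : ℝ) = 1 := by push_cast; norm_num
  have e2 : ((1 / 2 : NNReal) : ℝ) = 1 / 2 := by push_cast; rfl
  rw [e1, e2, h2] at h
  exact h.symm

theorem quarterPow_injective (hA : IsSelfAdjoint A) : Function.Injective (quarterPow A) := by
  rw [injective_iff_map_eq_zero]
  intro x hx
  apply invJapaneseSq_injective hA
  rw [← quarterPow_four hA, map_zero]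
  change quarterPow A (quarterPow A (quarterPow A (quarterPow A x))) = 0
  simp [hx]

theorem Commute.quarterPow {T : H →L[ℂ] H} (h : Commute (invJapaneseSq A) T) :
    Commute (quarterPow A) T :=
  h.cfc_nnreal _

/-- The bounded transform of a self-adjoint operator. -/
theorem exists_boundedTransform (hA : IsSelfAdjoint A) :
    ∃ Λ : H →L[ℂ] H, BoundedTransform A (quarterPow A) Λ ∧
      Λ * (quarterPow A * quarterPow A) = boundedSign A := by
  set j := quarterPow A with hj
  set b := invJapaneseSq A with hb
  set G := boundedSign A with hG
  have hjs : star j = j := star_quarterPow A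
  have hj4 : (j * j) * (j * j) = b := quarterPow_four hA
  have hji : Function.Injective j := quarterPow_injective hA
  have hJi : Function.Injective (j * j) := fun x y h => hji (hji h)
  have hJs : star (j * j) = j * j := by rw [star_mul, hjs]
  have hJd : DenseRange (j * j) := denseRange_of_isSelfAdjoint hJs hJi
  have hjd : DenseRange j := denseRange_of_isSelfAdjoint hjs hji
  have hGs : star G = G := isSelfAdjoint_boundedSign hA
  have hG2 : G * G = b - b * b := boundedSign_sq hA
  have hbG : Commute b G := by
    have hc := resolvent_commute hA
    have h1 : Commute b (resolventAt A Complex.I) := (Commute.refl _).mul_left hc.symm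
    have h2 : Commute b (resolventAt A (-Complex.I)) := hc.mul_left (Commute.refl _)
    exact (h1.add_right h2).smul_right _
  have hjG : Commute j G := Commute.quarterPow hbG
  have hbs : star b = b := (IsSelfAdjoint.of_nonneg (invJapaneseSq_nonneg hA)).star_eq
  -- `‖G x‖² = ⟪b x, x⟫ - ‖b x‖²` and `‖J x‖² = ⟪b x, x⟫`, so that `G` factors through `J`.
  have hle : ∀ x, ‖G x‖ ≤ 1 * ‖(j * j) x‖ := by
    intro x
    rw [one_mul]
    refine le_of_sq_le_sq ?_ (norm_nonneg _)
    have e1 : ((‖G x‖ ^ 2 : ℝ) : ℂ) = inner ℂ (b x) x - inner ℂ (b x) (b x) := by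
      rw [Complex.ofReal_pow]
      have := inner_self_eq_norm_sq_to_K (𝕜 := ℂ) (G x)
      simp only [Complex.coe_algebraMap] at this
      rw [← this, ← inner_map_left hGs]
      have h2 : G (G x) = b x - b (b x) := DFunLike.congr_fun hG2 x
      rw [h2, inner_sub_left, inner_map_left hbs (b x)]
    have e2 : ((‖(j * j) x‖ ^ 2 : ℝ) : ℂ) = inner ℂ (b x) x := by
      rw [Complex.ofReal_pow]
      have := inner_self_eq_norm_sq_to_K (𝕜 := ℂ) ((j * j) x)
      simp only [Complex.coe_algebraMap] at this
      rw [← this, ← inner_map_left hJs, ← hj4]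
      rfl
    have e3 : inner ℂ (b x) (b x) = ((‖b x‖ ^ 2 : ℝ) : ℂ) := by
      have := inner_self_eq_norm_sq_to_K (𝕜 := ℂ) (b x)
      simp only [Complex.coe_algebraMap] at this
      rw [this, Complex.ofReal_pow]
    rw [← e2, e3, ← Complex.ofReal_sub] at e1
    have e4 := Complex.ofReal_injective e1
    rw [e4]
    linarith [sq_nonneg ‖b x‖]
  obtain ⟨Λ, hΛ⟩ := exists_mul_eq_of_norm_le hJd hle
  have hjΛ : Commute j Λ := by
    refine eq_of_mul_eq_mul_right hJd ?_
    rw [mul_assoc, hΛ, hjG.eq, ← hΛ]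
    simp only [mul_assoc]
  have hJΛ : Commute (j * j) Λ := hjΛ.mul_left hjΛ
  have hΛs : star Λ = Λ := by
    refine eq_of_mul_eq_mul_left hJi ?_
    have h1 : star (Λ * (j * j)) = Λ * (j * j) := by rw [hΛ, hGs]
    rw [star_mul, hJs] at h1
    rw [h1, hJΛ.eq]
  have hsq : (j * j) * (j * j) + Λ * Λ = 1 := by
    refine eq_of_mul_eq_mul_right (denseRange_of_isSelfAdjoint hbs (invJapaneseSq_injective hA)) ?_
    have h1 : Λ * Λ * b = G * G := by
      rw [← hj4, ← hΛ]
      simp only [mul_assoc]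
      congr 1
      simp only [← mul_assoc]
      rw [← hjΛ.eq, mul_assoc j Λ j, ← hjΛ.eq]
      simp only [mul_assoc]
    rw [hj4, add_mul, h1, hG2, one_mul, add_sub_cancel]
  have hclosed : IsClosed (A.graph : Set (H × H)) := hA.isClosed
  have hmem : ∀ x, ((j * j) x, Λ x) ∈ A.graph := by
    intro x
    have hcont : Continuous fun x => ((j * j) x, Λ x) :=
      (j * j).continuous.prodMk Λ.continuous
    have hc : IsClosed {x | ((j * j) x, Λ x) ∈ (A.graph : Set (H × H))} := hclosed.preimage hcont
    refine hJd.induction_on (p := fun x => ((j * j) x, Λ x) ∈ (A.graph : Set (H × H))) x hc ?_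
    intro y
    have := invJapaneseSq_mem_graph hA y
    have e1 : (j * j) ((j * j) y) = b y := DFunLike.congr_fun hj4 y
    have e2 : Λ ((j * j) y) = G y := DFunLike.congr_fun hΛ y
    rw [e1, e2]
    exact this
  refine ⟨Λ, ⟨hjs, hΛs, hji, hjΛ, hsq, fun p => ⟨fun hp => ?_, ?_⟩⟩, hΛ⟩
  -- `p.1` is in the range of the resolvent `(A - i)⁻¹ = J (Λ + i J)`, hence of `J`.
  · obtain ⟨u, hu, hAu⟩ := (LinearPMap.mem_graph_iff _).1 hp
    have h1 := (isResolventAt_resolventAt hA (z := Complex.I) (by simp)).2 u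
    have h2 : resolventAt A Complex.I = (j * j) * (Λ + Complex.I • (j * j)) := by
      rw [resolvent_eq hA, mul_add, hJΛ.eq, hΛ, mul_smul_comm, hj4]
    rw [h2, hu] at h1
    have h3 : (j * j) ((Λ + Complex.I • (j * j)) (A u - Complex.I • p.1)) = p.1 := h1
    refine ⟨_, h3, ?_⟩
    have h4 := A.graph.sub_mem (hmem ((Λ + Complex.I • (j * j)) (A u - Complex.I • p.1))) hp
    have h5 := A.graph_fst_eq_zero_snd h4 (sub_eq_zero.2 h3)
    exact sub_eq_zero.1 h5
  · rintro ⟨x, h1, h2⟩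
    have := hmem x
    rw [h1, h2] at this
    exact this

end Transform

/-! ### The model problem in bounded terms -/

section Symmetry

variable {H : Type*} [NormedAddCommGroup H] [InnerProductSpace ℂ H] [CompleteSpace H]
  {A : H →ₗ.[ℂ] H}

/-- The data of the model problem in bounded terms: the bounded transform `(j, Λ)` of `A`, the
Clifford multiplication `γ`, and a projection `Q` that commutes with `A`, splits `H` into a
subspace where `A ≥ 0` and a subspace where `A ≤ 0`, and is exchanged with `1 - Q` by `γ`. -/
structure ModelData (A : H →ₗ.[ℂ] H) (j Λ γ Q : H →L[ℂ] H) : Prop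
    extends BoundedTransform A j Λ where
  star_γ : star γ = -γ
  γ_mul_γ : γ * γ = -1
  commute_γ : Commute j γ
  anticommute : γ * Λ = -(Λ * γ)
  proj : IsStarProjection Q
  commute_proj : Commute j Q
  commute_proj_Λ : Commute Λ Q
  nonneg : ∀ x, 0 ≤ (inner ℂ (Λ (Q x)) x).re
  nonpos : ∀ x, (inner ℂ (Λ ((1 - Q) x)) x).re ≤ 0
  γ_mul_proj : γ * Q = (1 - Q) * γ

theorem mem_graph_of_anticommute {γ : H →L[ℂ] H}
    (hγ_dom : A.domain.map (γ : H →ₗ[ℂ] H) = A.domain)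
    (hγ_anti : ∀ x y : A.domain, (y : H) = γ x → γ (A x) + A y = 0) {u w : H}
    (h : (u, w) ∈ A.graph) : (γ u, -γ w) ∈ A.graph := by
  obtain ⟨x, hx, hAx⟩ := (LinearPMap.mem_graph_iff _).1 h
  simp only at hx hAx
  have h1 : γ x ∈ A.domain := hγ_dom.le ⟨x, x.2, rfl⟩
  have h2 := hγ_anti x ⟨γ x, h1⟩ rfl
  rw [← hx, ← hAx, ← eq_neg_of_add_eq_zero_right h2]
  exact A.mem_graph ⟨γ x, h1⟩

theorem BoundedTransform.injective_sq {j Λ : H →L[ℂ] H} (B : BoundedTransform A j Λ) :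
    Function.Injective (j * j) := fun _ _ h => B.injective_j (B.injective_j h)

theorem BoundedTransform.star_sq {j Λ : H →L[ℂ] H} (B : BoundedTransform A j Λ) :
    star (j * j) = j * j := by rw [star_mul, B.star_j]

theorem BoundedTransform.denseRange {j Λ : H →L[ℂ] H} (B : BoundedTransform A j Λ) :
    DenseRange j := denseRange_of_isSelfAdjoint B.star_j B.injective_j

theorem BoundedTransform.denseRange_sq {j Λ : H →L[ℂ] H} (B : BoundedTransform A j Λ) :
    DenseRange (j * j) := denseRange_of_isSelfAdjoint B.star_sq B.injective_sq

theorem BoundedTransform.commute_sq {j Λ : H →L[ℂ] H} (B : BoundedTransform A j Λ) :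
    Commute (j * j) Λ := B.commute.mul_left B.commute

/-- `(1 + A²)⁻¹ y` is the only solution `p` of `p + A² p = y`. -/
theorem eq_invJapaneseSq_apply {j Λ : H →L[ℂ] H} (B : BoundedTransform A j Λ)
    (hb : (j * j) * (j * j) = invJapaneseSq A) {p q y : H} (h1 : (p, q) ∈ A.graph)
    (h2 : (q, y - p) ∈ A.graph) : p = invJapaneseSq A y := by
  obtain ⟨a, ha, ha'⟩ := (B.mem_graph_iff _).1 h1
  obtain ⟨c, hc, hc'⟩ := (B.mem_graph_iff _).1 h2
  simp only at ha ha' hc hc'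
  have h3 : y = Λ c + (j * j) a := by rw [hc', ha, sub_add_cancel]
  have h4 : (j * j) (Λ c) = Λ (Λ a) := by
    rw [ha', ← hc]
    exact DFunLike.congr_fun B.commute_sq.eq c
  have h5 : (j * j) ((j * j) a) + Λ (Λ a) = a := DFunLike.congr_fun B.sq_add_sq a
  rw [← hb, h3]
  change p = (j * j) ((j * j) (Λ c + (j * j) a))
  rw [map_add, h4, add_comm, h5, ha]

theorem commute_invJapaneseSq_of_anticommute (hA : IsSelfAdjoint A) {j Λ : H →L[ℂ] H}
    (B : BoundedTransform A j Λ) (hb : (j * j) * (j * j) = invJapaneseSq A) {γ : H →L[ℂ] H}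
    (hγ : ∀ u w, (u, w) ∈ A.graph → (γ u, -γ w) ∈ A.graph) :
    Commute (invJapaneseSq A) γ := by
  ext x
  obtain ⟨w, h1, h2⟩ := resolvent_mul_resolvent_spec hA x
  refine (eq_invJapaneseSq_apply B hb (hγ _ _ h1) (y := γ x) ?_).symm
  have h3 := A.graph.neg_mem (hγ _ _ h2)
  rw [Prod.neg_mk, neg_neg, map_sub] at h3
  exact h3

theorem BoundedTransform.anticommute_of_graph {j Λ : H →L[ℂ] H} (B : BoundedTransform A j Λ)
    {γ : H →L[ℂ] H} (hc : Commute j γ)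
    (hγ : ∀ u w, (u, w) ∈ A.graph → (γ u, -γ w) ∈ A.graph) : γ * Λ = -(Λ * γ) := by
  ext x
  obtain ⟨y, h1, h2⟩ := (B.mem_graph_iff _).1 (hγ _ _ ((B.mem_graph_iff _).2 ⟨x, rfl, rfl⟩))
  simp only at h1 h2
  have h3 : y = γ x := B.injective_sq (h1.trans
    (DFunLike.congr_fun (hc.mul_left hc).symm.eq x))
  rw [h3] at h2
  change γ (Λ x) = -Λ (γ x)
  rw [h2, neg_neg]

section Projection

variable {Q : H →L[ℂ] H}

theorem mul_posPart_of_le (hQ : IsStarProjection Q) (hge : positiveProj A ≤ Q) :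
    Q * (boundedSign A)⁺ = (boundedSign A)⁺ := by
  have h1 : Q * positiveProj A = positiveProj A :=
    (IsStarProjection.le_iff_mul_eq_right isStarProjection_starProjection hQ).1 hge
  ext x
  have h2 : positiveProj A ((boundedSign A)⁺ x) = (boundedSign A)⁺ x :=
    Submodule.starProjection_eq_self_iff.2 (Submodule.le_topologicalClosure _ ⟨x, rfl⟩)
  have h3 := DFunLike.congr_fun h1 ((boundedSign A)⁺ x)
  change Q (positiveProj A _) = positiveProj A _ at h3
  rw [h2] at h3
  exact h3

theorem negPart_mul_of_le (hQ : IsStarProjection Q) (hle : Q ≤ nonnegProj A) :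
    (boundedSign A)⁻ * Q = 0 := by
  have h1 : nonnegProj A * Q = Q :=
    (IsStarProjection.le_iff_mul_eq_right hQ isStarProjection_starProjection).1 hle
  ext x
  have h2 : nonnegProj A (Q x) = Q x := DFunLike.congr_fun h1 x
  have h3 : Q x ∈ ((boundedSign A)⁻).ker := Submodule.starProjection_eq_self_iff.1 h2
  exact h3

/-- A projection between `P_{(0,∞)}(A)` and `P_{[0,∞)}(A)` cuts out the positive part of `A (1 +
A²)⁻¹`. -/
theorem mul_boundedSign (hA : IsSelfAdjoint A) (hQ : IsStarProjection Q)
    (hge : positiveProj A ≤ Q) (hle : Q ≤ nonnegProj A) :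
    Q * boundedSign A = (boundedSign A)⁺ ∧ boundedSign A * Q = (boundedSign A)⁺ := by
  have hs := isSelfAdjoint_boundedSign hA
  have hp := mul_posPart_of_le hQ hge
  have hn := negPart_mul_of_le hQ hle
  have hp' := congrArg star hp
  have hn' := congrArg star hn
  rw [star_mul, hQ.isSelfAdjoint.star_eq, (CFC.posPart_nonneg _).isSelfAdjoint.star_eq] at hp'
  rw [star_mul, hQ.isSelfAdjoint.star_eq, (CFC.negPart_nonneg _).isSelfAdjoint.star_eq,
    star_zero] at hn'
  have hG := CFC.posPart_sub_negPart (boundedSign A) hs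
  constructor
  · nth_rw 1 [← hG]
    rw [mul_sub, hp, hn', sub_zero]
  · nth_rw 1 [← hG]
    rw [sub_mul, hp', hn, sub_zero]

/-- A projection between `P_{(0,∞)}(A)` and `P_{[0,∞)}(A)` commutes with `(1 + A²)⁻¹`: the
commutator vanishes on the range of `A (1 + A²)⁻¹`, and on its kernel `ker A`, where
`(1 + A²)⁻¹` is the identity. -/
theorem commute_invJapaneseSq_of_le (hA : IsSelfAdjoint A) {j Λ : H →L[ℂ] H}
    (B : BoundedTransform A j Λ) (hb : (j * j) * (j * j) = invJapaneseSq A)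
    (hG : Λ * (j * j) = boundedSign A) (hQ : IsStarProjection Q)
    (hge : positiveProj A ≤ Q) (hle : Q ≤ nonnegProj A) : Commute (invJapaneseSq A) Q := by
  obtain ⟨h1, h2⟩ := mul_boundedSign hA hQ hge hle
  have hs := isSelfAdjoint_boundedSign hA
  set b := invJapaneseSq A
  set G := boundedSign A
  have hbs : star b = b := (invJapaneseSq_nonneg hA).isSelfAdjoint.star_eq
  have hbG : Commute b G := by
    rw [← hb, ← hG]
    have := B.commute_sq
    exact ((this.mul_left this).mul_right ((Commute.refl (j * j)).mul_left (Commute.refl _)))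
  have hbG' : Commute b G⁺ := by
    rw [CFC.posPart_def]
    exact ((hbG.symm.cfcₙ_real _)).symm
  set K := Q * b - b * Q with hK
  have hKG : K * G = 0 := by
    rw [hK, sub_mul, mul_assoc, hbG.eq, ← mul_assoc, h1, mul_assoc, h1, hbG'.eq, sub_self]
  have hKs : star K = -K := by
    rw [hK, star_sub, star_mul, star_mul, hbs, hQ.isSelfAdjoint.star_eq, neg_sub]
  have hGK : G * K = 0 := by
    have := congrArg star hKG
    rw [star_mul, hKs, hs.star_eq, star_zero, mul_neg, neg_eq_zero] at this
    exact this
  have hker : ∀ k, G k = 0 → b k = k := by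
    intro k hk
    have h3 : (j * j) (Λ k) = 0 := by
      have h4 : (j * j) (Λ k) = (Λ * (j * j)) k := DFunLike.congr_fun B.commute_sq.eq k
      rw [h4, hG, hk]
    have h5 : Λ k = 0 := B.injective_sq (by rw [h3, map_zero])
    have h6 : ((j * j) * (j * j)) k + Λ (Λ k) = k := DFunLike.congr_fun B.sq_add_sq k
    rw [h5, map_zero, add_zero, hb] at h6
    exact h6
  have hKK : star K * K = 0 := by
    ext x
    have h3 : G (K x) = 0 := DFunLike.congr_fun hGK x
    have h4 : G (Q (K x)) = 0 := by
      have : G (Q (K x)) = Q (G (K x)) := DFunLike.congr_fun (h2.trans h1.symm) (K x)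
      rw [this, h3, map_zero]
    rw [hKs]
    change -(Q (b (K x)) - b (Q (K x))) = 0
    rw [hker _ h3, hker _ h4, sub_self, neg_zero]
  have hK0 : K = 0 := (CStarRing.star_mul_self_eq_zero_iff K).1 hKK
  exact (sub_eq_zero.1 hK0).symm

end Projection

/-- The hypotheses on `A`, `γ` and `P_+(A)`, in terms of the bounded transform of `A`. -/
theorem exists_modelData (hA : IsSelfAdjoint A) {γ Q : H →L[ℂ] H} (hγ_skew : star γ = -γ)
    (hγ_sq : γ * γ = -1) (hγ_dom : A.domain.map (γ : H →ₗ[ℂ] H) = A.domain)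
    (hγ_anti : ∀ x y : A.domain, (y : H) = γ x → γ (A x) + A y = 0)
    (hQ : IsStarProjection Q) (hQ_symm : 1 - Q = star γ * Q * γ)
    (hge : positiveProj A ≤ Q) (hle : Q ≤ nonnegProj A) :
    ∃ Λ, ModelData A (quarterPow A) Λ γ Q := by
  obtain ⟨Λ, B, hG⟩ := exists_boundedTransform hA
  have hb := quarterPow_four hA
  have hgr : ∀ u w, (u, w) ∈ A.graph → (γ u, -γ w) ∈ A.graph := fun u w h =>
    mem_graph_of_anticommute hγ_dom hγ_anti h
  have hγj : Commute (quarterPow A) γ :=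
    Commute.quarterPow (commute_invJapaneseSq_of_anticommute hA B hb hgr)
  have hQj : Commute (quarterPow A) Q :=
    Commute.quarterPow (commute_invJapaneseSq_of_le hA B hb hG hQ hge hle)
  obtain ⟨h1, h2⟩ := mul_boundedSign hA hQ hge hle
  have hQΛ : Commute Λ Q := by
    refine eq_of_mul_eq_mul_right B.denseRange_sq ?_
    rw [mul_assoc, ← (hQj.mul_left hQj).eq, ← mul_assoc, hG, mul_assoc, hG, h1, h2]
  have key : ∀ (x : H), inner ℂ (Λ (Q (quarterPow A x))) (quarterPow A x) =
      inner ℂ ((boundedSign A)⁺ x) x := by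
    intro x
    rw [← inner_map_left B.star_j, ← h2, ← hG]
    congr 1
    change (quarterPow A * (Λ * Q * quarterPow A)) x = (Λ * (quarterPow A * quarterPow A) * Q) x
    congr 1
    rw [← mul_assoc, ← mul_assoc, B.commute.eq]
    simp only [mul_assoc]
    rw [hQj.eq]
  have key' : ∀ (x : H), inner ℂ (Λ ((1 - Q) (quarterPow A x))) (quarterPow A x) =
      -inner ℂ ((boundedSign A)⁻ x) x := by
    intro x
    have h3 : inner ℂ (Λ (quarterPow A x)) (quarterPow A x) = inner ℂ (boundedSign A x) x := by
      rw [← inner_map_left B.star_j, ← hG]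
      congr 1
      change (quarterPow A * (Λ * quarterPow A)) x = (Λ * (quarterPow A * quarterPow A)) x
      rw [← mul_assoc, B.commute.eq, mul_assoc]
    have h4 := CFC.posPart_sub_negPart (boundedSign A) (isSelfAdjoint_boundedSign hA)
    have h5 : boundedSign A x = (boundedSign A)⁺ x - (boundedSign A)⁻ x :=
      (DFunLike.congr_fun h4 x).symm
    rw [h5, inner_sub_left] at h3
    change inner ℂ (Λ (quarterPow A x - Q (quarterPow A x))) (quarterPow A x) = _
    rw [map_sub, inner_sub_left, key, h3]
    ring
  have hpos : ∀ {T : H →L[ℂ] H}, 0 ≤ T → ∀ x, 0 ≤ (inner ℂ (T x) x).re := fun hT x =>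
    ((ContinuousLinearMap.nonneg_iff_isPositive _).1 hT).re_inner_nonneg_left x
  refine ⟨Λ, { B with
    star_γ := hγ_skew
    γ_mul_γ := hγ_sq
    commute_γ := hγj
    anticommute := B.anticommute_of_graph hγj hgr
    proj := hQ
    commute_proj := hQj
    commute_proj_Λ := hQΛ
    nonneg := fun x => ?_
    nonpos := fun x => ?_
    γ_mul_proj := ?_ }⟩
  · refine B.denseRange.induction_on (p := fun x => 0 ≤ (inner ℂ (Λ (Q x)) x).re) x
      (isClosed_le continuous_const ?_) fun y => ?_
    · exact Complex.continuous_re.comp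
        (((Λ.continuous.comp Q.continuous)).inner continuous_id)
    · rw [key]
      exact hpos (CFC.posPart_nonneg _) y
  · refine B.denseRange.induction_on (p := fun x => (inner ℂ (Λ ((1 - Q) x)) x).re ≤ 0) x
      (isClosed_le ?_ continuous_const) fun y => ?_
    · exact Complex.continuous_re.comp
        (((Λ.continuous.comp (1 - Q).continuous)).inner continuous_id)
    · rw [key', Complex.neg_re, Left.neg_nonpos_iff]
      exact hpos (CFC.negPart_nonneg _) y
  · have h3 := congrArg (γ * ·) hQ_symm
    simp only [hγ_skew, neg_mul, mul_neg, ← mul_assoc, hγ_sq, one_mul, neg_neg] at h3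
    rw [sub_mul, one_mul, ← h3, mul_sub, mul_one, sub_sub_cancel]

end Symmetry

/-! ### Operators of order zero -/

section Flat

variable {H : Type*} [NormedAddCommGroup H] [InnerProductSpace ℂ H] [CompleteSpace H]
  {A : H →ₗ.[ℂ] H}

/-- `H_∞(A)` is dense: with `b = (1 + A²)⁻¹`, the operator `(b - ε)⁺` has values in `H_∞(A)` and
differs from `b` by at most `ε`. -/
theorem dense_smoothSpace (hA : IsSelfAdjoint A) : Dense (smoothSpace A : Set H) := by
  set b := invJapaneseSq A with hb
  have hb0 : 0 ≤ b := invJapaneseSq_nonneg hA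
  have hsa : IsSelfAdjoint b := hb0.isSelfAdjoint
  have hspec : ∀ t ∈ spectrum ℝ b, 0 ≤ t := fun t ht => spectrum_nonneg_of_nonneg hb0 ht
  have hmem : ∀ ε : ℝ, 0 < ε → ∀ x, cfc (fun t : ℝ => max (t - ε) 0) b x ∈ smoothSpace A := by
    intro ε hε x
    simp only [smoothSpace, Submodule.mem_iInf]
    intro s hs
    refine ⟨cfc (fun t : ℝ => max (t - ε) 0 * (max t ε) ^ (-(s / 2))) b x, ?_⟩
    change (invJapanesePow A s * cfc (fun t : ℝ => max (t - ε) 0 * (max t ε) ^ (-(s / 2))) b) x = _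
    congr 1
    have hc : Continuous fun t : ℝ => (max t ε) ^ (-(s / 2)) :=
      (continuous_id.max continuous_const).rpow_const
        fun t => Or.inl (lt_of_lt_of_le hε (le_max_right _ _)).ne'
    have hc' : Continuous fun t : ℝ => max (t - ε) 0 * (max t ε) ^ (-(s / 2)) :=
      ((continuous_id.sub continuous_const).max continuous_const).mul hc
    have hc2 : Continuous fun t : ℝ => t ^ (s / 2) :=
      Real.continuous_rpow_const (by positivity)
    have e : invJapanesePow A s = cfc (fun t : ℝ => t ^ (s / 2)) b :=
      CFC.rpow_eq_cfc_real hb0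
    rw [e, ← cfc_mul _ _ b hc2.continuousOn hc'.continuousOn]
    refine cfc_congr fun t ht => ?_
    rcases le_total t ε with h | h
    · rw [max_eq_right (by linarith)]; simp
    · rw [max_eq_left (by linarith), max_eq_left h, mul_left_comm,
        ← Real.rpow_add (lt_of_lt_of_le hε h), add_neg_cancel, Real.rpow_zero, mul_one]
  have hnorm : ∀ ε : ℝ, 0 < ε → ‖cfc (fun t : ℝ => max (t - ε) 0) b - b‖ ≤ ε := by
    intro ε hε
    have hc : Continuous fun t : ℝ => max (t - ε) 0 :=
      (continuous_id.sub continuous_const).max continuous_const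
    have e : cfc (fun t : ℝ => max (t - ε) 0) b - b =
        cfc (fun t : ℝ => max (t - ε) 0 - t) b := by
      rw [cfc_sub (fun t : ℝ => max (t - ε) 0) (fun t => t) b hc.continuousOn, cfc_id' ℝ b]
    rw [e]
    refine norm_cfc_le hε.le fun t ht => ?_
    have := hspec t ht
    rw [Real.norm_eq_abs, abs_le]
    constructor
    · linarith [le_max_left (t - ε) 0]
    · rcases max_cases (t - ε) 0 with h | h <;> linarith
  have hbd : DenseRange b := denseRange_of_isSelfAdjoint hsa.star_eq (invJapaneseSq_injective hA)
  have hsub : Set.range b ⊆ closure (smoothSpace A : Set H) := by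
    rintro _ ⟨x, rfl⟩
    rw [Metric.mem_closure_iff]
    intro δ hδ
    have hε : 0 < δ / (‖x‖ + 1) := by positivity
    refine ⟨_, hmem _ hε x, ?_⟩
    rw [dist_comm, dist_eq_norm]
    change ‖(cfc (fun t : ℝ => max (t - δ / (‖x‖ + 1)) 0) b - b) x‖ < δ
    refine (ContinuousLinearMap.le_opNorm _ _).trans_lt ?_
    calc _ ≤ δ / (‖x‖ + 1) * ‖x‖ := by gcongr; exact hnorm _ hε
      _ < δ := by
        rw [div_mul_eq_mul_div, div_lt_iff₀ (by positivity)]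
        nlinarith
  have := hbd.closure_eq
  exact dense_iff_closure_eq.2 (Set.eq_univ_of_univ_subset (by
    rw [← this]; exact closure_minimal hsub isClosed_closure))

theorem apply_mem_smoothSpace {T : H →L[ℂ] H} (hT : T ∈ OpZero A) {x : H}
    (hx : x ∈ smoothSpace A) : T x ∈ smoothSpace A := by
  obtain ⟨B, -, hB⟩ := hT
  rw [hB ⟨x, hx⟩]
  exact (B _).2

theorem exists_sq_eq_of_mem_smoothSpace {x : H} (hx : x ∈ smoothSpace A) :
    ∃ y, (quarterPow A * quarterPow A) y = x := by
  simp only [smoothSpace, Submodule.mem_iInf] at hx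
  obtain ⟨y, hy⟩ := hx 1 zero_le_one
  rw [invJapanesePow_one] at hy
  exact ⟨y, hy⟩

/-- An operator `T` of order zero is bounded for the norm of `H_{-1/2}`, so that `j T` factors
through `j = (1 + A²)^(-1/4)`. -/
theorem exists_mul_quarterPow_eq (hA : IsSelfAdjoint A) {T : H →L[ℂ] H} (hT : T ∈ OpZero A) :
    ∃ X : H →L[ℂ] H, X * quarterPow A = quarterPow A * T := by
  obtain ⟨B, hB, hTB⟩ := hT
  obtain ⟨C, hC⟩ := hB (-1 / 2)
  have hsn : ∀ x, scaleNorm A (-1 / 2) x = ‖quarterPow A x‖ := by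
    intro x
    rw [scaleNorm, if_neg (by norm_num)]
    norm_num
  have hd := denseRange_of_isSelfAdjoint (star_quarterPow A) (quarterPow_injective hA)
  refine exists_mul_eq_of_norm_le hd (C := C) fun x => ?_
  refine (dense_smoothSpace hA).induction
    (P := fun x => ‖(quarterPow A * T) x‖ ≤ C * ‖quarterPow A x‖) (fun y hy => ?_) ?_ x
  · have := hC ⟨y, hy⟩
    rw [add_zero, hsn, hsn, ← hTB] at this
    exact this
  · exact isClosed_le (by fun_prop) (by fun_prop)

end Flat

/-! ### Regularization -/

section Regularizer

variable {X : Type*} [NormedAddCommGroup X] [InnerProductSpace ℂ X] [CompleteSpace X]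

/-- The operator `(J² + ε)⁻¹`. -/
def regularizer (J : X →L[ℂ] X) (ε : ℝ) : X →L[ℂ] X :=
  Ring.inverse (J * J + (ε : ℂ) • 1)

variable {J : X →L[ℂ] X} {ε : ℝ}

theorem re_inner_sq (hJ : star J = J) (x : X) : inner ℂ (J (J x)) x = ((‖J x‖ ^ 2 : ℝ) : ℂ) := by
  rw [inner_map_left hJ, inner_self_eq_norm_sq_to_K]
  push_cast
  rfl

theorem isUnit_sq_add (hJ : star J = J) (hε : 0 < ε) : IsUnit (J * J + (ε : ℂ) • 1) := by
  refine ContinuousLinearMap.isUnit_of_forall_le_norm_inner_map _ (c := ⟨ε, hε.le⟩) hε fun x => ?_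
  change ‖x‖ ^ 2 * ε ≤ ‖inner ℂ (J (J x) + (ε : ℂ) • x) x‖
  rw [inner_add_left, re_inner_sq hJ, inner_smul_left, inner_self_eq_norm_sq_to_K,
    Complex.conj_ofReal]
  simp only [Complex.coe_algebraMap]
  rw [← Complex.ofReal_pow ‖x‖, ← Complex.ofReal_mul, ← Complex.ofReal_add, Complex.norm_real,
    Real.norm_eq_abs]
  refine le_trans ?_ (le_abs_self _)
  nlinarith [sq_nonneg ‖J x‖]

theorem regularizer_mul (hJ : star J = J) (hε : 0 < ε) :
    regularizer J ε * (J * J + (ε : ℂ) • 1) = 1 :=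
  Ring.inverse_mul_cancel _ (isUnit_sq_add hJ hε)

theorem mul_regularizer (hJ : star J = J) (hε : 0 < ε) :
    (J * J + (ε : ℂ) • 1) * regularizer J ε = 1 :=
  Ring.mul_inverse_cancel _ (isUnit_sq_add hJ hε)

theorem star_regularizer (hJ : star J = J) : star (regularizer J ε) = regularizer J ε := by
  rw [regularizer, ← Ring.inverse_star, star_add, star_mul, star_smul, star_one, hJ]
  simp

theorem commute_regularizer {T : X →L[ℂ] X} (h : Commute J T) : Commute (regularizer J ε) T := by
  have hc : Commute (J * J + (ε : ℂ) • 1) T :=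
    (h.mul_left h).add_left ((Commute.one_left T).smul_left _)
  rw [regularizer]
  by_cases hu : IsUnit (J * J + (ε : ℂ) • 1)
  · obtain ⟨w, hw⟩ := hu
    rw [← hw] at hc ⊢
    rw [Ring.inverse_unit]
    exact hc.units_inv_left
  · rw [Ring.inverse_non_unit _ hu]
    exact Commute.zero_left T

theorem regularizer_mul_sq (hJ : star J = J) (hε : 0 < ε) (x : X) :
    regularizer J ε (J (J x)) = x - (ε : ℂ) • regularizer J ε x := by
  have h : regularizer J ε (J (J x) + (ε : ℂ) • x) = x :=
    DFunLike.congr_fun (regularizer_mul hJ hε) x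
  rw [map_add, map_smul] at h
  exact eq_sub_of_add_eq h

theorem norm_sq_add_norm_smul_le (hJ : star J = J) (hε : 0 < ε) (y : X) :
    ‖J (J y)‖ ^ 2 + ‖(ε : ℂ) • y‖ ^ 2 ≤ ‖J (J y) + (ε : ℂ) • y‖ ^ 2 := by
  rw [@norm_add_sq ℂ]
  have : RCLike.re (inner ℂ (J (J y)) ((ε : ℂ) • y)) = ε * ‖J y‖ ^ 2 := by
    rw [inner_smul_right, re_inner_sq hJ, ← Complex.ofReal_mul]
    exact Complex.ofReal_re _
  rw [this]
  have : 0 ≤ ε * ‖J y‖ ^ 2 := by positivity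
  linarith

theorem norm_smul_regularizer_le (hJ : star J = J) (hε : 0 < ε) (x : X) :
    ‖(ε : ℂ) • regularizer J ε x‖ ≤ ‖x‖ := by
  have h1 : J (J (regularizer J ε x)) + (ε : ℂ) • regularizer J ε x = x :=
    DFunLike.congr_fun (mul_regularizer hJ hε) x
  have h2 := norm_sq_add_norm_smul_le hJ hε (regularizer J ε x)
  rw [h1] at h2
  exact le_of_sq_le_sq (by nlinarith [sq_nonneg ‖J (J (regularizer J ε x))‖]) (norm_nonneg _)

/-- The operators `(J² + ε)⁻¹ J²` are contractions. -/
theorem norm_regularizer_mul_sq_le (hJ : star J = J) (hε : 0 < ε) (x : X) :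
    ‖regularizer J ε (J (J x))‖ ≤ ‖x‖ := by
  have h1 : J (J (regularizer J ε x)) + (ε : ℂ) • regularizer J ε x = x :=
    DFunLike.congr_fun (mul_regularizer hJ hε) x
  have h2 := norm_sq_add_norm_smul_le hJ hε (regularizer J ε x)
  rw [h1] at h2
  have h3 : regularizer J ε (J (J x)) = J (J (regularizer J ε x)) := by
    have := commute_regularizer (ε := ε) (Commute.refl J)
    exact DFunLike.congr_fun (this.mul_right this).eq x
  rw [h3]
  exact le_of_sq_le_sq (by nlinarith [sq_nonneg ‖(ε : ℂ) • regularizer J ε x‖]) (norm_nonneg _)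

/-- The operators `(J² + ε)⁻¹ J²` converge strongly to the identity as `ε → 0`. -/
theorem tendsto_regularizer (hJ : star J = J) (hi : Function.Injective J) (x : X) :
    Tendsto (fun ε => regularizer J ε (J (J x))) (𝓝[>] 0) (𝓝 x) := by
  have hd : DenseRange (J * J) := denseRange_of_isSelfAdjoint (by rw [star_mul, hJ])
    fun _ _ h => hi (hi h)
  rw [Metric.tendsto_nhds]
  intro δ hδ
  obtain ⟨y, hy⟩ := hd.exists_dist_lt x (half_pos hδ)
  have h1 : ∀ᶠ ε : ℝ in 𝓝[>] 0, ε * ‖y‖ < δ / 2 := by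
    have : Tendsto (fun ε : ℝ => ε * ‖y‖) (𝓝[>] 0) (𝓝 (0 * ‖y‖)) :=
      (tendsto_nhdsWithin_of_tendsto_nhds tendsto_id).mul_const _
    rw [zero_mul] at this
    exact this.eventually_lt_const (by positivity)
  filter_upwards [h1, self_mem_nhdsWithin] with ε h2 hε
  have hε' : 0 < ε := hε
  rw [regularizer_mul_sq hJ hε, dist_eq_norm, sub_sub_cancel_left, norm_neg]
  have e : (ε : ℂ) • regularizer J ε x = (ε : ℂ) • regularizer J ε (x - (J * J) y) +
      (ε : ℂ) • regularizer J ε (J (J y)) := by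
    rw [← smul_add, ← map_add]
    congr 2
    exact (sub_add_cancel _ _).symm
  rw [e]
  refine (norm_add_le _ _).trans_lt ?_
  have h3 := norm_smul_regularizer_le hJ hε' (x - (J * J) y)
  have h4 : ‖(ε : ℂ) • regularizer J ε (J (J y))‖ ≤ ε * ‖y‖ := by
    rw [norm_smul, Complex.norm_real, Real.norm_of_nonneg hε'.le]
    exact mul_le_mul_of_nonneg_left (norm_regularizer_mul_sq_le hJ hε' y) hε'.le
  rw [dist_eq_norm] at hy
  linarith

/-- A vector whose regularized preimages under `S` stay bounded is in the range of `S`. -/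
theorem mem_range_of_regularized {S : X →L[ℂ] X} (hS : star S = S) {E : ℝ → X} {q : ℝ → X}
    {v : X} (hE : Tendsto E (𝓝[>] 0) (𝓝 v)) (hq : ∀ ε, S (q ε) = E ε) {C : ℝ}
    (hC : ∀ ε > 0, ‖q ε‖ ≤ C) : ∃ u, S u = v := by
  refine mem_range_of_norm_inner_le (C := C) fun z => ?_
  have h1 : Tendsto (fun ε => ‖inner ℂ (E ε) z‖) (𝓝[>] 0) (𝓝 ‖inner ℂ v z‖) :=
    (hE.inner tendsto_const_nhds).norm
  refine le_of_tendsto h1 ?_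
  filter_upwards [self_mem_nhdsWithin] with ε hε
  rw [← hq, inner_map_left hS, hS]
  exact (norm_inner_le_norm _ _).trans (mul_le_mul_of_nonneg_right (hC ε hε) (norm_nonneg _))

end Regularizer

/-! ### Maximal solutions and the energy identity -/

section Energy

variable {H : Type*} [NormedAddCommGroup H] [InnerProductSpace ℂ H] [CompleteSpace H]
  {A : H →ₗ.[ℂ] H} {j Λ : H →L[ℂ] H}

theorem lift_star_eq {K : H →L[ℂ] H} (hK : star K = K) : star (lift K) = lift K := by
  rw [← lift_star, hK]

theorem lift_lift (K L : H →L[ℂ] H) (f : L2Half H) : lift K (lift L f) = lift (K * L) f := by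
  rw [lift_mul]
  rfl

theorem lift_commute {K L : H →L[ℂ] H} (h : Commute K L) : Commute (lift K) (lift L) := by
  rw [Commute, SemiconjBy, ← lift_mul, h.eq, lift_mul]

theorem lift_regularizer {J : H →L[ℂ] H} (hJ : star J = J) {ε : ℝ} (hε : 0 < ε) :
    lift (regularizer J ε) = regularizer (lift J) ε := by
  have h1 := congrArg lift (regularizer_mul hJ hε)
  rw [lift_mul, lift_add, lift_mul, lift_smul, lift_one] at h1
  have h2 := mul_regularizer (lift_star_eq hJ) hε
  exact left_inv_eq_right_inv h1 h2

theorem BoundedTransform.norm_sq_add_norm_sq (B : BoundedTransform A j Λ) (x : H) :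
    ‖(j * j) x‖ ^ 2 + ‖Λ x‖ ^ 2 = ‖x‖ ^ 2 := by
  have h : (j * j) ((j * j) x) + Λ (Λ x) = x := DFunLike.congr_fun B.sq_add_sq x
  have h2 := congrArg (fun y => inner ℂ y x) h
  simp only [inner_add_left, re_inner_sq B.star_sq, re_inner_sq B.star_Λ] at h2
  rw [inner_self_eq_norm_sq_to_K, ← Complex.ofReal_add] at h2
  simp only [Complex.coe_algebraMap, ← Complex.ofReal_pow] at h2
  exact Complex.ofReal_injective h2

theorem BoundedTransform.norm_sq_add_norm_sq_lift (B : BoundedTransform A j Λ) (f : L2Half H) :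
    ‖lift (j * j) f‖ ^ 2 + ‖lift Λ f‖ ^ 2 = ‖f‖ ^ 2 := by
  have h : lift (j * j) (lift (j * j) f) + lift Λ (lift Λ f) = f := by
    have := congrArg lift B.sq_add_sq
    rw [lift_add, lift_mul (j * j), lift_mul Λ, lift_one] at this
    exact DFunLike.congr_fun this f
  have h2 := congrArg (fun y => inner ℂ y f) h
  simp only [inner_add_left, re_inner_sq (lift_star_eq B.star_sq),
    re_inner_sq (lift_star_eq B.star_Λ)] at h2
  rw [inner_self_eq_norm_sq_to_K, ← Complex.ofReal_add] at h2
  simp only [Complex.coe_algebraMap, ← Complex.ofReal_pow] at h2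
  exact Complex.ofReal_injective h2

/-- `u` is a weak solution of `u' + A u = h` in the maximal sense: the equation holds after
multiplication by `J = (1 + A²)^(-1/2)`, and `J u` has the boundary value `w`. -/
def MaxSolution (j Λ : H →L[ℂ] H) (u h : L2Half H) (w : H) : Prop :=
  HasTrace (lift (j * j) u) (lift (j * j) h - lift Λ u) w

/-- The energy identity for `u' + A u = h`, weighted by `d`. -/
theorem MaxSolution.energy (B : BoundedTransform A j Λ) {u h : L2Half H} {w : H}
    (hu : MaxSolution j Λ u h w) {d : H →L[ℂ] H} (hd : star d = d) (hdj : Commute j d) :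
    2 * (inner ℂ (lift (d * (j * j)) u) (lift Λ u)).re =
      2 * (inner ℂ (lift (d * (j * j) * (j * j)) u) h).re + (inner ℂ w (d w)).re := by
  have hJd : Commute (j * j) d := hdj.mul_left hdj
  have h1 := HasTrace.inner_add_inner hu (hu.map d)
  have e1 : inner ℂ (lift (j * j) u) (lift d (lift (j * j) h - lift Λ u)) =
      inner ℂ (lift (d * (j * j) * (j * j)) u) h - inner ℂ (lift (d * (j * j)) u) (lift Λ u) := by
    rw [← inner_map_left (lift_star_eq hd), inner_sub_right]
    congr 1
    · rw [← inner_map_left (lift_star_eq B.star_sq)]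
      congr 1
      change (lift (j * j) * (lift d * lift (j * j))) u = _
      rw [← lift_mul, ← lift_mul, ← mul_assoc, hJd.eq]
    · rw [lift_lift]
  have e2 : (inner ℂ (lift (j * j) h - lift Λ u) (lift d (lift (j * j) u))).re =
      (inner ℂ (lift (d * (j * j) * (j * j)) u) h - inner ℂ (lift (d * (j * j)) u) (lift Λ u)).re :=
      by
    rw [← e1]
    rw [← inner_map_left (lift_star_eq hd), ← inner_conj_symm, Complex.conj_re]
  have h2 := congrArg Complex.re h1
  rw [Complex.add_re, e1, e2, Complex.neg_re, Complex.sub_re] at h2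
  linarith

/-- The boundary value of a function in `L²(ℝ₊, H₁)` with derivative in `L²` lies in `H_{1/2}`. -/
theorem HasTrace.exists_quarterPow_eq (B : BoundedTransform A j Λ) {f g : L2Half H} {v : H}
    (h : HasTrace (lift (j * j) f) g v) : ∃ x, j x = v := by
  have hJs := B.star_sq
  refine mem_range_of_regularized B.star_j
    (tendsto_regularizer hJs B.injective_sq v)
    (q := fun ε => (regularizer (j * j) ε * (j * j * j)) v) (fun ε => ?_)
    (C := Real.sqrt (2 * (‖f‖ * ‖g‖))) fun ε hε => ?_
  · have hc := commute_regularizer (J := j * j) (ε := ε) (T := j)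
      ((Commute.refl j).mul_left (Commute.refl j))
    change (j * (regularizer (j * j) ε * (j * j * j))) v =
      (regularizer (j * j) ε * (j * j * (j * j))) v
    congr 1
    rw [← mul_assoc, ← hc.eq]
    simp only [mul_assoc]
  · set D := regularizer (j * j) ε with hD
    have hc : Commute D j := commute_regularizer ((Commute.refl j).mul_left (Commute.refl j))
    have hDs : star D = D := star_regularizer hJs
    set q := D * (j * j * j) with hq
    have hqs : star q = q := by
      have : Commute D (j * j * j) := (hc.mul_right hc).mul_right hc
      nth_rw 2 [hq]
      rw [this.eq, hq]
      simp only [star_mul, hDs, B.star_j, mul_assoc]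
    -- The formula `2 Re ⟪f', q² f⟫ = -‖q f(0)‖²` bounds `q v`, as `q² J` is bounded
    -- uniformly in `ε`.
    have h1 := HasTrace.inner_add_inner h (h.map (q * q))
    have h2 := congrArg Complex.re h1
    have e0 : q * q * (j * j) = D * (j * j * (j * j)) * (D * (j * j * (j * j))) := by
      have hc3 : Commute D (j * j * j) := (hc.mul_right hc).mul_right hc
      have hc4 : Commute D (j * j * (j * j)) :=
        (hc.mul_right hc).mul_right (hc.mul_right hc)
      calc q * q * (j * j) = D * ((j * j * j) * D) * (j * j * j * (j * j)) := by
            simp only [hq, mul_assoc]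
        _ = D * ((j * j * (j * j)) * D) * (j * j * (j * j)) := by
            rw [← hc3.eq, ← hc4.eq]; simp only [mul_assoc]
        _ = _ := by simp only [mul_assoc]
    have e1 : inner ℂ (lift (j * j) f) (lift (q * q) g) = inner ℂ (lift (q * q * (j * j)) f) g := by
      rw [← inner_map_left (lift_star_eq (by rw [star_mul, hqs])), lift_mul (q * q)]
      rfl
    have e2 : (inner ℂ g (lift (q * q) (lift (j * j) f))).re =
        (inner ℂ (lift (q * q * (j * j)) f) g).re := by
      rw [← inner_conj_symm, Complex.conj_re, lift_mul (q * q)]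
      rfl
    have e3 : inner ℂ v ((q * q) v) = ((‖q v‖ ^ 2 : ℝ) : ℂ) := by
      change inner ℂ v (q (q v)) = _
      rw [← inner_map_left hqs, inner_self_eq_norm_sq_to_K]
      push_cast; rfl
    rw [Complex.add_re, e1, e2, Complex.neg_re, e3, Complex.ofReal_re, e0] at h2
    have e4 : ‖lift (D * (j * j * (j * j)) * (D * (j * j * (j * j)))) f‖ ≤ ‖f‖ := by
      have hle : ∀ g : L2Half H, ‖lift (D * (j * j * (j * j))) g‖ ≤ ‖g‖ := by
        intro g
        rw [lift_mul, lift_mul (j * j), hD, lift_regularizer hJs hε]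
        exact norm_regularizer_mul_sq_le (lift_star_eq hJs) hε g
      rw [lift_mul]
      exact (hle _).trans (hle _)
    have e5 := (Complex.abs_re_le_norm (inner ℂ
      (lift (D * (j * j * (j * j)) * (D * (j * j * (j * j)))) f) g)).trans (norm_inner_le_norm _ _)
    have e6 := abs_le.1 (e5.trans (mul_le_mul_of_nonneg_right e4 (norm_nonneg _)))
    refine Real.le_sqrt_of_sq_le ?_
    linarith [e6.1]

theorem bounded_of_sq_le {t a M : ℝ} (ha : 0 ≤ a) (hM : 0 ≤ M) (h : t ^ 2 ≤ t * a + M) :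
    t ≤ a + Real.sqrt M := by
  by_contra hcon
  push Not at hcon
  have h1 := Real.sqrt_nonneg M
  have h2 := Real.sq_sqrt hM
  nlinarith

/-- Interior and boundary regularity: a maximal solution `u` of `u' + A u = h` with `J u(0) = j v`
lies in `L²(ℝ₊, H₁)` as soon as `⟪A v_ε, v_ε⟫` is bounded from above for regularizations `v_ε`
of the generalized boundary value. -/
theorem MaxSolution.exists_lift_eq (B : BoundedTransform A j Λ) {u h : L2Half H} {v : H}
    (hu : MaxSolution j Λ u h (j v)) {M : ℝ}
    (hM : ∀ ε > 0, (inner ℂ (Λ ((regularizer (j * j) ε * (j * j)) v))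
      ((regularizer (j * j) ε * (j * j)) v)).re ≤ M) :
    ∃ f, lift (j * j) f = u := by
  have hJs := B.star_sq
  refine mem_range_of_regularized (lift_star_eq hJs)
    (tendsto_regularizer (lift_star_eq hJs) (lift_injective B.injective_sq) u)
    (q := fun ε => (regularizer (lift (j * j)) ε * (lift (j * j))) u) (fun ε => ?_)
    (C := Real.sqrt (‖u‖ ^ 2 + (‖h‖ + Real.sqrt (max M 0)) ^ 2)) fun ε hε => ?_
  · have hc := commute_regularizer (J := lift (j * j)) (ε := ε) (Commute.refl _)
    change (lift (j * j) * (regularizer (lift (j * j)) ε * (lift (j * j)))) u =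
      (regularizer (lift (j * j)) ε * (lift (j * j) * lift (j * j))) u
    rw [← mul_assoc, ← hc.eq]
    rfl
  · set D := regularizer (j * j) ε with hD
    have hcj : Commute D j := commute_regularizer ((Commute.refl j).mul_left (Commute.refl j))
    have hcJ : Commute D (j * j) := hcj.mul_right hcj
    have hcΛ : Commute D Λ := commute_regularizer B.commute_sq
    have hJΛ := B.commute_sq
    have hDs : star D = D := star_regularizer hJs
    rw [← lift_regularizer hJs hε, ← hD, ← lift_mul]
    set p := D * (j * j) with hp
    have hpJ : Commute p (j * j) := hcJ.mul_left (Commute.refl _)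
    have hpj : Commute p j := hcj.mul_left ((Commute.refl j).mul_left (Commute.refl j))
    have hpΛ : Commute p Λ := hcΛ.mul_left hJΛ
    have hps : star p = p := by rw [hp, star_mul, hJs, hDs, hcJ.eq]
    -- With this weight, the left-hand side of the energy identity is `2 ‖Λ p u‖²`, which controls
    -- the regularization of `A u`.
    set d := Λ * (D * p) with hd
    have hDp : Commute D p := (Commute.refl D).mul_right hcJ
    have hds : star d = d := by
      rw [hd]
      simp only [star_mul, hps, hDs, B.star_Λ]
      rw [← hDp.eq, (hcΛ.mul_left hpΛ).eq]
    have hdj : Commute j d := (B.commute).mul_right (hcj.symm.mul_right hpj.symm)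
    have hen := hu.energy B hds hdj
    have e1 : d * (j * j) = Λ * p * p := by
      rw [hd, mul_assoc, mul_assoc, hpJ.eq, ← mul_assoc D, ← hp, ← mul_assoc]
    have e2 : inner ℂ (lift (d * (j * j)) u) (lift Λ u) = ((‖lift (Λ * p) u‖ ^ 2 : ℝ) : ℂ) := by
      rw [e1, ← hpΛ.eq, mul_assoc, lift_mul]
      change inner ℂ (lift p (lift (Λ * p) u)) _ = _
      rw [inner_map_left (lift_star_eq hps)]
      change inner ℂ _ ((lift p * lift Λ) u) = _
      rw [← lift_mul, hpΛ.eq, inner_self_eq_norm_sq_to_K]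
      push_cast; rfl
    have e3 : inner ℂ (lift (d * (j * j) * (j * j)) u) h =
        inner ℂ (lift (Λ * p) u) (lift (p * (j * j)) h) := by
      have hs : star (p * (j * j)) = p * (j * j) := by rw [star_mul, hJs, hps, hpJ.eq]
      rw [← inner_map_left (lift_star_eq hs)]
      change _ = inner ℂ ((lift (p * (j * j)) * lift (Λ * p)) u) h
      rw [← lift_mul, e1]
      congr 3
      have h5 : Commute (p * (j * j)) (Λ * p) :=
        (hpΛ.mul_left hJΛ).mul_right ((Commute.refl p).mul_left hpJ.symm)
      rw [h5.eq]
      simp only [mul_assoc]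
    have e4 : inner ℂ (j v) (d (j v)) = inner ℂ (p v) (Λ (p v)) := by
      have h6 : j * (d * j) = p * (Λ * p) := by
        rw [← mul_assoc, hdj.eq, mul_assoc, e1]
        exact (congrArg (· * p) hpΛ.eq.symm).trans (mul_assoc _ _ _)
      rw [inner_map_left B.star_j, inner_map_left hps]
      congr 1
      exact DFunLike.congr_fun h6 v
    have hM' := hM ε hε
    rw [e2, e3, e4, Complex.ofReal_re] at hen
    have e5 : (inner ℂ (p v) (Λ (p v))).re ≤ max M 0 := by
      rw [← inner_conj_symm, Complex.conj_re]
      exact hM'.trans (le_max_left _ _)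
    have e6 : ‖lift (p * (j * j)) h‖ ≤ ‖h‖ := by
      rw [hp, mul_assoc, lift_mul, lift_mul (j * j), hD, lift_regularizer hJs hε]
      exact norm_regularizer_mul_sq_le (lift_star_eq hJs) hε h
    have e6' : ‖lift (p * (j * j)) u‖ ≤ ‖u‖ := by
      rw [hp, mul_assoc, lift_mul, lift_mul (j * j), hD, lift_regularizer hJs hε]
      exact norm_regularizer_mul_sq_le (lift_star_eq hJs) hε u
    have e7 : (inner ℂ (lift (Λ * p) u) (lift (p * (j * j)) h)).re ≤ ‖lift (Λ * p) u‖ * ‖h‖ :=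
      ((Complex.re_le_norm _).trans (norm_inner_le_norm _ _)).trans
        (mul_le_mul_of_nonneg_left e6 (norm_nonneg _))
    have e8 : ‖lift (Λ * p) u‖ ≤ ‖h‖ + Real.sqrt (max M 0) := by
      refine bounded_of_sq_le (norm_nonneg _) (le_max_right _ _) ?_
      have : 0 ≤ max M 0 := le_max_right _ _
      linarith
    refine Real.le_sqrt_of_sq_le ?_
    have e9 := B.norm_sq_add_norm_sq_lift (lift p u)
    have e10 : lift (j * j) (lift p u) = lift (p * (j * j)) u := by
      rw [hpJ.eq, lift_mul (j * j)]; rfl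
    have e11 : lift Λ (lift p u) = lift (Λ * p) u := lift_lift _ _ _
    rw [e10, e11] at e9
    rw [← e9]
    gcongr

/-- A maximal solution in `L²(ℝ₊, H₁)` is a strong solution, and its boundary value lies
in `H_{1/2}`. -/
theorem MaxSolution.hasTrace_of_lift (B : BoundedTransform A j Λ) {f h : L2Half H} {w : H}
    (hu : MaxSolution j Λ (lift (j * j) f) h w) :
    ∃ x, HasTrace (lift (j * j) f) (h - lift Λ f) (j x) ∧ j ((j * j) x) = w := by
  have e : lift (j * j) h - lift Λ (lift (j * j) f) = lift (j * j) (h - lift Λ f) := by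
    rw [map_sub]
    congr 1
    exact (DFunLike.congr_fun (lift_commute B.commute_sq).eq f).symm
  rw [MaxSolution, e] at hu
  obtain ⟨v, hv, hv'⟩ := hu.of_lift B.injective_sq
  obtain ⟨x, rfl⟩ := hv.exists_quarterPow_eq B
  exact ⟨x, hv, hv'⟩

end Energy

/-! ### A Cauchy cycle of two circles -/

section Circles

theorem integral_circleMap_mul (c : ℂ) (R : ℝ) (g : ℂ → ℂ) :
    ∫ t in (0 : ℝ)..1, deriv (fun t : ℝ => circleMap c R (2 * Real.pi * t)) t *
      g (circleMap c R (2 * Real.pi * t)) = ∮ z in C(c, R), g z := by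
  have hd : ∀ t : ℝ, deriv (fun t : ℝ => circleMap c R (2 * Real.pi * t)) t =
      (2 * Real.pi : ℝ) • deriv (circleMap c R) (2 * Real.pi * t) := fun t =>
    deriv_comp_mul_left (2 * Real.pi) (circleMap c R) t
  simp only [hd, smul_mul_assoc]
  rw [intervalIntegral.integral_smul, intervalIntegral.smul_integral_comp_mul_left
    (fun θ => deriv (circleMap c R) θ * g (circleMap c R θ))]
  simp [circleIntegral]

theorem circleIntegral_sub_inv_of_notMem {c w : ℂ} {R : ℝ} (hR : 0 ≤ R)
    (hw : w ∉ Metric.closedBall c R) : ∮ z in C(c, R), (z - w)⁻¹ = 0 := by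
  refine DiffContOnCl.circleIntegral_eq_zero hR ?_
  have hd : DifferentiableOn ℂ (fun z => (z - w)⁻¹) (Metric.closedBall c R) := by
    intro z hz
    refine ((differentiableAt_id.sub_const w).inv ?_).differentiableWithinAt
    rintro h
    exact hw (by rwa [← sub_eq_zero.1 h])
  exact hd.diffContOnCl_ball subset_rfl

/-- Two circles, of center `0` and radius `δ / 4` and of center `m` and radius `m - δ / 2`. -/
def twoCircles (δ m : ℝ) : Fin 2 → ℝ → ℂ :=
  ![fun t => circleMap 0 (δ / 4) (2 * Real.pi * t),
    fun t => circleMap m (m - δ / 2) (2 * Real.pi * t)]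

/-- The two circles wind once around a set in `{0} ∪ [δ, m]`: the first one around `0`, the
second one around `[δ, m]`. -/
theorem isCauchyCycle_twoCircles {δ m : ℝ} (hδ : 0 < δ) (hm : δ ≤ m) {K : Set ℂ}
    (hK : ∀ w ∈ K, w = 0 ∨ ∃ r : ℝ, δ ≤ r ∧ r ≤ m ∧ w = r) :
    IsCauchyCycle K (Metric.ball 0 (δ / 3) ∪ Metric.ball (m : ℂ) (m - δ / 3))
      (twoCircles δ m) := by
  have hpi : (2 * Real.pi * Complex.I : ℂ) ≠ 0 := by simp [Real.pi_ne_zero]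
  have hdist : ∀ r : ℝ, r ≤ m → dist (r : ℂ) (m : ℂ) = m - r := by
    intro r hr
    rw [dist_comm, dist_eq_norm, ← Complex.ofReal_sub, Complex.norm_real,
      Real.norm_of_nonneg (by linarith)]
  have hdist0 : dist (0 : ℂ) (m : ℂ) = m := by
    have := hdist 0 (by linarith)
    simpa using this
  have hint : ∀ w, ∑ i, ∫ t in (0 : ℝ)..1, deriv (twoCircles δ m i) t / (twoCircles δ m i t - w) =
      (∮ z in C(0, δ / 4), (z - w)⁻¹) + ∮ z in C(m, m - δ / 2), (z - w)⁻¹ := by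
    intro w
    simp only [div_eq_mul_inv, Fin.sum_univ_two]
    rw [← integral_circleMap_mul 0, ← integral_circleMap_mul m]
    rfl
  refine ⟨?_, ?_, ?_, ?_, ?_⟩
  · intro i
    fin_cases i
    · exact (contDiff_circleMap 0 (δ / 4)).comp (contDiff_const.mul contDiff_id)
    · exact (contDiff_circleMap m (m - δ / 2)).comp (contDiff_const.mul contDiff_id)
  · intro i
    fin_cases i <;> simp [twoCircles, circleMap]
  · intro i t _
    fin_cases i
    · have h1 : dist (circleMap 0 (δ / 4) (2 * Real.pi * t)) 0 = δ / 4 := by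
        simpa using (circleMap_mem_sphere 0 (by positivity) (2 * Real.pi * t) :
          circleMap 0 (δ / 4) _ ∈ Metric.sphere 0 (δ / 4))
      change circleMap 0 (δ / 4) (2 * Real.pi * t) ∈ _
      refine ⟨Or.inl ?_, fun hw => ?_⟩
      · rw [Metric.mem_ball, h1]; linarith
      · rcases hK _ hw with h | ⟨r, hr, -, h⟩
        · rw [h, dist_self] at h1; linarith
        · rw [h, dist_zero_right, Complex.norm_real, Real.norm_of_nonneg (by linarith)] at h1
          linarith
    · have h1 : dist (circleMap m (m - δ / 2) (2 * Real.pi * t)) m = m - δ / 2 :=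
        circleMap_mem_sphere (m : ℂ) (by linarith) (2 * Real.pi * t)
      change circleMap m (m - δ / 2) (2 * Real.pi * t) ∈ _
      refine ⟨Or.inr ?_, fun hw => ?_⟩
      · rw [Metric.mem_ball, h1]; linarith
      · rcases hK _ hw with h | ⟨r, hr, hr', h⟩
        · rw [h, hdist0] at h1; linarith
        · rw [h, hdist r hr'] at h1
          linarith
  · intro w hw
    rw [hint]
    rcases hK w hw with rfl | ⟨r, hr, hr', rfl⟩
    · rw [circleIntegral.integral_sub_inv_of_mem_ball (by simp; positivity),
        circleIntegral_sub_inv_of_notMem (by linarith), add_zero, inv_mul_cancel₀ hpi]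
      rw [Metric.mem_closedBall, hdist0]
      linarith
    · rw [circleIntegral.integral_sub_inv_of_mem_ball (c := (m : ℂ)),
        circleIntegral_sub_inv_of_notMem (by linarith), zero_add, inv_mul_cancel₀ hpi]
      · rw [Metric.mem_closedBall, dist_zero_right, Complex.norm_real,
          Real.norm_of_nonneg (by linarith)]
        linarith
      · rw [Metric.mem_ball, hdist r hr']
        linarith
  · intro w hw
    rw [hint, circleIntegral_sub_inv_of_notMem (by linarith),
      circleIntegral_sub_inv_of_notMem (by linarith), add_zero, mul_zero]
    · exact fun h => hw (Or.inr (Metric.closedBall_subset_ball (by linarith) h))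
    · exact fun h => hw (Or.inl (Metric.closedBall_subset_ball (by linarith) h))

/-- The function that is `0` near `0` and `z⁻¹` elsewhere. -/
def cutInv (δ : ℝ) (z : ℂ) : ℂ := if ‖z‖ < δ / 3 then 0 else z⁻¹

theorem differentiableOn_cutInv {δ m : ℝ} (hδ : 0 < δ) (hm : δ ≤ m) :
    DifferentiableOn ℂ (cutInv δ)
      (Metric.ball 0 (δ / 3) ∪ Metric.ball (m : ℂ) (m - δ / 3)) := by
  rintro z (hz | hz)
  · refine DifferentiableAt.differentiableWithinAt ?_
    have : cutInv δ =ᶠ[𝓝 z] fun _ => 0 := by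
      filter_upwards [Metric.isOpen_ball.mem_nhds hz] with w hw
      rw [cutInv, if_pos (by simpa using hw)]
    exact (differentiableAt_const _).congr_of_eventuallyEq this
  · refine DifferentiableAt.differentiableWithinAt ?_
    have hfar : ∀ w ∈ Metric.ball (m : ℂ) (m - δ / 3), δ / 3 < ‖w‖ := by
      intro w hw
      rw [Metric.mem_ball, dist_comm, dist_eq_norm] at hw
      have h1 := norm_le_norm_add_norm_sub w (m : ℂ)
      rw [Complex.norm_real, Real.norm_of_nonneg (by linarith)] at h1
      rw [norm_sub_rev] at h1
      rw [norm_sub_rev] at hw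
      linarith [norm_sub_rev (m : ℂ) w]
    have : cutInv δ =ᶠ[𝓝 z] fun w => w⁻¹ := by
      filter_upwards [Metric.isOpen_ball.mem_nhds hz] with w hw
      rw [cutInv, if_neg (hfar w hw).not_gt]
    refine DifferentiableAt.congr_of_eventuallyEq (differentiableAt_inv ?_) this
    rintro rfl
    have := hfar _ hz
    rw [norm_zero] at this
    linarith

/-- As `0` is isolated in `K`, the convention `0⁻¹ = 0` makes the inverse continuous on `K`; it is
the function whose functional calculus gives the pseudo-inverse. -/
theorem continuousOn_inv_of_gap {δ m : ℝ} (hδ : 0 < δ) {K : Set ℂ}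
    (hK : ∀ w ∈ K, w = 0 ∨ ∃ r : ℝ, δ ≤ r ∧ r ≤ m ∧ w = r) :
    ContinuousOn (fun w : ℂ => w⁻¹) K := by
  intro w hw
  by_cases h0 : w = 0
  · subst h0
    have : (fun w : ℂ => w⁻¹) =ᶠ[𝓝[K] 0] fun _ => (0 : ℂ)⁻¹ := by
      filter_upwards [self_mem_nhdsWithin, mem_nhdsWithin_of_mem_nhds
        (Metric.ball_mem_nhds (0 : ℂ) hδ)] with z hz hz'
      rcases hK z hz with rfl | ⟨r, hr, -, rfl⟩
      · rfl
      · rw [Metric.mem_ball, dist_zero_right, Complex.norm_real,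
          Real.norm_of_nonneg (by linarith)] at hz'
        linarith
    exact continuousWithinAt_const.congr_of_eventuallyEq this rfl
  · exact (continuousAt_inv₀ h0).continuousWithinAt

/-- The Cauchy formula for `z⁻¹` on the circle around `[δ, m]`. It holds for `w = 0` too, as both
sides vanish. -/
theorem circleIntegral_sub_inv_smul_inv {δ m : ℝ} (hδ : 0 < δ) (hm : δ ≤ m) {w : ℂ}
    (hw : w = 0 ∨ ∃ r : ℝ, δ ≤ r ∧ r ≤ m ∧ w = r) :
    ∮ z in C(m, m - δ / 2), (z - w)⁻¹ • z⁻¹ = (2 * Real.pi * Complex.I) * w⁻¹ := by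
  have hd : DiffContOnCl ℂ (fun z : ℂ => z⁻¹) (Metric.ball (m : ℂ) (m - δ / 2)) := by
    have hd : DifferentiableOn ℂ (fun z : ℂ => z⁻¹) (Metric.closedBall (m : ℂ) (m - δ / 2)) := by
      intro z hz
      refine (differentiableAt_inv ?_).differentiableWithinAt
      rintro rfl
      rw [Metric.mem_closedBall, dist_comm, dist_eq_norm, sub_zero, Complex.norm_real,
        Real.norm_of_nonneg (by linarith)] at hz
      linarith
    exact hd.diffContOnCl_ball subset_rfl
  rcases hw with rfl | ⟨r, hr, hr', rfl⟩
  · have : DiffContOnCl ℂ (fun z : ℂ => (z - 0)⁻¹ • z⁻¹) (Metric.ball (m : ℂ) (m - δ / 2)) := by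
      simp only [sub_zero]
      exact hd.smul hd
    rw [this.circleIntegral_eq_zero (by linarith), inv_zero, mul_zero]
  · rw [hd.circleIntegral_sub_inv_smul, smul_eq_mul]
    rw [Metric.mem_ball, dist_comm, dist_eq_norm, ← Complex.ofReal_sub, Complex.norm_real,
      Real.norm_of_nonneg (by linarith)]
    linarith

end Circles

/-! ### The pseudo-inverse of an operator with a spectral gap -/

section Parametrix

variable {H : Type*} [NormedAddCommGroup H] [InnerProductSpace ℂ H] [CompleteSpace H]

/-- The hypothesis says `S² ≥ δ S`, which keeps the spectrum of `S` off the interval `(0, δ)`. -/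
theorem spectrum_of_gap {S : H →L[ℂ] H} (hS : 0 ≤ S) {δ : ℝ}
    (hgap : ∀ x, δ * (inner ℂ (S x) x).re ≤ ‖S x‖ ^ 2) (hδ : 0 < δ) (w : ℂ)
    (hw : w ∈ spectrum ℂ S) : w = 0 ∨ ∃ r : ℝ, δ ≤ r ∧ r ≤ ‖S‖ + δ ∧ w = r := by
  have hsa := hS.isSelfAdjoint
  obtain ⟨r, rfl⟩ : ∃ r : ℝ, (r : ℂ) = w := ⟨w.re, (hsa.mem_spectrum_eq_re hw).symm⟩
  have hr : r ∈ spectrum ℝ S := (spectrum.algebraMap_mem_iff ℂ).1 hw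
  have hr0 : 0 ≤ r := spectrum_nonneg_of_nonneg hS hr
  have hpos : 0 ≤ S * S - δ • S := by
    rw [ContinuousLinearMap.nonneg_iff_isPositive, ContinuousLinearMap.isPositive_def']
    refine ⟨by
      rw [isSelfAdjoint_iff, star_sub, star_mul, star_smul, hsa.star_eq, star_trivial δ],
      fun x => ?_⟩
    have e : (S * S - δ • S).reApplyInnerSelf x = ‖S x‖ ^ 2 - δ * (inner ℂ (S x) x).re := by
      rw [ContinuousLinearMap.reApplyInnerSelf_apply]
      change (inner ℂ (S (S x) - δ • S x) x).re = _
      rw [inner_sub_left, re_inner_sq hsa.star_eq, ← Complex.coe_smul, inner_smul_left,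
        Complex.conj_ofReal, Complex.sub_re, Complex.re_ofReal_mul, Complex.ofReal_re]
    rw [e]
    linarith [hgap x]
  have hcfc : S * S - δ • S = cfc (fun t : ℝ => t * t - δ * t) S := by
    rw [cfc_sub (fun t : ℝ => t * t) (fun t => δ * t) S, cfc_mul (fun t : ℝ => t) (fun t => t) S,
      cfc_const_mul δ (fun t : ℝ => t) S, cfc_id' ℝ S]
  rw [hcfc, cfc_nonneg_iff _ S] at hpos
  have h1 : 0 ≤ r * (r - δ) := by have := hpos r hr; nlinarith
  rcases hr0.eq_or_lt with h0 | h0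
  · left; rw [← h0]; simp
  · refine Or.inr ⟨r, ?_, ?_, rfl⟩
    · by_contra hcon
      push Not at hcon
      nlinarith
    · have := spectrum.norm_le_norm_mul_of_mem hw
      have h3 : ‖(1 : H →L[ℂ] H)‖ ≤ 1 := ContinuousLinearMap.norm_id_le
      rw [Complex.norm_real, Real.norm_of_nonneg hr0] at this
      nlinarith [norm_nonneg S]

theorem resolvent_eq_cfc {S : H →L[ℂ] H} (hS : IsStarNormal S) {z : ℂ} (hz : z ∉ spectrum ℂ S) :
    resolvent S z = cfc (fun w => (z - w)⁻¹) S := by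
  have hne : ∀ w ∈ spectrum ℂ S, z - w ≠ 0 := by
    intro w hw h
    exact hz (by rwa [sub_eq_zero.1 h])
  have hc : ContinuousOn (fun w => (z - w)⁻¹) (spectrum ℂ S) :=
    (continuousOn_const.sub continuousOn_id).inv₀ hne
  have h1 : algebraMap ℂ (H →L[ℂ] H) z - S = cfc (fun w => z - w) S := by
    rw [cfc_sub (fun _ => z) (fun w => w) S, cfc_const z S, cfc_id' ℂ S]
  have h2 : (algebraMap ℂ (H →L[ℂ] H) z - S) * cfc (fun w => (z - w)⁻¹) S = 1 := by
    rw [h1, ← cfc_mul _ _ S (by fun_prop) hc, ← cfc_one ℂ S]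
    exact cfc_congr fun w hw => mul_inv_cancel₀ (hne w hw)
  have h3 : resolvent S z * (algebraMap ℂ (H →L[ℂ] H) z - S) = 1 :=
    Ring.inverse_mul_cancel _ (spectrum.notMem_iff.1 hz)
  exact left_inv_eq_right_inv h3 h2

/-- The Cauchy integral of the function that is `0` near `0` and `z⁻¹` elsewhere is the
pseudo-inverse of `S`. -/
theorem cauchyIntegral_cutInv {S : H →L[ℂ] H} (hS : IsStarNormal S) {δ m : ℝ} (hδ : 0 < δ)
    (hm : δ ≤ m) (hK : ∀ w ∈ spectrum ℂ S, w = 0 ∨ ∃ r : ℝ, δ ≤ r ∧ r ≤ m ∧ w = r) :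
    cauchyIntegral S (cutInv δ) (twoCircles δ m) = cfc (fun w : ℂ => w⁻¹) S := by
  have hpi : (2 * Real.pi * Complex.I : ℂ) ≠ 0 := by simp [Real.pi_ne_zero]
  have hcyc := isCauchyCycle_twoCircles hδ hm hK
  -- The function vanishes on the first circle.
  have h1 : ∫ t in (0 : ℝ)..1, (deriv (twoCircles δ m 0) t * cutInv δ (twoCircles δ m 0 t)) •
      resolvent S (twoCircles δ m 0 t) = 0 := by
    suffices h0 : ∀ t, (deriv (twoCircles δ m 0) t * cutInv δ (twoCircles δ m 0 t)) •
        resolvent S (twoCircles δ m 0 t) = 0 by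
      simp only [h0, intervalIntegral.integral_zero]
    intro t
    have : ‖twoCircles δ m 0 t‖ = δ / 4 :=
      mem_sphere_zero_iff_norm.1 (circleMap_mem_sphere 0 (by positivity) (2 * Real.pi * t))
    rw [cutInv, if_pos (by rw [this]; linarith), mul_zero, zero_smul]
  set c := twoCircles δ m 1 with hc
  have hcm : ∀ t, c t = circleMap m (m - δ / 2) (2 * Real.pi * t) := fun t => rfl
  have hcd : ContDiff ℝ 1 c := hcyc.contDiff 1
  have hfar : ∀ z ∈ Metric.closedBall (m : ℂ) (m - δ / 2), δ / 2 ≤ ‖z‖ := by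
    intro z hz
    rw [Metric.mem_closedBall, dist_comm, dist_eq_norm] at hz
    have h2 := norm_le_norm_add_norm_sub z (m : ℂ)
    rw [Complex.norm_real, Real.norm_of_nonneg (by linarith)] at h2
    linarith [norm_sub_rev (m : ℂ) z]
  have hcc : ∀ t, c t ∈ Metric.sphere (m : ℂ) (m - δ / 2) := fun t =>
    circleMap_mem_sphere (m : ℂ) (by linarith) (2 * Real.pi * t)
  have hcf : ∀ t, cutInv δ (c t) = (c t)⁻¹ := by
    intro t
    rw [cutInv, if_neg]
    linarith [hfar _ (Metric.sphere_subset_closedBall (hcc t))]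
  have hc0 : ∀ t, c t ≠ 0 := by
    intro t h0
    have := hfar _ (Metric.sphere_subset_closedBall (hcc t))
    rw [h0, norm_zero] at this
    linarith
  have hne : ∀ t ∈ Icc (0 : ℝ) 1, ∀ w ∈ spectrum ℂ S, c t - w ≠ 0 := by
    intro t ht w hw h0
    exact (hcyc.mapsTo 1 t ht).2 (by rw [← hc, sub_eq_zero.1 h0]; exact hw)
  set φ : ℝ → ℂ → ℂ := fun t w => deriv c t * (c t)⁻¹ * (c t - w)⁻¹ with hφ
  have hφc : ContinuousOn (Function.uncurry φ) (Icc 0 1 ×ˢ spectrum ℂ S) := by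
    have e1 : Continuous fun p : ℝ × ℂ => deriv c p.1 :=
      (hcd.continuous_deriv le_rfl).comp continuous_fst
    have e2 : Continuous fun p : ℝ × ℂ => c p.1 := hcd.continuous.comp continuous_fst
    refine ContinuousOn.mul (e1.mul (e2.inv₀ fun p => hc0 p.1)).continuousOn ?_
    exact (e2.sub continuous_snd).continuousOn.inv₀ fun p hp => hne _ hp.1 _ hp.2
  obtain ⟨M, hM⟩ := (isCompact_Icc.prod (spectrum.isCompact S)).exists_bound_of_continuousOn hφc
  have h2 : ∫ t in (0 : ℝ)..1, (deriv c t * cutInv δ (c t)) • resolvent S (c t) =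
      cfc (fun w => ∫ t in (0 : ℝ)..1, φ t w) S := by
    simp only [intervalIntegral.integral_of_le zero_le_one, ← integral_Icc_eq_integral_Ioc]
    rw [cfc_setIntegral measurableSet_Icc φ (fun _ => M) S hφc]
    · refine setIntegral_congr_fun measurableSet_Icc fun t ht => ?_
      change (deriv c t * cutInv δ (c t)) • resolvent S (c t) = cfc (φ t) S
      have hr := resolvent_eq_cfc hS (hcyc.mapsTo 1 t ht).2
      have hcon : ContinuousOn (fun w => (c t - w)⁻¹) (spectrum ℂ S) :=
        (continuousOn_const.sub continuousOn_id).inv₀ (hne t ht)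
      have hmul := cfc_const_mul (deriv c t * (c t)⁻¹) (fun w => (c t - w)⁻¹) S hcon
      rw [hr, hcf]
      exact hmul.symm
    · filter_upwards [ae_restrict_mem measurableSet_Icc] with t ht w hw
      exact hM (t, w) ⟨ht, hw⟩
    · exact (integrable_const M).hasFiniteIntegral
  have h3 : ∀ w ∈ spectrum ℂ S, ∫ t in (0 : ℝ)..1, φ t w = (2 * Real.pi * Complex.I) * w⁻¹ := by
    intro w hw
    rw [← circleIntegral_sub_inv_smul_inv hδ hm (hK w hw), ← integral_circleMap_mul]
    refine intervalIntegral.integral_congr fun t _ => ?_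
    change deriv c t * (c t)⁻¹ * (c t - w)⁻¹ = deriv c t * ((c t - w)⁻¹ • (c t)⁻¹)
    rw [smul_eq_mul]
    ring
  have h4 := cfc_const_mul (2 * Real.pi * Complex.I : ℂ) (fun w => w⁻¹) S
    (continuousOn_inv_of_gap hδ hK)
  rw [cauchyIntegral, Fin.sum_univ_two, h1, zero_add, ← hc, h2, cfc_congr h3, h4,
    inv_smul_smul₀ hpi]

/-- A nonnegative operator with a spectral gap at `0` has a pseudo-inverse in every
algebra with holomorphic functional calculus. -/
theorem exists_pseudoInverse {Ψ : Set (H →L[ℂ] H)} (hΨ : HasHolomorphicCalculus Ψ)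
    {S : H →L[ℂ] H} (hSΨ : S ∈ Ψ) (hS : 0 ≤ S) {δ : ℝ} (hδ : 0 < δ)
    (hgap : ∀ x, δ * (inner ℂ (S x) x).re ≤ ‖S x‖ ^ 2) :
    ∃ E ∈ Ψ, S * (1 - E * S) = 0 := by
  have hK := spectrum_of_gap hS hgap hδ
  have hm : δ ≤ ‖S‖ + δ := by linarith [norm_nonneg S]
  have hSn : IsStarNormal S := hS.isSelfAdjoint.isStarNormal
  have hcyc := isCauchyCycle_twoCircles hδ hm hK
  have hsub : spectrum ℂ S ⊆
      Metric.ball 0 (δ / 3) ∪ Metric.ball ((‖S‖ + δ : ℝ) : ℂ) (‖S‖ + δ - δ / 3) := by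
    intro w hw
    rcases hK w hw with rfl | ⟨r, hr, hr', rfl⟩
    · exact Or.inl (by simp; positivity)
    · refine Or.inr ?_
      rw [Metric.mem_ball, dist_comm, dist_eq_norm, ← Complex.ofReal_sub, Complex.norm_real,
        Real.norm_of_nonneg (by linarith)]
      linarith
  have hE := hΨ S hSΨ _ (cutInv δ) (Metric.isOpen_ball.union Metric.isOpen_ball) hsub
    (differentiableOn_cutInv hδ hm) 2 (twoCircles δ (‖S‖ + δ)) hcyc
  rw [cauchyIntegral_cutInv hSn hδ hm hK] at hE
  refine ⟨_, hE, ?_⟩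
  have hc := continuousOn_inv_of_gap hδ hK
  have h1 : cfc (fun w : ℂ => w⁻¹) S * S = cfc (fun w : ℂ => w⁻¹ * w) S := by
    rw [cfc_mul (fun w : ℂ => w⁻¹) (fun w => w) S hc (by fun_prop), cfc_id' ℂ S]
  have h2 : S * (cfc (fun w : ℂ => w⁻¹) S * S) = S := by
    rw [h1]
    nth_rw 1 [← cfc_id' ℂ S]
    rw [← cfc_mul (fun w : ℂ => w) (fun w => w⁻¹ * w) S (by fun_prop) (hc.mul continuousOn_id)]
    conv_rhs => rw [← cfc_id' ℂ S]
    refine cfc_congr fun w _ => ?_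
    by_cases h0 : w = 0
    · simp [h0]
    · simp [h0]
  rw [mul_sub, mul_one, h2, sub_self]

end Parametrix

/-! ### Fredholm pairs of projections -/

section FredholmPairs

variable {H : Type*} [NormedAddCommGroup H] [InnerProductSpace ℂ H] [CompleteSpace H]

theorem re_inner_proj {P : H →L[ℂ] H} (hP : IsStarProjection P) (x : H) :
    (inner ℂ (P x) x).re = ‖P x‖ ^ 2 := by
  have h : P (P x) = P x := DFunLike.congr_fun hP.isIdempotentElem.eq x
  rw [← h, re_inner_sq hP.isSelfAdjoint.star_eq, h, Complex.ofReal_re]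

theorem norm_proj_add_sq {Q : H →L[ℂ] H} (hQ : IsStarProjection Q) (x y : H) :
    ‖Q x + (1 - Q) y‖ ^ 2 = ‖Q x‖ ^ 2 + ‖(1 - Q) y‖ ^ 2 := by
  have h : inner ℂ (Q x) ((1 - Q) y) = 0 := by
    rw [inner_map_left hQ.isSelfAdjoint.star_eq]
    have : Q ((1 - Q) y) = 0 := by
      change Q (y - Q y) = 0
      rw [map_sub, sub_eq_zero]
      exact (DFunLike.congr_fun hQ.isIdempotentElem.eq y).symm
    rw [this, inner_zero_right]
  have := norm_add_sq_eq_norm_sq_add_norm_sq_of_inner_eq_zero (𝕜 := ℂ) (Q x) ((1 - Q) y) h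
  simpa [pow_two] using this

/-- `Q P Q` on the range of `Q`, continued by the identity. This is `T T* ⊕ 1` for the map
`T = Q : P(H) → Q(H)`. -/
def foldedProj (P Q : H →L[ℂ] H) : H →L[ℂ] H := Q * P * Q + (1 - Q)

variable {P Q : H →L[ℂ] H}

theorem star_foldedProj (hP : IsStarProjection P) (hQ : IsStarProjection Q) :
    star (foldedProj P Q) = foldedProj P Q := by
  rw [foldedProj]
  simp only [star_add, star_sub, star_mul, star_one, hP.isSelfAdjoint.star_eq,
    hQ.isSelfAdjoint.star_eq, mul_assoc]

theorem re_inner_foldedProj (hP : IsStarProjection P) (hQ : IsStarProjection Q) (x : H) :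
    (inner ℂ (foldedProj P Q x) x).re = ‖P (Q x)‖ ^ 2 + ‖(1 - Q) x‖ ^ 2 := by
  change (inner ℂ (Q (P (Q x)) + (1 - Q) x) x).re = _
  rw [inner_add_left, inner_map_left hQ.isSelfAdjoint.star_eq, Complex.add_re, re_inner_proj hP,
    re_inner_proj hQ.one_sub]

theorem norm_foldedProj_sq (hQ : IsStarProjection Q) (x : H) :
    ‖foldedProj P Q x‖ ^ 2 = ‖Q (P (Q x))‖ ^ 2 + ‖(1 - Q) x‖ ^ 2 :=
  norm_proj_add_sq hQ _ _

theorem foldedProj_nonneg (hP : IsStarProjection P) (hQ : IsStarProjection Q) :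
    0 ≤ foldedProj P Q := by
  rw [ContinuousLinearMap.nonneg_iff_isPositive, ContinuousLinearMap.isPositive_def']
  refine ⟨star_foldedProj hP hQ, fun x => ?_⟩
  have h := re_inner_foldedProj hP hQ x
  rw [ContinuousLinearMap.reApplyInnerSelf_apply]
  change 0 ≤ (inner ℂ (foldedProj P Q x) x).re
  rw [h]
  positivity

theorem isClosed_range_proj (hP : IsStarProjection P) : IsClosed (P.range : Set H) := by
  have h : (P.range : Set H) = {x | P x = x} := by
    ext x
    constructor
    · rintro ⟨y, rfl⟩
      exact DFunLike.congr_fun hP.isIdempotentElem.eq y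
    · intro h
      exact ⟨x, h⟩
  rw [h]
  exact isClosed_eq P.continuous continuous_id

/-- For a Fredholm pair, `foldedProj P Q` has a spectral gap at `0`. -/
theorem IsFredholmPair.exists_gap (h : IsFredholmPair P Q) (hP : IsStarProjection P)
    (hQ : IsStarProjection Q) :
    ∃ δ > 0, ∀ x, δ * (inner ℂ (foldedProj P Q x) x).re ≤ ‖foldedProj P Q x‖ ^ 2 := by
  have hPs := hP.isSelfAdjoint.star_eq
  have hQs := hQ.isSelfAdjoint.star_eq
  have : CompleteSpace P.range := (isClosed_range_proj hP).completeSpace_coe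
  have : CompleteSpace Q.range := (isClosed_range_proj hQ).completeSpace_coe
  set T := (Q.comp P.range.subtypeL).codRestrict Q.range (fun _ => LinearMap.mem_range_self _ _)
    with hT
  have hTc : IsClosed (T.range : Set Q.range) := h.isClosed_range
  have : CompleteSpace T.range := hTc.completeSpace_coe
  -- As `T` has closed range, its range has bounded preimages, which gives `‖T* y‖ ≤ c ‖T T* y‖`.
  obtain ⟨c, hc, hpre⟩ := (T.rangeRestrict).exists_preimage_norm_le
    (fun ⟨y, x, hx⟩ => ⟨x, Subtype.ext hx⟩)
  have key : ∀ x, ‖P (Q x)‖ ≤ c * ‖Q (P (Q x))‖ := by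
    intro x
    obtain ⟨z, hz, hzn⟩ := hpre (T.rangeRestrict ⟨P (Q x), ⟨Q x, rfl⟩⟩)
    have hz' : Q z = Q (P (Q x)) := congrArg (fun y : T.range => ((y : Q.range) : H)) hz
    have hPz : P (z : H) = z := by
      obtain ⟨y, hy⟩ := z.2
      rw [← hy]
      exact DFunLike.congr_fun hP.isIdempotentElem.eq y
    have hn : ‖(z : H)‖ ≤ c * ‖Q (P (Q x))‖ := hzn
    have e1 : ‖P (Q x)‖ ^ 2 = (inner ℂ (z : H) (P (Q x))).re := by
      rw [← inner_map_left hPs, hPz, ← inner_map_left hQs, hz', inner_map_left hQs,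
        re_inner_proj hP]
    have e2 : ‖P (Q x)‖ ^ 2 ≤ ‖(z : H)‖ * ‖P (Q x)‖ := by
      rw [e1]
      exact (Complex.re_le_norm _).trans (norm_inner_le_norm _ _)
    rcases (norm_nonneg (P (Q x))).eq_or_lt with h0 | h0
    · rw [← h0]; positivity
    · refine le_trans ?_ hn
      rw [pow_two] at e2
      exact le_of_mul_le_mul_right e2 h0
  refine ⟨(1 + c ^ 2)⁻¹, by positivity, fun x => ?_⟩
  rw [re_inner_foldedProj hP hQ, norm_foldedProj_sq hQ, inv_mul_le_iff₀ (by positivity)]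
  have h1 := pow_le_pow_left₀ (norm_nonneg _) (key x) 2
  rw [mul_pow] at h1
  nlinarith [sq_nonneg ‖Q (P (Q x))‖, sq_nonneg (c * ‖(1 - Q) x‖)]

theorem mem_ker_foldedProj (hP : IsStarProjection P) (hQ : IsStarProjection Q) {x : H}
    (hx : foldedProj P Q x = 0) : P x = 0 ∧ Q x = x := by
  have h := re_inner_foldedProj hP hQ x
  rw [hx, inner_zero_left, Complex.zero_re] at h
  have h1 : ‖(1 - Q) x‖ = 0 := by nlinarith [sq_nonneg ‖P (Q x)‖, sq_nonneg ‖(1 - Q) x‖]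
  have h2 : ‖P (Q x)‖ = 0 := by nlinarith [sq_nonneg ‖P (Q x)‖, sq_nonneg ‖(1 - Q) x‖]
  rw [norm_eq_zero] at h1 h2
  have h3 : Q x = x := (sub_eq_zero.1 h1).symm
  rw [h3] at h2
  exact ⟨h2, h3⟩

theorem IsFredholmPair.finiteDimensional_ker (h : IsFredholmPair P Q) (hP : IsStarProjection P)
    (hQ : IsStarProjection Q) : FiniteDimensional ℂ (foldedProj P Q).ker := by
  set T := (Q.comp P.range.subtypeL).codRestrict Q.range (fun _ => LinearMap.mem_range_self _ _)
    with hT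
  have hfin : Module.Finite ℂ (Q.range ⧸ T.range) := h.finite_coker
  let L : (foldedProj P Q).ker →ₗ[ℂ] Q.range :=
    LinearMap.codRestrict Q.range (foldedProj P Q).ker.subtype
      (fun x => ⟨x, (mem_ker_foldedProj hP hQ x.2).2⟩)
  refine Module.Finite.of_injective (T.range.mkQ.comp L) ?_
  rw [← LinearMap.ker_eq_bot, LinearMap.ker_eq_bot']
  rintro ⟨x, hx⟩ hx0
  obtain ⟨h1, h2⟩ := mem_ker_foldedProj hP hQ hx
  have h3 : L ⟨x, hx⟩ ∈ T.range := (Submodule.Quotient.mk_eq_zero _).1 hx0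
  obtain ⟨⟨_, y, rfl⟩, hy⟩ := h3
  have h4 : Q (P y) = x := congrArg (fun z : Q.range => (z : H)) hy
  have h5 : inner ℂ x x = 0 := by
    nth_rw 1 [← h4]
    rw [inner_map_left hQ.isSelfAdjoint.star_eq, h2, inner_map_left hP.isSelfAdjoint.star_eq, h1,
      inner_zero_right]
  exact Subtype.ext (inner_self_eq_zero.1 h5)

end FredholmPairs

/-! ### Elliptic regularity in the algebra -/

section Regularity

variable {H : Type*} [NormedAddCommGroup H] [InnerProductSpace ℂ H] [CompleteSpace H]
  {A : H →ₗ.[ℂ] H}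

/-- If `T` and `T*` have order zero, then `T` restricts to a bounded operator of `H_{1/2}`. -/
theorem exists_quarterPow_mul_eq (hA : IsSelfAdjoint A) {T : H →L[ℂ] H} (hT : star T ∈ OpZero A) :
    ∃ Y : H →L[ℂ] H, quarterPow A * Y = T * quarterPow A := by
  obtain ⟨X, hX⟩ := exists_mul_quarterPow_eq hA hT
  refine ⟨star X, ?_⟩
  have := congrArg star hX
  rwa [star_mul, star_mul, star_star, star_quarterPow] at this

/-- A continuous linear map that sends a dense set into a finite-dimensional subspace has its
range there. -/
theorem apply_mem_of_dense {X Y : Type*} [NormedAddCommGroup X] [NormedSpace ℂ X]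
    [NormedAddCommGroup Y] [NormedSpace ℂ Y] (T : X →L[ℂ] Y) {D : Set X} (hD : Dense D)
    (W : Submodule ℂ Y) [FiniteDimensional ℂ W] (h : ∀ x ∈ D, T x ∈ W) (x : X) : T x ∈ W := by
  have hc : IsClosed (W : Set Y) := W.closed_of_finiteDimensional
  exact hD.induction (P := fun x => T x ∈ (W : Set Y)) h (hc.preimage T.continuous) x

/-- Elliptic regularity for a nonnegative operator `S` of the algebra `Ψ` that has a spectral gap
at `0` and a finite-dimensional kernel; `X` is the operator induced by `S` on `H_{-1/2}`, a space
that is identified with `H` through `j`. -/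
theorem exists_sq_eq_of_gap (hA : IsSelfAdjoint A) {Ψ : StarSubalgebra ℂ (H →L[ℂ] H)}
    (hΨ_op : (Ψ : Set (H →L[ℂ] H)) ⊆ OpZero A)
    (hΨ_hol : HasHolomorphicCalculus (Ψ : Set (H →L[ℂ] H))) {S : H →L[ℂ] H} (hSΨ : S ∈ Ψ)
    (hS : 0 ≤ S) {δ : ℝ} (hδ : 0 < δ) (hgap : ∀ x, δ * (inner ℂ (S x) x).re ≤ ‖S x‖ ^ 2)
    (hker : FiniteDimensional ℂ S.ker) {X : H →L[ℂ] H}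
    (hX : X * quarterPow A = quarterPow A * S) {y z : H}
    (hy : X y = (quarterPow A * quarterPow A) z) :
    ∃ x, (quarterPow A * quarterPow A) x = y := by
  obtain ⟨E, hE, hES⟩ := exists_pseudoInverse hΨ_hol hSΨ hS hδ hgap
  set j := quarterPow A with hj
  have hjd : DenseRange j :=
    denseRange_of_isSelfAdjoint (star_quarterPow A) (quarterPow_injective hA)
  have hR : 1 - E * S ∈ Ψ := Ψ.sub_mem Ψ.one_mem (Ψ.mul_mem hE hSΨ)
  set R := 1 - E * S with hRdef
  obtain ⟨XE, hXE⟩ := exists_mul_quarterPow_eq hA (hΨ_op hE)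
  obtain ⟨XR, hXR⟩ := exists_mul_quarterPow_eq hA (hΨ_op hR)
  obtain ⟨YE, hYE⟩ := exists_quarterPow_mul_eq hA (hΨ_op (star_mem hE))
  rw [← hj] at hXE hXR hYE
  -- `1 = E S + R` on `H_{-1/2}`, where `R` is smoothing, with values in `ker S`.
  have hdec : XE * X + XR = 1 := by
    refine eq_of_mul_eq_mul_right hjd ?_
    rw [add_mul, mul_assoc, hX, ← mul_assoc, hXE, hXR, mul_assoc, ← mul_add, hRdef,
      add_sub_cancel, mul_one, one_mul]
  have hfin : ∀ x, R x ∈ S.ker ⊓ smoothSpace A := by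
    have : FiniteDimensional ℂ (S.ker ⊓ smoothSpace A : Submodule ℂ H) :=
      Submodule.finiteDimensional_inf_left _ _
    exact apply_mem_of_dense R (dense_smoothSpace hA) _ fun x hx =>
      ⟨DFunLike.congr_fun hES x, apply_mem_smoothSpace (hΨ_op hR) hx⟩
  have hXRmem : XR y ∈ (S.ker ⊓ smoothSpace A).map (j : H →ₗ[ℂ] H) := by
    have : FiniteDimensional ℂ (S.ker ⊓ smoothSpace A : Submodule ℂ H) :=
      Submodule.finiteDimensional_inf_left _ _
    refine apply_mem_of_dense XR hjd _ ?_ y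
    rintro _ ⟨x, rfl⟩
    exact ⟨R x, hfin x, (DFunLike.congr_fun hXR x).symm⟩
  obtain ⟨r, hr, hr'⟩ := hXRmem
  obtain ⟨s, hs⟩ := exists_sq_eq_of_mem_smoothSpace hr.2
  have e1 : XE (X y) = j (j (YE z)) := by
    rw [hy]
    have h1 : XE (j (j z)) = j (E (j z)) := DFunLike.congr_fun hXE (j z)
    have h2 : j (YE z) = E (j z) := DFunLike.congr_fun hYE z
    rw [h2]
    exact h1
  refine ⟨YE z + j s, ?_⟩
  have h3 : XE (X y) + XR y = y := DFunLike.congr_fun hdec y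
  rw [map_add, ← h3, e1, ← hr', ← hs]
  rfl

end Regularity

/-! ### Graphs of self-adjoint operators -/

section Abstract

variable {X : Type*} [NormedAddCommGroup X] [InnerProductSpace ℂ X] [CompleteSpace X]

/-- A vector that is orthogonal, in the sense of the symplectic form of graphs, to everything
that is orthogonal to `G` lies in the closure of `G`. -/
theorem mem_topologicalClosure_of_forall_adjoint {G : Submodule ℂ (X × X)} {p : X × X}
    (h : ∀ u g, (∀ q ∈ G, inner ℂ q.2 u = inner ℂ q.1 g) → inner ℂ p.2 u = inner ℂ p.1 g) :
    p ∈ G.topologicalClosure := by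
  set φ := (WithLp.linearEquiv 2 ℂ (X × X)).symm with hφ
  set W : Submodule ℂ (WithLp 2 (X × X)) := G.map (φ : X × X →ₗ[ℂ] WithLp 2 (X × X)) with hW
  have h1 : φ p ∈ Wᗮᗮ := by
    rw [Submodule.mem_orthogonal']
    intro q hq
    have h2 : ∀ r ∈ G, inner ℂ r.1 q.fst + inner ℂ r.2 q.snd = 0 := by
      intro r hr
      have := (Submodule.mem_orthogonal _ _).1 hq (φ r) ⟨r, hr, rfl⟩
      rwa [WithLp.prod_inner_apply] at this
    have h3 := h q.snd (-q.fst) fun r hr => by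
      rw [inner_neg_right]
      exact eq_neg_of_add_eq_zero_right (h2 r hr)
    rw [WithLp.prod_inner_apply]
    rw [inner_neg_right] at h3
    change inner ℂ p.1 q.fst + inner ℂ p.2 q.snd = 0
    rw [h3, add_neg_cancel]
  rw [Submodule.orthogonal_orthogonal_eq_closure] at h1
  have h4 : φ p ∈ closure (W : Set (WithLp 2 (X × X))) := h1
  have h5 := map_mem_closure (t := (G : Set (X × X))) (WithLp.prod_continuous_ofLp 2 X X) h4 (by
    rintro _ ⟨r, hr, rfl⟩
    exact hr)
  exact h5

variable {D S : X →ₗ.[ℂ] X}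

/-- If `S` is a symmetric extension of `D` that contains the adjoint of `D`, then `D` is
essentially self-adjoint with closure `S`. -/
theorem isEssentiallySelfAdjoint_of_adjoint_le (hDS : D.graph ≤ S.graph)
    (hsymm : ∀ p ∈ S.graph, ∀ q ∈ S.graph, inner ℂ p.2 q.1 = inner ℂ p.1 q.2)
    (hadj : ∀ u g, (∀ p ∈ D.graph, inner ℂ p.2 u = inner ℂ p.1 g) → (u, g) ∈ S.graph) :
    IsEssentiallySelfAdjoint D ∧ D.closure = S := by
  have hdense : Dense (D.domain : Set X) := by
    rw [Submodule.dense_iff_topologicalClosure_eq_top, Submodule.topologicalClosure_eq_top_iff,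
      Submodule.eq_bot_iff]
    intro g hg
    refine S.graph_fst_eq_zero_snd (hadj 0 g fun p hp => ?_) rfl
    rw [inner_zero_right]
    exact ((Submodule.mem_orthogonal _ _).1 hg _ (D.mem_domain_of_mem_graph hp)).symm
  have hSdense : Dense (S.domain : Set X) :=
    hdense.mono (LinearPMap.le_graph_iff.1 hDS).1
  have hiff : ∀ q : X × X, q ∈ S.graph ↔ ∀ p ∈ D.graph, inner ℂ p.2 q.1 = inner ℂ p.1 q.2 :=
    fun q => ⟨fun hq p hp => hsymm p (hDS hp) q hq, hadj q.1 q.2⟩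
  have hSc : S.IsClosed := by
    have : (S.graph : Set (X × X)) = ⋂ p ∈ D.graph, {q | inner ℂ p.2 q.1 = inner ℂ p.1 q.2} := by
      ext q
      simp only [SetLike.mem_coe, hiff, mem_iInter, mem_ofPred_eq]
    rw [LinearPMap.IsClosed, this]
    exact isClosed_biInter fun p _ => isClosed_eq (by fun_prop) (by fun_prop)
  have hDc : D.IsClosable := LinearPMap.isClosable_iff_exists_closed_extension.2
    ⟨S, hSc, LinearPMap.le_graph_iff.1 hDS⟩
  have hcl : D.closure = S := by
    refine LinearPMap.eq_of_eq_graph ?_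
    rw [← hDc.graph_closure_eq_closure_graph]
    refine le_antisymm (Submodule.topologicalClosure_minimal _ hDS hSc) fun p hp => ?_
    refine mem_topologicalClosure_of_forall_adjoint fun u g hug => ?_
    exact hsymm p hp (u, g) (hadj u g hug)
  refine ⟨⟨hDc, ?_⟩, hcl⟩
  rw [hcl, LinearPMap.isSelfAdjoint_def]
  refine LinearPMap.eq_of_eq_graph ?_
  rw [LinearPMap.adjoint_graph_eq_graph_adjoint hSdense]
  ext q
  rw [Submodule.mem_adjoint_iff]
  constructor
  · intro h
    exact hadj q.1 q.2 fun p hp => sub_eq_zero.1 (h p.1 p.2 (hDS hp))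
  · intro h a b hab
    exact sub_eq_zero.2 (hsymm (a, b) hab q h)

/-- A self-adjoint operator is determined by orthogonality to its graph. -/
theorem mem_graph_iff_of_isSelfAdjoint (hS : IsSelfAdjoint S) (q : X × X) :
    q ∈ S.graph ↔ ∀ p ∈ S.graph, inner ℂ p.2 q.1 = inner ℂ p.1 q.2 := by
  conv_lhs => rw [← LinearPMap.isSelfAdjoint_def.1 hS]
  rw [LinearPMap.adjoint_graph_eq_graph_adjoint hS.dense_domain, Submodule.mem_adjoint_iff]
  exact ⟨fun h p hp => sub_eq_zero.1 (h p.1 p.2 hp), fun h a b hab => sub_eq_zero.2 (h _ hab)⟩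

end Abstract

/-! ### Green's formula -/

section Graphs

variable {H : Type*} [NormedAddCommGroup H] [InnerProductSpace ℂ H] [CompleteSpace H]
  {A : H →ₗ.[ℂ] H} {j Λ γ P Q : H →L[ℂ] H}

theorem BoundedTransform.isPointwiseImage_iff (B : BoundedTransform A j Λ) (f h : L2Half H) :
    IsPointwiseImage A f h ↔ ∃ a, lift (j * j) a = f ∧ lift Λ a = h := by
  constructor
  · intro hfh
    have e0 : ∀ x : H, (j * j) ((j * j) x) + Λ (Λ x) = x := fun x => DFunLike.congr_fun B.sq_add_sq x
    refine ⟨lift (j * j) f + lift Λ h, Lp.ext ?_, Lp.ext ?_⟩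
    · filter_upwards [hfh, coeFn_lift (j * j) (lift (j * j) f + lift Λ h),
        Lp.coeFn_add (lift (j * j) f) (lift Λ h), coeFn_lift (j * j) f, coeFn_lift Λ h]
        with x h1 h2 h3 h4 h5
      obtain ⟨y, hy1, hy2⟩ := (B.mem_graph_iff _).1 h1
      simp only at hy1 hy2
      rw [h2, h3, Pi.add_apply, h4, h5, ← hy1, ← hy2, e0]
    · filter_upwards [hfh, coeFn_lift Λ (lift (j * j) f + lift Λ h),
        Lp.coeFn_add (lift (j * j) f) (lift Λ h), coeFn_lift (j * j) f, coeFn_lift Λ h]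
        with x h1 h2 h3 h4 h5
      obtain ⟨y, hy1, hy2⟩ := (B.mem_graph_iff _).1 h1
      simp only at hy1 hy2
      rw [h2, h3, Pi.add_apply, h4, h5, ← hy1, ← hy2, e0]
  · rintro ⟨a, rfl, rfl⟩
    filter_upwards [coeFn_lift (j * j) a, coeFn_lift Λ a] with x h1 h2
    rw [h1, h2]
    exact (B.mem_graph_iff _).2 ⟨a x, rfl, rfl⟩

/-- The graph of `γ (d/dx + A)` on `{f ∈ ℋ₁ | P f(0) = 0}`, in bounded terms. -/
theorem BoundedTransform.mem_sobolevGraph_iff (B : BoundedTransform A j Λ)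
    (p : L2Half H × L2Half H) :
    p ∈ sobolevGraph γ A P ↔ ∃ a g v, lift (j * j) a = p.1 ∧ HasTrace p.1 g v ∧ P v = 0 ∧
      p.2 = lift γ (g + lift Λ a) := by
  constructor
  · rintro ⟨g, h, hg, hh, ⟨v, hv, hPv⟩, hp⟩
    obtain ⟨a, ha, rfl⟩ := (B.isPointwiseImage_iff _ _).1 hh
    obtain ⟨v', hv'⟩ := hg.exists_hasTrace
    obtain rfl : v = v' := hv.unique hv'.hasBoundaryValue
    exact ⟨a, g, v, ha, hv', hPv, hp⟩
  · rintro ⟨a, g, v, ha, hv, hPv, hp⟩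
    exact ⟨g, lift Λ a, hv.hasWeakDeriv, (B.isPointwiseImage_iff _ _).2 ⟨a, ha, rfl⟩,
      ⟨v, hv.hasBoundaryValue, hPv⟩, hp⟩

/-- Green's formula for `γ (d/dx + A)`. -/
theorem ModelData.green (B : ModelData A j Λ γ Q) {a₁ a₂ g₁ g₂ : L2Half H} {v₁ v₂ : H}
    (h₁ : HasTrace (lift (j * j) a₁) g₁ v₁) (h₂ : HasTrace (lift (j * j) a₂) g₂ v₂) :
    inner ℂ (lift γ (g₁ + lift Λ a₁)) (lift (j * j) a₂) -
      inner ℂ (lift (j * j) a₁) (lift γ (g₂ + lift Λ a₂)) = -inner ℂ (γ v₁) v₂ := by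
  have hγ : ∀ f g : L2Half H, inner ℂ f (lift γ g) = -inner ℂ (lift γ f) g := by
    intro f g
    have h := inner_star_right (lift γ) (lift γ f) g
    have e : star (lift γ) = -lift γ := by rw [← lift_star, B.star_γ, lift_neg]
    have e2 : lift γ (lift γ f) = -f := by
      rw [lift_lift, B.γ_mul_γ, lift_neg, lift_one]; rfl
    have h' := inner_star_right (lift γ) f g
    rw [e] at h'
    rw [← h']
    change _ = -inner ℂ f (-(lift γ g))
    rw [inner_neg_right, neg_neg]
  have h3 := (h₁.map γ).inner_add_inner h₂
  have h4 : inner ℂ (lift γ (lift Λ a₁)) (lift (j * j) a₂) +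
      inner ℂ (lift γ (lift (j * j) a₁)) (lift Λ a₂) = 0 := by
    rw [← inner_map_left (lift_star_eq B.star_sq), ← inner_map_left (lift_star_eq B.star_Λ),
      ← inner_add_left]
    have : lift (j * j) (lift γ (lift Λ a₁)) + lift Λ (lift γ (lift (j * j) a₁)) = 0 := by
      simp only [lift_lift]
      rw [← add_apply, ← lift_add]
      have e : j * j * γ * Λ + Λ * γ * (j * j) = 0 := by
        have hc : Commute (j * j) γ := B.commute_γ.mul_left B.commute_γ
        rw [hc.eq, mul_assoc, B.commute_sq.eq, ← mul_assoc, B.anticommute, neg_mul,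
          neg_add_cancel]
      rw [← mul_assoc, ← mul_assoc, e]
      have := lift_smul (0 : ℂ) (0 : H →L[ℂ] H)
      rw [zero_smul, zero_smul] at this
      rw [this]; rfl
    rw [this, inner_zero_left]
  rw [hγ, map_add, inner_add_left, inner_add_right, ← h3]
  linear_combination h4

theorem ModelData.inner_γ_left (B : ModelData A j Λ γ Q) (x y : H) :
    inner ℂ (γ x) y = -inner ℂ x (γ y) := by
  rw [← inner_star_right, B.star_γ]
  change inner ℂ x (-γ y) = _
  rw [inner_neg_right]

/-- `γ* P γ = 1 - P` says that `γ` exchanges `P` and `1 - P`. -/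
theorem ModelData.γ_mul_eq (B : ModelData A j Λ γ Q) (hP : star γ * P * γ = 1 - P) :
    γ * P = (1 - P) * γ := by
  have h := congrArg (γ * ·) hP
  simp only [B.star_γ, neg_mul, mul_neg, ← mul_assoc, B.γ_mul_γ, one_mul, neg_neg] at h
  rw [sub_mul, one_mul, h, mul_sub, mul_one, sub_sub_cancel]

/-- The boundary form vanishes on `ker P`, as `γ` maps `ker P` to the range of `P`. -/
theorem ModelData.symmetric (B : ModelData A j Λ γ Q) (hPp : IsStarProjection P)
    (hP : star γ * P * γ = 1 - P) {p q : L2Half H × L2Half H}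
    (hp : p ∈ sobolevGraph γ A P) (hq : q ∈ sobolevGraph γ A P) :
    inner ℂ p.2 q.1 = inner ℂ p.1 q.2 := by
  obtain ⟨a₁, g₁, v₁, ha₁, h₁, hv₁, hp2⟩ := (B.mem_sobolevGraph_iff _).1 hp
  obtain ⟨a₂, g₂, v₂, ha₂, h₂, hv₂, hq2⟩ := (B.mem_sobolevGraph_iff _).1 hq
  rw [← ha₁] at h₁
  rw [← ha₂] at h₂
  have h := B.green h₁ h₂
  have e1 : γ v₁ = P (γ v₁) := by
    have h3 : γ (P v₁) = γ v₁ - P (γ v₁) := DFunLike.congr_fun (B.γ_mul_eq hP) v₁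
    rw [hv₁, map_zero] at h3
    exact sub_eq_zero.1 h3.symm
  rw [e1, inner_map_left hPp.isSelfAdjoint.star_eq, hv₂, inner_zero_right, neg_zero] at h
  rw [hp2, hq2, ← ha₁, ← ha₂]
  exact sub_eq_zero.1 h

end Graphs

/-! ### Elements of the domain of `D_P` -/

section TestFunctions

variable {H : Type*} [NormedAddCommGroup H] [InnerProductSpace ℂ H] [CompleteSpace H]
  {A : H →ₗ.[ℂ] H} {j Λ γ P Q : H →L[ℂ] H}

theorem IsTestFunction.memLp_derivWithin {F : ℝ → A.graph} (hF : IsTestFunction A F) :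
    MemLp (derivWithin (baseFun F) (Ici 0)) 2 (volume.restrict (Ioi (0 : ℝ))) := by
  obtain ⟨b, hb⟩ := hF.compact_support
  refine memLp_of_continuousOn (b := max b 0 + 1)
    (hF.contDiffOn_baseFun.continuousOn_derivWithin (uniqueDiffOn_Ici 0) (by simp)) ?_
  intro x hx
  have hxb : b < x := by linarith [le_max_left b 0]
  have hx0 : 0 < x := by linarith [le_max_right b 0]
  have he : baseFun F =ᶠ[𝓝 x] fun _ => (0 : H) := by
    filter_upwards [Ioi_mem_nhds hxb] with y hy
    simp [baseFun, hb y (le_of_lt hy)]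
  rw [derivWithin_of_mem_nhds (Ici_mem_nhds hx0), he.deriv_eq]
  simp

theorem modelGraph_le_sobolevGraph : modelGraph γ A P ≤ sobolevGraph γ A P := by
  rintro p ⟨F, hF, hF0, h1, h2⟩
  obtain ⟨b, hb⟩ := hF.compact_support
  have hg := hF.memLp_derivWithin
  have hA : MemLp (fun x => (F x).1.2) 2 (volume.restrict (Ioi (0 : ℝ))) :=
    memLp_of_continuousOn hF.contDiffOn_snd.continuousOn (b := b) (fun x hx => by simp [hb x hx])
  have htr : HasTrace p.1 (hg.toLp _) (baseFun F 0) := by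
    rw [HasTrace]
    filter_upwards [h1, ae_restrict_mem measurableSet_Ioi] with x hx hx0
    have hx0' : (0 : ℝ) ≤ x := le_of_lt hx0
    rw [hx]
    have e : ∫ t in (0 : ℝ)..x, (hg.toLp _ : L2Half H) t =
        ∫ t in (0 : ℝ)..x, derivWithin (baseFun F) (Ici 0) t := by
      rw [intervalIntegral.integral_of_le hx0', intervalIntegral.integral_of_le hx0']
      exact integral_congr_ae (ae_restrict_of_ae_restrict_of_subset
        Ioc_subset_Ioi_self hg.coeFn_toLp)
    rw [e, intervalIntegral.integral_eq_sub_of_hasDerivAt_of_le hx0'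
      (hF.contDiffOn_baseFun.continuousOn.mono Icc_subset_Ici_self), add_sub_cancel]
    · intro t ht
      have := (hF.differentiableWithinAt (le_of_lt ht.1 : (0 : ℝ) ≤ t)).hasDerivWithinAt
      exact this.hasDerivAt (Ici_mem_nhds ht.1)
    · have hc := hF.contDiffOn_baseFun.continuousOn_derivWithin (uniqueDiffOn_Ici 0) (by simp)
      refine (hc.mono ?_).intervalIntegrable
      rw [uIcc_of_le hx0']
      exact Icc_subset_Ici_self
  refine ⟨hg.toLp _, hA.toLp _, htr.hasWeakDeriv, ?_, ⟨_, htr.hasBoundaryValue, hF0⟩, Lp.ext ?_⟩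
  · filter_upwards [h1, hA.coeFn_toLp] with x e1 e2
    rw [e1, e2]
    exact (F x).2
  · have := coeFn_lift γ (hg.toLp _ + hA.toLp _)
    filter_upwards [h2, hg.coeFn_toLp, hA.coeFn_toLp, this, Lp.coeFn_add (hg.toLp _) (hA.toLp _)]
      with x e1 e2 e3 e4 e5
    change _ = lift γ (hg.toLp _ + hA.toLp _) x
    rw [e1, e4, e5, Pi.add_apply, e2, e3]
    rfl

/-- The functions `φ(x) J y` with `φ` smooth of compact support belong to the graph of `D_P`, if
`φ(0) P J y = 0`. -/
theorem BoundedTransform.exists_mem_modelGraph (B : BoundedTransform A j Λ) {φ : ℝ → ℝ}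
    (h1 : ContDiff ℝ ∞ φ) (h2 : HasCompactSupport φ) {y : H}
    (hy : φ 0 • P ((j * j) y) = 0) :
    ∃ p ∈ modelGraph γ A P, (p.1 =ᵐ[volume.restrict (Ioi (0 : ℝ))] fun x => φ x • (j * j) y) ∧
      p.2 =ᵐ[volume.restrict (Ioi (0 : ℝ))]
        fun x => γ (deriv φ x • (j * j) y + φ x • Λ y) := by
  have hmem : ((j * j) y, Λ y) ∈ A.graph := (B.mem_graph_iff _).2 ⟨y, rfl, rfl⟩
  set F : ℝ → A.graph := fun x => φ x • ⟨_, hmem⟩ with hF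
  obtain ⟨b, hb⟩ : ∃ b : ℝ, ∀ x, b ≤ x → φ x = 0 := by
    obtain ⟨R, hR⟩ := h2.isCompact.isBounded.subset_closedBall 0
    refine ⟨R + 1, fun x hx => image_eq_zero_of_notMem_tsupport fun h' => ?_⟩
    have := hR h'
    rw [Metric.mem_closedBall, dist_zero_right, Real.norm_eq_abs] at this
    linarith [le_abs_self x]
  have hFt : IsTestFunction A F :=
    ⟨(h1.smul contDiff_const).contDiffOn, b, fun x hx => by simp [hF, hb x hx]⟩
  have hbase : baseFun F = fun x => φ x • (j * j) y := rfl
  have hd : ∀ x, HasDerivAt (baseFun F) (deriv φ x • (j * j) y) x := fun x =>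
    ((h1.differentiable (by simp)) x).hasDerivAt.smul_const _
  have hdirac : diracFun γ F =ᵐ[volume.restrict (Ioi (0 : ℝ))]
      fun x => γ (deriv φ x • (j * j) y + φ x • Λ y) := by
    filter_upwards [ae_restrict_mem measurableSet_Ioi] with x hx
    have hx0 : (0 : ℝ) < x := hx
    rw [diracFun, derivWithin_of_mem_nhds (Ici_mem_nhds hx0), (hd x).deriv]
    rfl
  have hm1 : MemLp (baseFun F) 2 (volume.restrict (Ioi (0 : ℝ))) :=
    memLp_of_continuousOn hFt.contDiffOn_baseFun.continuousOn (b := b)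
      (fun x hx => by simp [hbase, hb x hx])
  have hm2 : MemLp (diracFun γ F) 2 (volume.restrict (Ioi (0 : ℝ))) := by
    have hA : MemLp (fun x => (F x).1.2) 2 (volume.restrict (Ioi (0 : ℝ))) :=
      memLp_of_continuousOn hFt.contDiffOn_snd.continuousOn (b := b)
        (fun x hx => by simp [hF, hb x hx])
    exact γ.comp_memLp' (hFt.memLp_derivWithin.add hA)
  refine ⟨(hm1.toLp _, hm2.toLp _), ⟨F, hFt, ?_, hm1.coeFn_toLp, hm2.coeFn_toLp⟩,
    hm1.coeFn_toLp, hm2.coeFn_toLp.trans hdirac⟩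
  rw [hbase]
  simp only
  rw [ContinuousLinearMap.map_smul_of_tower]
  exact hy

end TestFunctions

/-! ### Boundary values of elements of the adjoint -/

section AdjointBoundary

variable {H : Type*} [NormedAddCommGroup H] [InnerProductSpace ℂ H] [CompleteSpace H]
  {A : H →ₗ.[ℂ] H} {j Λ γ P Q : H →L[ℂ] H}

/-- The adjoint relation `⟪D_P f, u⟫ = ⟪f, g⟫`, tested on `f = φ(x) J y`. -/
theorem ModelData.inner_integral_eq_zero (B : ModelData A j Λ γ Q) {u g : L2Half H}
    (hug : ∀ p ∈ modelGraph γ A P, inner ℂ p.2 u = inner ℂ p.1 g) {φ : ℝ → ℝ}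
    (h1 : ContDiff ℝ ∞ φ) (h2 : HasCompactSupport φ) {y : H} (hy : φ 0 • P ((j * j) y) = 0) :
    inner ℂ y (γ (∫ x in Ioi (0 : ℝ), (deriv φ x • lift (j * j) u x +
      φ x • (lift (j * j) (-lift γ g) - lift Λ u : L2Half H) x))) = 0 := by
  obtain ⟨p, hp, hp1, hp2⟩ := B.exists_mem_modelGraph (γ := γ) (P := P) h1 h2 hy
  have hpu := hug p hp
  have hint : Integrable (fun x => deriv φ x • lift (j * j) u x +
      φ x • (lift (j * j) (-lift γ g) - lift Λ u : L2Half H) x)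
      (volume.restrict (Ioi (0 : ℝ))) :=
    (integrable_smul_of_test (h1.continuous_deriv (by simp)) h2.deriv _).add
      (integrable_smul_of_test h1.continuous h2 _)
  have e1 : inner ℂ y (γ (∫ x in Ioi (0 : ℝ), (deriv φ x • lift (j * j) u x +
      φ x • (lift (j * j) (-lift γ g) - lift Λ u : L2Half H) x))) =
      ∫ x in Ioi (0 : ℝ), inner ℂ y (γ (deriv φ x • lift (j * j) u x +
      φ x • (lift (j * j) (-lift γ g) - lift Λ u : L2Half H) x)) :=
    ((innerSL ℂ y).comp γ).integral_comp_comm hint |>.symm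
  have e2 : inner ℂ p.1 g - inner ℂ p.2 u = ∫ x in Ioi (0 : ℝ),
      (inner ℂ (p.1 x) (g x) - inner ℂ (p.2 x) (u x)) := by
    rw [L2.inner_def, L2.inner_def, integral_sub (L2.integrable_inner _ _)
      (L2.integrable_inner _ _)]
  rw [hpu, sub_self] at e2
  rw [e1, e2]
  refine integral_congr_ae ?_
  filter_upwards [hp1, hp2, coeFn_lift (j * j) u, coeFn_lift (j * j) (-lift γ g), coeFn_lift Λ u,
    coeFn_lift γ g, Lp.coeFn_sub (lift (j * j) (-lift γ g)) (lift Λ u), Lp.coeFn_neg (lift γ g)]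
    with x e3 e4 e5 e6 e7 e8 e9 e10
  have hJ := B.star_sq
  have hc : (j * j) (γ (g x)) = γ ((j * j) (g x)) :=
    DFunLike.congr_fun (B.commute_γ.mul_left B.commute_γ).eq (g x)
  have hc' : γ ((j * j) (u x)) = (j * j) (γ (u x)) :=
    (DFunLike.congr_fun (B.commute_γ.mul_left B.commute_γ).eq (u x)).symm
  have hγγ : γ (γ ((j * j) (g x))) = -(j * j) (g x) :=
    DFunLike.congr_fun B.γ_mul_γ ((j * j) (g x))
  have hγΛ : γ (Λ (u x)) = -Λ (γ (u x)) := DFunLike.congr_fun B.anticommute (u x)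
  rw [e3, e4, e9, Pi.sub_apply, e5, e6, e7, e10, Pi.neg_apply, e8, B.inner_γ_left]
  simp only [map_add, map_sub, map_neg, ContinuousLinearMap.map_smul_of_tower, hc, hc', hγγ, hγΛ]
  simp only [inner_add_left, inner_add_right, inner_sub_right, inner_neg_right,
    smul_sub, smul_neg, ← Complex.coe_smul, inner_smul_left, inner_smul_right, Complex.conj_ofReal,
    inner_map_left hJ, inner_map_left B.star_Λ]
  ring

/-- An element of the graph of the adjoint of `D_P` is a maximal solution, whose generalized
boundary value `w` satisfies a weak form of the boundary condition. -/
theorem ModelData.exists_maxSolution (B : ModelData A j Λ γ Q) {u g : L2Half H}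
    (hug : ∀ p ∈ modelGraph γ A P, inner ℂ p.2 u = inner ℂ p.1 g) :
    ∃ w, MaxSolution j Λ u (-lift γ g) w ∧ ∀ y, P ((j * j) y) = 0 → inner ℂ y (γ w) = 0 := by
  have hγ0 : ∀ x, γ x = 0 → x = 0 := by
    intro x hx
    have : γ (γ x) = -x := DFunLike.congr_fun B.γ_mul_γ x
    rw [hx, map_zero] at this
    exact neg_eq_zero.1 this.symm
  have hw : HasWeakDeriv (lift (j * j) u) (lift (j * j) (-lift γ g) - lift Λ u) := by
    intro φ h1 h2 h3
    have h0 : φ 0 = 0 := image_eq_zero_of_notMem_tsupport fun h' => lt_irrefl (0 : ℝ) (h3 h')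
    have h4 := hγ0 _ (ext_inner_left ℂ fun y => by
      rw [B.inner_integral_eq_zero hug h1 h2 (y := y) (by rw [h0, zero_smul]), inner_zero_right])
    rw [integral_add (integrable_smul_of_test (h1.continuous_deriv (by simp)) h2.deriv _)
      (integrable_smul_of_test h1.continuous h2 _)] at h4
    exact eq_neg_of_add_eq_zero_left h4
  obtain ⟨w, hw⟩ := hw.exists_hasTrace
  refine ⟨w, hw, fun y hy => ?_⟩
  let β : ContDiffBump (0 : ℝ) := ⟨1, 2, by norm_num, by norm_num⟩
  have hβ : β 0 = 1 := β.one_of_mem_closedBall (by simp [β])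
  have h4 := B.inner_integral_eq_zero hug β.contDiff β.hasCompactSupport (y := y)
    (by rw [hy, smul_zero])
  rw [hw.integral_test β.contDiff β.hasCompactSupport, hβ, one_smul, map_neg, inner_neg_right,
    neg_eq_zero] at h4
  exact h4

theorem quarterPow_mem_smoothSpace {x : H} (hx : x ∈ smoothSpace A) :
    quarterPow A x ∈ smoothSpace A := by
  simp only [smoothSpace, Submodule.mem_iInf] at hx ⊢
  intro s hs
  obtain ⟨y, rfl⟩ := hx s hs
  have hc : Commute (quarterPow A) (invJapanesePow A s) :=
    Commute.quarterPow ((Commute.refl (invJapaneseSq A)).cfc_nnreal _).symm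
  exact ⟨quarterPow A y, (DFunLike.congr_fun hc.eq y).symm⟩

/-- The weak boundary condition is `P v = 0`, for the operator `X` induced by `P` on `H_{-1/2}`. -/
theorem ModelData.flat_apply_eq_zero (hA : IsSelfAdjoint A)
    (B : ModelData A (quarterPow A) Λ γ Q) (hPp : IsStarProjection P)
    (hP : star γ * P * γ = 1 - P) (hP0 : P ∈ OpZero A) {X : H →L[ℂ] H}
    (hX : X * quarterPow A = quarterPow A * P) {v : H}
    (hv : ∀ y, P ((quarterPow A * quarterPow A) y) = 0 → inner ℂ y (γ (quarterPow A v)) = 0) :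
    X v = 0 := by
  set j := quarterPow A with hj
  have hPs := hPp.isSelfAdjoint.star_eq
  have hX' : j * star X = P * j := by
    have := congrArg star hX
    rwa [star_mul, star_mul, B.star_j, hPs] at this
  have hPP : ∀ x, P (P x) = P x := fun x => DFunLike.congr_fun hPp.isIdempotentElem.eq x
  have h1 : (1 - X) (γ v) = 0 := by
    refine (dense_smoothSpace hA).eq_zero_of_inner_right ℂ fun y hy => ?_
    have h2 : j y - P (j y) ∈ smoothSpace A :=
      Submodule.sub_mem _ (quarterPow_mem_smoothSpace hy)
        (apply_mem_smoothSpace hP0 (quarterPow_mem_smoothSpace hy))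
    obtain ⟨z, hz⟩ := exists_sq_eq_of_mem_smoothSpace h2
    have h3 : P ((j * j) z) = 0 := by
      rw [hz, map_sub, hPP, sub_self]
    have h4 : j z = y - star X y := by
      apply B.injective_j
      rw [map_sub]
      have : j (star X y) = P (j y) := DFunLike.congr_fun hX' y
      rw [this]
      exact hz
    have h5 := hv z h3
    have h6 : γ (j v) = j (γ v) := (DFunLike.congr_fun B.commute_γ.eq v).symm
    rw [h6, ← inner_map_left B.star_j, h4, inner_sub_left, inner_star_left] at h5
    change inner ℂ y (γ v - X (γ v)) = 0
    rw [inner_sub_right]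
    exact h5
  have h7 : γ * X = (1 - X) * γ := by
    refine eq_of_mul_eq_mul_right B.denseRange ?_
    rw [mul_assoc, hX, ← mul_assoc, ← B.commute_γ.eq, mul_assoc, B.γ_mul_eq hP, mul_assoc,
      ← B.commute_γ.eq, sub_mul, sub_mul, mul_sub, one_mul, one_mul, ← mul_assoc, ← mul_assoc, hX,
      mul_assoc]
  have h8 : γ (X v) = 0 := (DFunLike.congr_fun h7 v).trans h1
  have h9 : γ (γ (X v)) = -X v := DFunLike.congr_fun B.γ_mul_γ (X v)
  rw [h8, map_zero] at h9
  exact neg_eq_zero.1 h9.symm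

theorem MaxSolution.map {u h : L2Half H} {w : H} (hu : MaxSolution j Λ u h w) {K : H →L[ℂ] H}
    (hj : Commute j K) (hΛ : Commute Λ K) : MaxSolution j Λ (lift K u) (lift K h) (K w) := by
  have h1 := HasTrace.map hu K
  rw [map_sub, lift_lift, lift_lift, lift_lift] at h1
  rw [MaxSolution, lift_lift, lift_lift, lift_lift, (hj.mul_left hj).eq, hΛ.eq]
  exact h1

theorem BoundedTransform.norm_le (B : BoundedTransform A j Λ) (x : H) : ‖Λ x‖ ≤ ‖x‖ := by
  have := B.norm_sq_add_norm_sq x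
  exact le_of_sq_le_sq (by nlinarith [sq_nonneg ‖(j * j) x‖]) (norm_nonneg _)

/-- A maximal solution whose generalized boundary value is in `H_{1/2}` lies in `L²(ℝ₊, H₁)`. -/
theorem MaxSolution.exists_lift_eq_of_mem (B : BoundedTransform A j Λ) {u h : L2Half H} {x : H}
    (hu : MaxSolution j Λ u h (j ((j * j) x))) : ∃ f, lift (j * j) f = u := by
  refine hu.exists_lift_eq B (M := ‖x‖ ^ 2) fun ε hε => ?_
  set e := (regularizer (j * j) ε * (j * j)) ((j * j) x) with he
  have h1 : ‖e‖ ≤ ‖x‖ := norm_regularizer_mul_sq_le B.star_sq hε x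
  calc (inner ℂ (Λ e) e).re ≤ ‖Λ e‖ * ‖e‖ := (Complex.re_le_norm _).trans (norm_inner_le_norm _ _)
    _ ≤ ‖x‖ * ‖x‖ := mul_le_mul ((B.norm_le e).trans h1) h1 (norm_nonneg _) (norm_nonneg _)
    _ = ‖x‖ ^ 2 := by ring

/-- The negative part of a maximal solution lies in `L²(ℝ₊, H₁)`, and its boundary value
is in `H_{1/2}`. -/
theorem ModelData.exists_sq_eq_of_nonpos (B : ModelData A j Λ γ Q) {u h : L2Half H} {v : H}
    (hu : MaxSolution j Λ u h (j v)) : ∃ x, (j * j) x = (1 - Q) v := by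
  have hj : Commute j (1 - Q) := (Commute.one_right j).sub_right B.commute_proj
  have hΛ : Commute Λ (1 - Q) := (Commute.one_right Λ).sub_right B.commute_proj_Λ
  have h1 := hu.map hj hΛ
  have e1 : (1 - Q) (j v) = j ((1 - Q) v) := (DFunLike.congr_fun hj.eq v).symm
  rw [e1] at h1
  obtain ⟨f, hf⟩ := h1.exists_lift_eq B.toBoundedTransform (M := 0) fun ε hε => by
    set K := regularizer (j * j) ε * (j * j) with hK
    have hKQ : Commute K (1 - Q) :=
      (commute_regularizer (hj.mul_left hj)).mul_left (hj.mul_left hj)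
    have h2 : K ((1 - Q) v) = (1 - Q) (K ((1 - Q) v)) := by
      have h3 : K ((1 - Q) v) = (1 - Q) (K v) := DFunLike.congr_fun hKQ.eq v
      rw [h3]
      exact (DFunLike.congr_fun B.proj.one_sub.isIdempotentElem.eq (K v)).symm
    have h4 := B.nonpos (K ((1 - Q) v))
    rwa [← h2] at h4
  rw [← hf] at h1
  obtain ⟨x, -, hx⟩ := h1.hasTrace_of_lift B.toBoundedTransform
  exact ⟨x, B.injective_j hx⟩

end AdjointBoundary

/-! ### The adjoint of `D_P` -/

section SufficientCondition

variable {H : Type*} [NormedAddCommGroup H] [InnerProductSpace ℂ H] [CompleteSpace H]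
  {A : H →ₗ.[ℂ] H} {Λ γ P Q : H →L[ℂ] H}

/-- The adjoint of `D_P` is contained in the operator on `{f ∈ ℋ₁ | P f(0) = 0}`. -/
theorem ModelData.mem_sobolevGraph_of_adjoint (hA : IsSelfAdjoint A)
    (B : ModelData A (quarterPow A) Λ γ Q) {Ψ : StarSubalgebra ℂ (H →L[ℂ] H)}
    (hΨ_op : (Ψ : Set (H →L[ℂ] H)) ⊆ OpZero A)
    (hΨ_hol : HasHolomorphicCalculus (Ψ : Set (H →L[ℂ] H))) (hQΨ : Q ∈ Ψ) (hPΨ : P ∈ Ψ)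
    (hPp : IsStarProjection P) (hP : star γ * P * γ = 1 - P) (hF : IsFredholmPair P Q)
    {u g : L2Half H} (hug : ∀ p ∈ modelGraph γ A P, inner ℂ p.2 u = inner ℂ p.1 g) :
    (u, g) ∈ sobolevGraph γ A P := by
  obtain ⟨w, hu, hw⟩ := B.exists_maxSolution hug
  obtain ⟨v, rfl⟩ := HasTrace.exists_quarterPow_eq B.toBoundedTransform hu
  obtain ⟨X, hX⟩ := exists_mul_quarterPow_eq hA (hΨ_op hPΨ)
  obtain ⟨Y, hY⟩ := exists_quarterPow_mul_eq hA (T := P) (hΨ_op (star_mem hPΨ))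
  set j := quarterPow A with hj
  have hXv : X v = 0 := B.flat_apply_eq_zero hA hPp hP (hΨ_op hPΨ) hX hw
  obtain ⟨x₁, hx₁⟩ := B.exists_sq_eq_of_nonpos hu
  -- `S v₊ = Q P v₊ = - Q P v₋` for `v = v₊ + v₋`, and `v₋` is in `H_{1/2}` already.
  have hS : (Q * X * Q + (1 - Q)) * j = j * foldedProj P Q := by
    rw [foldedProj, add_mul, mul_add]
    congr 1
    · rw [mul_assoc, ← B.commute_proj.eq, ← mul_assoc, mul_assoc Q, hX, ← mul_assoc,
        ← B.commute_proj.eq]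
      simp only [mul_assoc]
    · rw [sub_mul, mul_sub, one_mul, mul_one, B.commute_proj.eq]
  have hQQ : ∀ x, Q (Q x) = Q x := fun x => DFunLike.congr_fun B.proj.isIdempotentElem.eq x
  have hx₁' : v - Q v = (j * j) x₁ := hx₁.symm
  have hSv : (Q * X * Q + (1 - Q)) (Q v) = (j * j) (-(Q (Y x₁))) := by
    change Q (X (Q (Q v))) + (Q v - Q (Q v)) = _
    rw [hQQ, sub_self, add_zero]
    have h1 : X (Q v) = -X ((j * j) x₁) := by
      rw [← hx₁', map_sub, hXv, zero_sub, neg_neg]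
    have h2 : X ((j * j) x₁) = j (P (j x₁)) := DFunLike.congr_fun hX (j x₁)
    have h3 : j (Y x₁) = P (j x₁) := DFunLike.congr_fun hY x₁
    have h4 : (j * j) (Q (Y x₁)) = Q ((j * j) (Y x₁)) :=
      DFunLike.congr_fun (B.commute_proj.mul_left B.commute_proj).eq (Y x₁)
    rw [h1, h2, ← h3, map_neg, map_neg, h4]
    rfl
  have hSΨ : foldedProj P Q ∈ Ψ := Ψ.add_mem (Ψ.mul_mem (Ψ.mul_mem hQΨ hPΨ) hQΨ)
    (Ψ.sub_mem Ψ.one_mem hQΨ)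
  obtain ⟨δ, hδ, hgap⟩ := hF.exists_gap hPp B.proj
  obtain ⟨x₂, hx₂⟩ := exists_sq_eq_of_gap hA hΨ_op hΨ_hol hSΨ (foldedProj_nonneg hPp B.proj) hδ
    hgap (hF.finiteDimensional_ker hPp B.proj) hS hSv
  have hv : v = (j * j) (x₁ + x₂) := by
    rw [map_add, hx₂, ← hx₁', sub_add_cancel]
  rw [hv] at hu
  obtain ⟨f, rfl⟩ := hu.exists_lift_eq_of_mem B.toBoundedTransform
  obtain ⟨x, htr, hx⟩ := hu.hasTrace_of_lift B.toBoundedTransform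
  refine (B.mem_sobolevGraph_iff _).2 ⟨f, _, j x, rfl, htr, ?_, ?_⟩
  · have h5 : (j * j) x = v := by rw [hv]; exact B.injective_j hx
    have h6 : X (j (j x)) = j (P (j x)) := DFunLike.congr_fun hX (j x)
    have h7 : j (j x) = v := h5
    rw [h7, hXv] at h6
    exact B.injective_j (by rw [← h6, map_zero])
  · rw [sub_add_cancel, map_neg, lift_lift, B.γ_mul_γ, lift_neg, lift_one]
    exact (neg_neg g).symm

end SufficientCondition

/-! ### The Lagrangian condition on `P` -/

section NecessarySymmetry

variable {H : Type*} [NormedAddCommGroup H] [InnerProductSpace ℂ H] [CompleteSpace H]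
  {A : H →ₗ.[ℂ] H} {j Λ γ P Q : H →L[ℂ] H}

/-- Every element of `H_1` is a boundary value. -/
theorem BoundedTransform.exists_hasTrace (B : BoundedTransform A j Λ) (y : H) :
    ∃ a g, HasTrace (lift (j * j) a) g ((j * j) y) := by
  let β : ContDiffBump (0 : ℝ) := ⟨1, 2, by norm_num, by norm_num⟩
  have hβ : β 0 = 1 := β.one_of_mem_closedBall (by simp [β])
  obtain ⟨p, hp, hp1, -⟩ := B.exists_mem_modelGraph (γ := 0) (P := 0) β.contDiff
    β.hasCompactSupport (y := y) (by simp)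
  obtain ⟨a, g, v, ha, hv, -, -⟩ := (B.mem_sobolevGraph_iff p).1 (modelGraph_le_sobolevGraph hp)
  have hb : HasBoundaryValue p.1 ((j * j) y) :=
    ⟨_, (β.continuous.smul continuous_const).continuousOn, hp1, by
      change β 0 • (j * j) y = _
      rw [hβ, one_smul]⟩
  obtain rfl := hv.hasBoundaryValue.unique hb
  exact ⟨a, g, by rw [ha]; exact hv⟩

/-- If the operator on `{f ∈ ℋ₁ | P f(0) = 0}` is self-adjoint, then `ker P` is a Lagrangian
subspace for the symplectic form `⟪γ v, w⟫`. -/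
theorem ModelData.star_mul_mul_eq (hA : IsSelfAdjoint A)
    (B : ModelData A (quarterPow A) Λ γ Q) (hPp : IsStarProjection P) (hP0 : P ∈ OpZero A)
    (hG : ∀ q, q ∈ sobolevGraph γ A P ↔
      ∀ p ∈ sobolevGraph γ A P, inner ℂ p.2 q.1 = inner ℂ p.1 q.2) :
    star γ * P * γ = 1 - P := by
  have hB := B.toBoundedTransform
  have hPs := hPp.isSelfAdjoint.star_eq
  have hPP : ∀ x, P (P x) = P x := fun x => DFunLike.congr_fun hPp.isIdempotentElem.eq x
  have hd := dense_smoothSpace hA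
  -- `ker P` is isotropic, as the operator is symmetric,
  have h1 : (1 - P) * γ * (1 - P) = 0 := by
    have h2 : ∀ z ∈ smoothSpace A, ((1 - P) * γ * (1 - P)) z = 0 := by
      intro z hz
      refine hd.eq_zero_of_inner_left ℂ fun z' hz' => ?_
      obtain ⟨y, hy⟩ := exists_sq_eq_of_mem_smoothSpace
        (Submodule.sub_mem _ hz (apply_mem_smoothSpace hP0 hz))
      obtain ⟨y', hy'⟩ := exists_sq_eq_of_mem_smoothSpace
        (Submodule.sub_mem _ hz' (apply_mem_smoothSpace hP0 hz'))
      obtain ⟨a, g, h⟩ := hB.exists_hasTrace y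
      obtain ⟨a', g', h'⟩ := hB.exists_hasTrace y'
      have hp := (hB.mem_sobolevGraph_iff (γ := γ) (P := P) (_, _)).2 ⟨a, g, _, rfl, h, by
        rw [hy, map_sub, hPP, sub_self], rfl⟩
      have hp' := (hB.mem_sobolevGraph_iff (γ := γ) (P := P) (_, _)).2 ⟨a', g', _, rfl, h', by
        rw [hy', map_sub, hPP, sub_self], rfl⟩
      have h3 := (hG _).1 hp' _ hp
      have h4 := B.green h h'
      simp only at h3
      rw [h3, sub_self, hy, hy'] at h4
      have h5 := neg_eq_zero.1 h4.symm
      rw [inner_sub_right, ← inner_map_left hPs, ← inner_sub_left] at h5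
      exact h5
    ext z
    exact congrFun (Continuous.ext_on hd (ContinuousLinearMap.continuous _) continuous_const h2) z
  -- and maximal, as the operator contains its adjoint.
  have h6 : P * γ * P = 0 := by
    have h2 : ∀ z ∈ smoothSpace A, (P * γ * P) z = 0 := by
      intro z hz
      obtain ⟨y, hy⟩ := exists_sq_eq_of_mem_smoothSpace (apply_mem_smoothSpace hP0 hz)
      have hc : (quarterPow A * quarterPow A) (γ y) = γ ((quarterPow A * quarterPow A) y) :=
        DFunLike.congr_fun (B.commute_γ.mul_left B.commute_γ).eq y
      obtain ⟨a, g, h⟩ := hB.exists_hasTrace (γ y)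
      rw [hc, hy] at h
      have hq : (lift (quarterPow A * quarterPow A) a, lift γ (g + lift Λ a)) ∈
          sobolevGraph γ A P := by
        rw [hG]
        intro p hp
        obtain ⟨a', g', v', ha', h', hv', hp2⟩ := (hB.mem_sobolevGraph_iff p).1 hp
        rw [← ha'] at h'
        have h3 := B.green h' h
        have h4 : inner ℂ (γ v') (γ (P z)) = 0 := by
          have e : γ (γ (P z)) = -P z := DFunLike.congr_fun B.γ_mul_γ (P z)
          rw [B.inner_γ_left, e, inner_neg_right, neg_neg, ← inner_map_left hPs, hv',
            inner_zero_left]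
        rw [h4, neg_zero, sub_eq_zero] at h3
        rw [← ha', hp2]
        exact h3
      obtain ⟨a', g', v', ha', h', hv', -⟩ := (hB.mem_sobolevGraph_iff _).1 hq
      change P (γ (P z)) = 0
      rw [h.hasBoundaryValue.unique h'.hasBoundaryValue, hv']
    ext z
    exact congrFun (Continuous.ext_on hd (ContinuousLinearMap.continuous _) continuous_const h2) z
  have h7 : γ * P = (1 - P) * γ := by
    have e1 : (1 - P) * γ * P = γ * P := by
      rw [sub_mul, sub_mul, h6, sub_zero, one_mul]
    rw [mul_sub, mul_one, sub_eq_zero, e1] at h1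
    exact h1.symm
  rw [B.star_γ, neg_mul, neg_mul, h7, mul_assoc, B.γ_mul_γ, mul_neg, mul_one, neg_neg]

end NecessarySymmetry

/-! ### Decaying solutions, and Green's formula for maximal solutions -/

section Decay

variable {H : Type*} [NormedAddCommGroup H] [InnerProductSpace ℂ H] [CompleteSpace H]
  {A : H →ₗ.[ℂ] H} {j Λ γ P Q : H →L[ℂ] H}

theorem exists_hasTrace_smul {φ : ℝ → ℝ} (h1 : ContDiff ℝ ∞ φ) (h2 : HasCompactSupport φ)
    (y : H) : ∃ f g : L2Half H, (f =ᵐ[volume.restrict (Ioi (0 : ℝ))] fun x => φ x • y) ∧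
      (g =ᵐ[volume.restrict (Ioi (0 : ℝ))] fun x => deriv φ x • y) ∧ HasTrace f g (φ 0 • y) := by
  have hL : ∀ ψ : ℝ → ℝ, Continuous ψ → HasCompactSupport ψ →
      MemLp (fun x => ψ x • y) 2 (volume.restrict (Ioi (0 : ℝ))) := fun ψ hψ hψ' =>
    ((hψ.smul continuous_const).memLp_of_hasCompactSupport hψ'.smul_right).restrict _
  have hd : Continuous (deriv φ) := h1.continuous_deriv (by simp)
  have hf := hL φ h1.continuous h2
  have hg := hL _ hd h2.deriv
  refine ⟨hf.toLp _, hg.toLp _, hf.coeFn_toLp, hg.coeFn_toLp, ?_⟩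
  rw [HasTrace]
  filter_upwards [hf.coeFn_toLp, ae_restrict_mem measurableSet_Ioi] with x hx hx0
  have hx0' : (0 : ℝ) ≤ x := le_of_lt hx0
  have e : ∫ t in (0 : ℝ)..x, (hg.toLp _ : L2Half H) t = ∫ t in (0 : ℝ)..x, deriv φ t • y := by
    rw [intervalIntegral.integral_of_le hx0', intervalIntegral.integral_of_le hx0']
    exact integral_congr_ae (ae_restrict_of_ae_restrict_of_subset
      Ioc_subset_Ioi_self hg.coeFn_toLp)
  rw [hx, e, intervalIntegral.integral_smul_const, intervalIntegral.integral_deriv_eq_sub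
    (fun t _ => h1.differentiable (by simp) t) (hd.intervalIntegrable _ _), ← add_smul,
    add_sub_cancel]

/-- The half-line problem `(j² u)' = - u`, `(j² u)(0) = j y` has a solution in `L²`: it is
`j² u = exp (- x j⁻²) j y`. -/
theorem exists_hasTrace_neg (hj : star j = j) (y : H) :
    ∃ u : L2Half H, HasTrace (lift (j * j) u) (-u) (j y) := by
  have hJ : star (j * j) = j * j := by rw [star_mul, hj]
  let X : Submodule ℂ (L2Half H × L2Half H × H) :=
    { carrier := {p | HasTrace p.1 p.2.1 p.2.2}
      add_mem' := fun h h' => HasTrace.add h h'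
      zero_mem' := by
        refine HasTrace.of_integral_test fun φ _ _ => ?_
        rw [Prod.fst_zero, Prod.snd_zero, Prod.fst_zero, Prod.snd_zero, smul_zero, neg_zero]
        refine integral_eq_zero_of_ae ?_
        filter_upwards [Lp.coeFn_zero H 2 (volume.restrict (Ioi (0 : ℝ)))] with x hx
        rw [hx]
        simp
      smul_mem' := fun c p h => HasTrace.smul h c }
  let L : X →ₗ[ℂ] L2Half H :=
    ((lift (j * j) : L2Half H →ₗ[ℂ] L2Half H) ∘ₗ LinearMap.fst ℂ _ _ ∘ₗ LinearMap.snd ℂ _ _ -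
      LinearMap.fst ℂ _ _) ∘ₗ X.subtype
  let ℓ : X →ₗ[ℂ] ℂ := (innerSL ℂ (-(j y)) : H →ₗ[ℂ] ℂ) ∘ₗ LinearMap.snd ℂ _ _ ∘ₗ
    LinearMap.snd ℂ _ _ ∘ₗ X.subtype
  have hL : ∀ p : X, L p = lift (j * j) p.1.2.1 - p.1.1 := fun p => rfl
  have hℓ : ∀ p : X, ℓ p = inner ℂ (-(j y)) p.1.2.2 := fun p => rfl
  have hbound : ∀ p : X, ‖ℓ p‖ ≤ ‖y‖ * ‖L p‖ := by
    rintro ⟨⟨f, g, v⟩, hp⟩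
    have hp' : HasTrace f g v := hp
    rw [hL, hℓ]
    simp only
    -- `‖j² f' - f‖² = ‖j² f'‖² + ‖f‖² + ‖j f(0)‖²`
    have h1 := (hp'.map j).inner_add_inner (hp'.map j)
    have h2 : inner ℂ (lift j f) (lift j g) = inner ℂ f (lift (j * j) g) := by
      rw [inner_map_left (lift_star_eq hj), lift_lift]
    have h3 : inner ℂ (lift j g) (lift j f) = inner ℂ (lift (j * j) g) f := by
      rw [← inner_map_left (lift_star_eq hj), lift_lift]
    rw [h2, h3] at h1
    have h4 : (inner ℂ f (lift (j * j) g)).re = (inner ℂ (lift (j * j) g) f).re :=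
      inner_re_symm (𝕜 := ℂ) _ _
    have h5 := congrArg Complex.re h1
    have h9 : (inner ℂ (j v) (j v)).re = ‖j v‖ ^ 2 := inner_self_eq_norm_sq (𝕜 := ℂ) (j v)
    rw [Complex.add_re, h4, Complex.neg_re, h9] at h5
    have h6 : ‖lift (j * j) g - f‖ ^ 2 = _ := norm_sub_sq (𝕜 := ℂ) (lift (j * j) g) f
    have h7 : RCLike.re (inner ℂ (lift (j * j) g) f) = (inner ℂ (lift (j * j) g) f).re := rfl
    rw [h7] at h6
    have h8 : ‖j v‖ ≤ ‖lift (j * j) g - f‖ := by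
      refine le_of_sq_le_sq ?_ (norm_nonneg _)
      nlinarith [sq_nonneg ‖lift (j * j) g‖, sq_nonneg ‖f‖]
    rw [inner_neg_left, norm_neg, inner_map_left hj]
    exact (norm_inner_le_norm _ _).trans (by gcongr)
  -- The equation for `u` is the adjoint of `f ↦ j² f' - f`, tested on all `f`.
  obtain ⟨u, hu⟩ := exists_inner_eq_of_norm_le L ℓ hbound
  refine ⟨u, HasTrace.of_integral_test fun φ h1 h2 => ?_⟩
  refine ext_inner_left ℂ fun x => ?_
  obtain ⟨f, g, hf, hg, hfg⟩ := exists_hasTrace_smul h1 h2 x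
  have h3 := hu ⟨(f, g, φ 0 • x), hfg⟩
  rw [hL, hℓ] at h3
  simp only at h3
  have h4 := congrArg (starRingEnd ℂ) h3
  rw [inner_conj_symm, inner_conj_symm, inner_sub_left, inner_map_left (lift_star_eq hJ),
    L2.inner_def, L2.inner_def, ← integral_sub (L2.integrable_inner _ _)
      (L2.integrable_inner _ _)] at h4
  have hint : Integrable (fun x => deriv φ x • lift (j * j) u x + φ x • (-u : L2Half H) x)
      (volume.restrict (Ioi (0 : ℝ))) :=
    (integrable_smul_of_test (h1.continuous_deriv (by simp)) h2.deriv _).add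
      (integrable_smul_of_test h1.continuous h2 _)
  have h5 : inner ℂ x (∫ t in Ioi (0 : ℝ), (deriv φ t • lift (j * j) u t +
      φ t • (-u : L2Half H) t)) = ∫ t in Ioi (0 : ℝ), inner ℂ x (deriv φ t • lift (j * j) u t +
      φ t • (-u : L2Half H) t) :=
    (innerSL ℂ x).integral_comp_comm hint |>.symm
  rw [h5]
  have h6 : inner ℂ x (-(φ 0 • j y)) = inner ℂ (φ 0 • x) (-(j y)) := by
    rw [inner_neg_right, inner_neg_right, ← Complex.coe_smul, ← Complex.coe_smul, inner_smul_left,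
      inner_smul_right, Complex.conj_ofReal]
  rw [h6, ← h4]
  refine integral_congr_ae ?_
  filter_upwards [hf, hg, Lp.coeFn_neg u] with t e1 e2 e3
  rw [e1, e2, e3, Pi.neg_apply]
  simp only [← Complex.coe_smul, inner_smul_left, inner_smul_right, inner_add_right,
    inner_neg_right, Complex.conj_ofReal]
  ring

/-- Green's formula pairs elements of `ℋ₁`, whose boundary values are in `H_{1/2}`, with maximal
solutions, whose boundary values are in `H_{-1/2}`. -/
theorem MaxSolution.green (B : BoundedTransform A j Λ) {u h a g : L2Half H} {x y : H}
    (hu : MaxSolution j Λ u h (j y)) (ha : HasTrace (lift (j * j) a) g (j x)) :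
    inner ℂ (lift (j * j) a) h - inner ℂ (lift Λ a) u + inner ℂ g u = -inner ℂ x y := by
  have hJ := B.star_sq
  have hJl := lift_star_eq hJ
  set D := fun ε : ℝ => regularizer (j * j) ε with hD
  have hT := fun f => tendsto_regularizer hJl (lift_injective B.injective_sq) f
  have h1 : Tendsto (fun ε : ℝ => inner ℂ (regularizer (lift (j * j)) ε
        (lift (j * j) (lift (j * j) (lift (j * j) a)))) h -
      inner ℂ (regularizer (lift (j * j)) ε (lift (j * j) (lift (j * j) (lift Λ a)))) u +
      inner ℂ (regularizer (lift (j * j)) ε (lift (j * j) (lift (j * j) g))) u) (𝓝[>] 0)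
      (𝓝 (inner ℂ (lift (j * j) a) h - inner ℂ (lift Λ a) u + inner ℂ g u)) :=
    (((hT _).inner tendsto_const_nhds).sub ((hT _).inner tendsto_const_nhds)).add
      ((hT _).inner tendsto_const_nhds)
  have h2 : Tendsto (fun ε : ℝ => -inner ℂ (regularizer (j * j) ε ((j * j) ((j * j) x))) y)
      (𝓝[>] 0) (𝓝 (-inner ℂ x y)) :=
    ((tendsto_regularizer hJ B.injective_sq x).inner tendsto_const_nhds).neg
  refine tendsto_nhds_unique h1 (h2.congr' ?_)
  filter_upwards [self_mem_nhdsWithin] with ε hε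
  have hε' : (0 : ℝ) < ε := hε
  have hDs : star (D ε) = D ε := star_regularizer hJ
  have hDJ : Commute (D ε) (j * j) := commute_regularizer (Commute.refl _)
  have hDj : Commute (D ε) j := commute_regularizer ((Commute.refl j).mul_left (Commute.refl j))
  have h3 := (ha.map (D ε * (j * j))).inner_add_inner hu
  rw [← lift_regularizer hJ hε']
  change -inner ℂ (D ε _) y = inner ℂ (lift (D ε) _) h - inner ℂ (lift (D ε) _) u +
    inner ℂ (lift (D ε) _) u
  rw [lift_mul] at h3
  change inner ℂ (lift (D ε) (lift (j * j) (lift (j * j) a))) _ +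
    inner ℂ (lift (D ε) (lift (j * j) g)) _ = -inner ℂ (D ε ((j * j) (j x))) _ at h3
  have e : ∀ f k, inner ℂ (lift (D ε) (lift (j * j) f)) (lift (j * j) k) =
      inner ℂ (lift (D ε) (lift (j * j) (lift (j * j) f))) k := by
    intro f k
    rw [← inner_map_left hJl]
    congr 1
    exact (DFunLike.congr_fun (lift_commute hDJ).eq (lift (j * j) f)).symm
  have e2 : inner ℂ (lift (D ε) (lift (j * j) (lift (j * j) a))) (lift Λ u) =
      inner ℂ (lift (D ε) (lift (j * j) (lift (j * j) (lift Λ a)))) u := by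
    rw [← inner_map_left (lift_star_eq B.star_Λ)]
    congr 1
    have hc : Commute (D ε * (j * j) * (j * j)) Λ :=
      ((commute_regularizer B.commute_sq).mul_left B.commute_sq).mul_left B.commute_sq
    have := DFunLike.congr_fun (lift_commute hc).eq a
    rw [lift_mul, lift_mul] at this
    exact this.symm
  have e3 : inner ℂ (D ε ((j * j) (j x))) (j y) = inner ℂ (D ε ((j * j) ((j * j) x))) y := by
    rw [← inner_map_left B.star_j]
    congr 1
    exact (DFunLike.congr_fun hDj.eq ((j * j) (j x))).symm
  rw [inner_sub_right, e, e, e2, e3] at h3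
  exact h3.symm

end Decay

/-! ### Boundary regularity from self-adjointness -/

section NecessaryRegularity

variable {H : Type*} [NormedAddCommGroup H] [InnerProductSpace ℂ H] [CompleteSpace H]
  {A : H →ₗ.[ℂ] H} {j Λ γ P Q X : H →L[ℂ] H}

/-- The positive part of every element of `H_{-1/2}` is the generalized boundary value of
a maximal solution. -/
theorem ModelData.exists_maxSolution_of_proj (B : ModelData A j Λ γ Q) {y : H} (hy : Q y = y) :
    ∃ u h, MaxSolution j Λ u h (j y) := by
  have hunit : IsUnit (1 + Λ * Q) := by
    refine ContinuousLinearMap.isUnit_of_forall_le_norm_inner_map _ (c := 1) one_pos fun x => ?_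
    have h1 : (inner ℂ ((1 + Λ * Q) x) x).re = ‖x‖ ^ 2 + (inner ℂ (Λ (Q x)) x).re := by
      change (inner ℂ (x + Λ (Q x)) x).re = _
      rw [inner_add_left, Complex.add_re]
      congr 1
      exact inner_self_eq_norm_sq (𝕜 := ℂ) x
    have h2 := B.nonneg x
    have h3 := Complex.re_le_norm (inner ℂ ((1 + Λ * Q) x) x)
    change ‖x‖ ^ 2 * 1 ≤ _
    linarith
  set r := Ring.inverse (1 + Λ * Q) with hr
  have hr1 : (1 + Λ * Q) * r = 1 := Ring.mul_inverse_cancel _ hunit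
  have hr2 : r * (1 + Λ * Q) = 1 := Ring.inverse_mul_cancel _ hunit
  have hc : Commute (j * j) (1 + Λ * Q) := (Commute.one_right _).add_right
    (B.commute_sq.mul_right (B.commute_proj.mul_left B.commute_proj))
  have hJr : (j * j) * r = r * (j * j) := by
    calc (j * j) * r = r * (1 + Λ * Q) * ((j * j) * r) := by rw [hr2, one_mul]
      _ = r * ((1 + Λ * Q) * (j * j)) * r := by simp only [mul_assoc]
      _ = r * (j * j) * ((1 + Λ * Q) * r) := by rw [← hc.eq]; simp only [mul_assoc]
      _ = _ := by rw [hr1, mul_one]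
  -- `(1 + Λ)⁻¹ J² = 1 - Λ` on the range of `Q`
  have hkey : (j * j) * ((j * j) * r) * Q = Q - Λ * Q := by
    have e1 : (j * j) * (j * j) * Q = (1 + Λ * Q) * (Q - Λ * Q) := by
      have e2 := congrArg (· * Q) B.sq_add_sq
      simp only [add_mul, one_mul] at e2
      have e3 : Λ * Q * Q = Λ * Q := by rw [mul_assoc, B.proj.isIdempotentElem.eq]
      have e4 : Λ * Q * (Λ * Q) = Λ * Λ * Q := by
        rw [mul_assoc, ← mul_assoc Q, ← B.commute_proj_Λ.eq, mul_assoc,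
          B.proj.isIdempotentElem.eq, mul_assoc]
      rw [add_mul, one_mul, mul_sub, e3, e4, eq_sub_of_add_eq e2]
      abel
    calc (j * j) * ((j * j) * r) * Q = r * ((j * j) * (j * j) * Q) := by
          rw [hJr, ← mul_assoc, hJr]; simp only [mul_assoc]
      _ = _ := by rw [e1, ← mul_assoc, hr2, one_mul]
  -- `u' = - J⁻¹ u`, so that `Q u` is a solution for `h = (A - J⁻¹) Q u`; this `h` is in `L²`
  -- because `J h = (Λ - 1) Q u` is in the range of `J²`.
  obtain ⟨u, hu⟩ := exists_hasTrace_neg B.star_j y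
  have hu' := hu.map Q
  have e1 : Q (j y) = j y := by
    conv_rhs => rw [← hy]
    exact (DFunLike.congr_fun B.commute_proj.eq y).symm
  rw [e1, map_neg] at hu'
  refine ⟨lift Q u, -lift ((j * j) * r) (lift Q u), ?_⟩
  have e2 : lift (j * j) (lift Q u) = lift Q (lift (j * j) u) :=
    DFunLike.congr_fun (lift_commute (B.commute_proj.mul_left B.commute_proj)).eq u
  have e3 : lift (j * j) (-lift ((j * j) * r) (lift Q u)) - lift Λ (lift Q u) = -lift Q u := by
    rw [map_neg, lift_lift, lift_lift, lift_lift, hkey, lift_sub]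
    change -(lift Q u - lift (Λ * Q) u) - _ = _
    abel
  rw [MaxSolution, e2, e3]
  exact hu'

/-- Boundary regularity for the self-adjoint operator on `{f ∈ ℋ₁ | P f(0) = 0}`, where `X` is
the operator induced by `P` on `H_{-1/2}`: a boundary value `y` in the positive part with
`P y ∈ H_{1/2}` is itself in `H_{1/2}`. -/
theorem ModelData.exists_sq_eq_of_proj (B : ModelData A j Λ γ Q) (hPp : IsStarProjection P)
    (hP : star γ * P * γ = 1 - P) (hX : X * j = j * P)
    (hG : ∀ q, q ∈ sobolevGraph γ A P ↔
      ∀ p ∈ sobolevGraph γ A P, inner ℂ p.2 q.1 = inner ℂ p.1 q.2)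
    {y x : H} (hy : Q y = y) (hx : X y = (j * j) x) : ∃ z, (j * j) z = y := by
  have hB := B.toBoundedTransform
  have hX' : j * star X = P * j := by
    have := congrArg star hX
    rwa [star_mul, star_mul, B.star_j, hPp.isSelfAdjoint.star_eq] at this
  obtain ⟨u, h, hu⟩ := B.exists_maxSolution_of_proj hy
  -- correct the boundary value so that it satisfies the boundary condition
  obtain ⟨f, hf⟩ := exists_hasTrace_neg B.star_j (-x)
  have hq : (u + lift (j * j) f, lift γ (h + (-f + lift Λ f))) ∈ sobolevGraph γ A P := by
    rw [hG]
    intro p hp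
    obtain ⟨a, g, v, ha, htr, hv, hp2⟩ := (hB.mem_sobolevGraph_iff p).1 hp
    rw [← ha] at htr
    obtain ⟨a₀, rfl⟩ := htr.exists_quarterPow_eq hB
    have h1 := B.green htr hf
    have hγa : lift γ (lift (j * j) a) = lift (j * j) (lift γ a) :=
      DFunLike.congr_fun (lift_commute (B.commute_γ.mul_left B.commute_γ).symm).eq a
    have hγj : γ (j a₀) = j (γ a₀) := (DFunLike.congr_fun B.commute_γ.eq a₀).symm
    have hγΛ : lift γ (lift Λ a) = -lift Λ (lift γ a) := by
      rw [lift_lift, lift_lift, B.anticommute, lift_neg]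
      rfl
    have htr' := htr.map γ
    rw [hγa, hγj] at htr'
    have h2 := hu.green hB htr'
    have hγs : ∀ k l : L2Half H, inner ℂ k (lift γ l) = -inner ℂ (lift γ k) l := by
      intro k l
      have e := inner_star_right (lift γ) k l
      rw [← lift_star, B.star_γ, lift_neg] at e
      rw [← e]
      change _ = -inner ℂ k (-(lift γ l))
      rw [inner_neg_right, neg_neg]
    have h3 : inner ℂ (γ a₀) (y - X y) = 0 := by
      have e1 : γ a₀ - star X (γ a₀) = 0 := by
        apply B.injective_j
        have e2 : j (star X (γ a₀)) = P (j (γ a₀)) := DFunLike.congr_fun hX' (γ a₀)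
        have e3 : γ (P (j a₀)) = γ (j a₀) - P (γ (j a₀)) :=
          DFunLike.congr_fun (B.γ_mul_eq hP) (j a₀)
        rw [hv, map_zero] at e3
        rw [map_sub, e2, ← hγj, ← e3, map_zero]
      rw [inner_sub_right, ← inner_star_left, ← inner_sub_left, e1, inner_zero_left]
    have h4 : inner ℂ (γ (j a₀)) (j (-x)) = -inner ℂ (γ a₀) (X y) := by
      rw [hγj, inner_map_left B.star_j, map_neg, map_neg, inner_neg_right, hx]
      rfl
    rw [h4] at h1
    rw [hp2, ← ha]
    simp only
    rw [inner_add_right, map_add (lift γ) h, inner_add_right, hγs _ h, hγa]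
    rw [inner_sub_right] at h3
    have h5 : inner ℂ (lift γ (g + lift Λ a)) u =
        inner ℂ (lift γ g) u - inner ℂ (lift Λ (lift γ a)) u := by
      rw [map_add, hγΛ, inner_add_left, inner_neg_left, sub_eq_add_neg]
    rw [h5]
    linear_combination h1 + h2 - h3
  obtain ⟨b, -, -, hb, -⟩ := (hB.mem_sobolevGraph_iff _).1 hq
  simp only at hb
  have hu' : u = lift (j * j) (b - f) := by rw [map_sub, hb, add_sub_cancel_right]
  rw [hu'] at hu
  obtain ⟨z, -, hz⟩ := hu.hasTrace_of_lift hB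
  exact ⟨z, B.injective_j hz⟩

/-- Boundary regularity in the form used below: the operator induced on `H_{-1/2}` by
`Q P Q + (1 - Q)` is regular with respect to `H_{1/2}`. -/
theorem ModelData.exists_sq_eq_of_folded (B : ModelData A j Λ γ Q) (hPp : IsStarProjection P)
    (hP : star γ * P * γ = 1 - P) (hX : X * j = j * P)
    (hG : ∀ q, q ∈ sobolevGraph γ A P ↔
      ∀ p ∈ sobolevGraph γ A P, inner ℂ p.2 q.1 = inner ℂ p.1 q.2)
    {y x : H} (hx : (Q * X * Q + (1 - Q)) y = (j * j) x) : ∃ z, (j * j) z = y := by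
  have hX' : j * star X = P * j := by
    have := congrArg star hX
    rwa [star_mul, star_mul, B.star_j, hPp.isSelfAdjoint.star_eq] at this
  have hQQ : ∀ x, Q (Q x) = Q x := fun x => DFunLike.congr_fun B.proj.isIdempotentElem.eq x
  have hXX : ∀ x, X (X x) = X x := by
    have : X * X = X := by
      refine eq_of_mul_eq_mul_right B.denseRange ?_
      rw [mul_assoc, hX, ← mul_assoc, hX, mul_assoc, hPp.isIdempotentElem.eq]
    exact fun x => DFunLike.congr_fun this x
  have hXJ : ∀ x, X ((j * j) x) = (j * j) (star X x) := by
    have : X * (j * j) = (j * j) * star X := by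
      rw [← mul_assoc, hX, mul_assoc, mul_assoc, hX']
    exact fun x => DFunLike.congr_fun this x
  have hQJ : ∀ x, Q ((j * j) x) = (j * j) (Q x) := fun x =>
    (DFunLike.congr_fun (B.commute_proj.mul_left B.commute_proj).eq x).symm
  have hγJ : ∀ x, γ ((j * j) x) = (j * j) (γ x) := fun x =>
    (DFunLike.congr_fun (B.commute_γ.mul_left B.commute_γ).eq x).symm
  have hγX : ∀ x, X (γ x) = γ x - γ (X x) := by
    have : γ * X = (1 - X) * γ := by
      refine eq_of_mul_eq_mul_right B.denseRange ?_
      rw [mul_assoc, hX, ← mul_assoc, ← B.commute_γ.eq, mul_assoc, B.γ_mul_eq hP, mul_assoc,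
        ← B.commute_γ.eq, sub_mul, sub_mul, mul_sub, one_mul, one_mul, ← mul_assoc, ← mul_assoc,
        hX, mul_assoc]
    intro x
    have h : γ (X x) = γ x - X (γ x) := DFunLike.congr_fun this x
    rw [h, sub_sub_cancel]
  have hγQ : ∀ x, Q (γ x) = γ x - γ (Q x) := by
    intro x
    have h : γ (Q x) = γ x - Q (γ x) := DFunLike.congr_fun B.γ_mul_proj x
    rw [h, sub_sub_cancel]
  have hγγ : ∀ x, γ (γ x) = -x := fun x => DFunLike.congr_fun B.γ_mul_γ x
  have hx' : Q (X (Q y)) + (y - Q y) = (j * j) x := hx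
  have h1 : Q (X (Q y)) = (j * j) (Q x) := by
    rw [← hQJ, ← hx', map_add, hQQ, map_sub, hQQ, sub_self, add_zero]
  have h2 : y - Q y = (j * j) (x - Q x) := by
    rw [map_sub, ← hx', ← h1, add_sub_cancel_left]
  -- `z = (1 - Q) X Q y` satisfies `(1 - X) z ∈ H_{1/2}`; `γ` maps it to the positive part
  set z := X (Q y) - Q (X (Q y)) with hz
  have h3 : z - X z = (j * j) (star X (Q x) - Q x) := by
    rw [hz, map_sub, hXX, h1, hXJ, map_sub]
    abel
  obtain ⟨z', hz'⟩ := B.exists_sq_eq_of_proj hPp hP hX hG (y := γ z)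
    (x := γ (star X (Q x) - Q x))
    (by rw [hγQ, show Q z = 0 by rw [hz, map_sub, hQQ, sub_self], map_zero, sub_zero])
    (by rw [hγX, ← map_sub, h3, hγJ])
  have h4 : z = (j * j) (-γ z') := by
    rw [map_neg, ← hγJ, hz', hγγ, neg_neg]
  obtain ⟨w, hw⟩ := B.exists_sq_eq_of_proj hPp hP hX hG (y := Q y) (x := -γ z' + Q x) (hQQ y)
    (by rw [map_add, ← h4, ← h1, hz, sub_add_cancel])
  exact ⟨w + (x - Q x), by rw [map_add, hw, ← h2, add_sub_cancel]⟩

end NecessaryRegularity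

/-! ### Compactness and symmetrizable operators -/

section CompactEstimates

variable {X : Type*} [NormedAddCommGroup X] [InnerProductSpace ℂ X] [CompleteSpace X]

theorem isUnit_of_norm_le {T : X →L[ℂ] X} {C : ℝ} (h : ∀ x, ‖x‖ ≤ C * ‖T x‖)
    (hs : Function.Injective (star T : X →L[ℂ] X)) : IsUnit T := by
  have h' : ∀ x, ‖x‖ ≤ (Real.toNNReal C : ℝ) * ‖T x‖ := fun x =>
    (h x).trans (mul_le_mul_of_nonneg_right (Real.le_coe_toNNReal C) (norm_nonneg _))
  rw [ContinuousLinearMap.isUnit_iff_bijective,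
    ContinuousLinearMap.bijective_iff_dense_range_and_antilipschitz]
  exact ⟨Submodule.dense_iff_topologicalClosure_eq_top.1 (denseRange_of_star_injective hs),
    _, ContinuousLinearMap.antilipschitz_of_bound T h'⟩

/-- A subspace on which a compact operator is bounded below is finite-dimensional. -/
theorem finiteDimensional_of_norm_le {K : X →L[ℂ] X} (hK : IsCompactOperator K) {N : Submodule ℂ X}
    [CompleteSpace N] {C : ℝ} (h : ∀ x ∈ N, ‖x‖ ≤ C * ‖K x‖) : FiniteDimensional ℂ N := by
  have h' : ∀ x : N, ‖x‖ ≤ (Real.toNNReal C : ℝ) * ‖(K.comp N.subtypeL) x‖ := fun x =>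
    (h x x.2).trans (mul_le_mul_of_nonneg_right (Real.le_coe_toNNReal C) (norm_nonneg _))
  have hal := ContinuousLinearMap.antilipschitz_of_bound (K.comp N.subtypeL) h'
  have hemb := hal.isClosedEmbedding (K.comp N.subtypeL).uniformContinuous
  obtain ⟨S, hS, hKS⟩ := (hK.comp_clm N.subtypeL).image_closedBall_subset_compact
    (f := (K.comp N.subtypeL : N →ₗ[ℂ] X)) 1
  refine FiniteDimensional.of_isCompact_closedBall₀ ℂ (r := 1) one_pos ?_
  exact (hemb.isCompact_preimage hS).of_isClosed_subset Metric.isClosed_closedBall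
    (image_subset_iff.1 hKS)

/-- An injective operator that is bounded below up to a compact operator is bounded below. -/
theorem exists_norm_le_of_isCompactOperator {K M : X →L[ℂ] X} (hK : IsCompactOperator K)
    (hM : Function.Injective M) {C : ℝ} (h : ∀ x, ‖x‖ ≤ C * (‖K x‖ + ‖M x‖)) :
    ∃ C', ∀ x, ‖x‖ ≤ C' * ‖M x‖ := by
  by_contra! hcon
  have h1 : ∀ n : ℕ, ∃ x, ‖x‖ = 1 ∧ ‖M x‖ ≤ ((n : ℝ) + 1)⁻¹ := by
    intro n
    obtain ⟨x, hx⟩ := hcon ((n : ℝ) + 1)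
    have hx0 : 0 < ‖x‖ := lt_of_le_of_lt (by positivity) hx
    refine ⟨((‖x‖⁻¹ : ℝ) : ℂ) • x, ?_, ?_⟩
    · rw [norm_smul, Complex.norm_real, norm_inv, norm_norm, inv_mul_cancel₀ hx0.ne']
    · rw [map_smul, norm_smul, Complex.norm_real, norm_inv, norm_norm, inv_mul_le_iff₀ hx0,
        ← div_eq_mul_inv, le_div_iff₀ (by positivity), mul_comm]
      exact hx.le
  choose x hx1 hxM using h1
  have hM0 : Tendsto (fun n => M (x n)) atTop (𝓝 0) := by
    refine squeeze_zero_norm hxM ?_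
    exact tendsto_one_div_add_atTop_nhds_zero_nat.congr fun n => one_div _
  obtain ⟨S, hS, hKS⟩ := hK.image_closedBall_subset_compact (f := (K : X →ₗ[ℂ] X)) 1
  obtain ⟨k, -, φ, hφ, hk⟩ := hS.tendsto_subseq (x := fun n => K (x n))
    fun n => hKS ⟨x n, by simp [hx1], rfl⟩
  set T := K.prod M with hT
  have h2 : ∀ y, ‖y‖ ≤ (Real.toNNReal (2 * C) : ℝ) * ‖T y‖ := by
    intro y
    have hC : 0 ≤ C ∨ C < 0 := le_or_gt 0 C
    have e1 : ‖K y‖ ≤ ‖T y‖ := le_max_left ‖K y‖ ‖M y‖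
    have e2 : ‖M y‖ ≤ ‖T y‖ := le_max_right ‖K y‖ ‖M y‖
    rcases hC with hC | hC
    · rw [Real.coe_toNNReal _ (by positivity)]
      refine (h y).trans ?_
      rw [mul_comm 2 C, mul_assoc]
      exact mul_le_mul_of_nonneg_left (by linarith) hC
    · exact (h y).trans ((mul_nonpos_of_nonpos_of_nonneg hC.le (by positivity)).trans
        (by positivity))
  have hal := ContinuousLinearMap.antilipschitz_of_bound T h2
  have hemb := hal.isClosedEmbedding T.uniformContinuous
  have h3 : Tendsto (fun n => T (x (φ n))) atTop (𝓝 (k, 0)) :=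
    hk.prodMk_nhds (hM0.comp hφ.tendsto_atTop)
  obtain ⟨z, hz⟩ := hemb.isClosed_range.mem_of_tendsto h3
    (Eventually.of_forall fun n => ⟨x (φ n), rfl⟩)
  rw [← hz] at h3
  have h4 : Tendsto (fun n => x (φ n)) atTop (𝓝 z) :=
    hemb.isInducing.tendsto_nhds_iff.2 h3
  have h5 : ‖z‖ = 1 := tendsto_nhds_unique h4.norm (by simp [hx1])
  have h6 : M z = 0 := congrArg Prod.snd hz
  rw [hM (h6.trans (map_zero M).symm), norm_zero] at h5
  exact zero_ne_one h5

theorem le_of_pow_two_pow_le {a b D : ℝ} (hb : 0 ≤ b)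
    (h : ∀ k : ℕ, a ^ 2 ^ k ≤ D * b ^ 2 ^ k) : a ≤ b := by
  by_contra! hab
  rcases hb.eq_or_lt with rfl | hb
  · have h0 := h 0
    simp at h0
    linarith
  have h1 : 1 < a / b := (one_lt_div hb).2 hab
  obtain ⟨n, hn⟩ := pow_unbounded_of_one_lt D h1
  have h2 : (a / b) ^ n ≤ (a / b) ^ 2 ^ n := pow_le_pow_right₀ h1.le Nat.lt_two_pow_self.le
  have h3 := h n
  rw [← div_le_iff₀ (by positivity), ← div_pow] at h3
  linarith

/-- An operator that is symmetric for the inner product `⟪j x, j y⟫` is bounded for its norm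
by the operator norm (Lax). -/
theorem norm_apply_le_of_symmetrizable {j R : X →L[ℂ] X} (hj : star j = j)
    (hR : j * j * R = star R * (j * j)) (x : X) : ‖j (R x)‖ ≤ ‖R‖ * ‖j x‖ := by
  have hpow : ∀ n : ℕ, j * j * R ^ n = star (R ^ n) * (j * j) := by
    intro n
    induction n with
    | zero => simp
    | succ n ih =>
      rw [pow_succ, ← mul_assoc, ih, mul_assoc, hR, star_mul, ← mul_assoc, ← star_mul, ← pow_succ',
        pow_succ, star_mul]
  have hsq : ∀ n : ℕ, ‖j ((R ^ n) x)‖ ^ 2 ≤ ‖j x‖ * ‖j ((R ^ (2 * n)) x)‖ := by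
    intro n
    have e1 : inner ℂ (j ((R ^ n) x)) (j ((R ^ n) x)) = inner ℂ (j x) (j ((R ^ (2 * n)) x)) := by
      have e2 : j (j ((R ^ n) x)) = star (R ^ n) (j (j x)) := DFunLike.congr_fun (hpow n) x
      have e3 : (R ^ (2 * n)) x = (R ^ n) ((R ^ n) x) := by
        rw [two_mul, pow_add]
        rfl
      rw [← inner_map_left hj, e2, inner_star_left, inner_map_left hj, e3]
    have e4 := norm_inner_le_norm (𝕜 := ℂ) (j x) (j ((R ^ (2 * n)) x))
    rwa [← e1, inner_self_eq_norm_sq_to_K, norm_pow, RCLike.norm_ofReal, abs_norm] at e4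
  rcases (norm_nonneg (j x)).eq_or_lt with h0 | h0
  · have := hsq 1
    rw [← h0, zero_mul, pow_one] at this
    have h1 : ‖j (R x)‖ = 0 := pow_eq_zero_iff (two_ne_zero) |>.1 (le_antisymm this (by positivity))
    rw [h1, ← h0, mul_zero]
  have hk : ∀ k : ℕ, (‖j (R x)‖ / ‖j x‖) ^ 2 ^ k ≤ ‖j ((R ^ 2 ^ k) x)‖ / ‖j x‖ := by
    intro k
    induction k with
    | zero => simp
    | succ k ih =>
      calc (‖j (R x)‖ / ‖j x‖) ^ 2 ^ (k + 1) = ((‖j (R x)‖ / ‖j x‖) ^ 2 ^ k) ^ 2 := by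
            rw [← pow_mul, pow_succ]
        _ ≤ (‖j ((R ^ 2 ^ k) x)‖ / ‖j x‖) ^ 2 := by gcongr
        _ = ‖j ((R ^ 2 ^ k) x)‖ ^ 2 / ‖j x‖ / ‖j x‖ := by rw [div_pow, sq ‖j x‖, div_div]
        _ ≤ ‖j ((R ^ 2 ^ (k + 1)) x)‖ / ‖j x‖ := by
            gcongr
            rw [div_le_iff₀ h0, pow_succ' 2 k, mul_comm]
            exact hsq (2 ^ k)
  rw [← div_le_iff₀ h0]
  refine le_of_pow_two_pow_le (norm_nonneg R) (D := ‖j‖ * ‖x‖ / ‖j x‖) fun k => (hk k).trans ?_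
  rw [div_mul_eq_mul_div]
  gcongr
  calc ‖j ((R ^ 2 ^ k) x)‖ ≤ ‖j‖ * (‖R ^ 2 ^ k‖ * ‖x‖) :=
        (j.le_opNorm _).trans (by gcongr; exact ContinuousLinearMap.le_opNorm _ _)
    _ ≤ ‖j‖ * (‖R‖ ^ 2 ^ k * ‖x‖) := by
        gcongr
        exact norm_pow_le' R (by positivity)
    _ = _ := by ring

end CompactEstimates

/-! ### From `H_{1/2}` to `H` -/

section Lifting

variable {X : Type*} [NormedAddCommGroup X] [InnerProductSpace ℂ X] [CompleteSpace X]
  {j S V : X →L[ℂ] X}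

/-- Let `S` be self-adjoint and act as `V` on the range of `j`, where `j²` is compact. If the
operator `V*` induced by `S` on the dual of `j X` is regular, then `S` is invertible up to
an operator of finite rank. -/
theorem exists_isUnit_add_of_regular (hj : star j = j) (hi : Function.Injective j)
    (hc : IsCompactOperator (j * j)) (hS : star S = S) (hV : j * V = S * j)
    (hreg : ∀ y x, star V y = (j * j) x → ∃ z, (j * j) z = y) :
    ∃ F : X →L[ℂ] X, FiniteDimensional ℂ F.range ∧ IsUnit (S + F) := by
  have hV' : star V * j = j * S := by
    have := congrArg star hV
    rwa [star_mul, star_mul, hj, hS] at this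
  have hJs : star (j * j) = j * j := by rw [star_mul, hj]
  have hJi : Function.Injective (j * j) := fun _ _ h => hi (hi h)
  have hJV : ∀ z, star V ((j * j) z) = (j * j) (V z) := by
    have : star V * (j * j) = (j * j) * V := by rw [← mul_assoc, hV', mul_assoc, mul_assoc, hV]
    exact fun z => DFunLike.congr_fun this z
  -- regularity, with an estimate
  obtain ⟨C, hC⟩ : ∃ C, ∀ z, ‖z‖ ≤ C * (‖(j * j) z‖ + ‖V z‖) := by
    set T := (j * j).prod V with hT
    have hTi : Function.Injective T := fun a b h => hJi (congrArg Prod.fst h)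
    have hTr : Set.range T = {p : X × X | star V p.1 = (j * j) p.2} := by
      ext p
      constructor
      · rintro ⟨z, rfl⟩
        exact hJV z
      · intro hp
        obtain ⟨z, hz⟩ := hreg _ _ hp
        refine ⟨z, Prod.ext hz (hJi ?_)⟩
        have hp' : star V p.1 = (j * j) p.2 := hp
        rw [← hp', ← hz]
        exact (hJV z).symm
    have hcl : IsClosed (Set.range T) := by
      rw [hTr]
      exact isClosed_eq ((star V).continuous.comp continuous_fst)
        ((j * j).continuous.comp continuous_snd)
    obtain ⟨K, hK⟩ := T.antilipschitz_of_injective_of_isClosed_range hTi hcl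
    refine ⟨K, fun z => ?_⟩
    have := hK.le_mul_dist z 0
    rw [map_zero, dist_zero_right, dist_zero_right] at this
    refine this.trans ?_
    gcongr
    exact max_le_add_of_nonneg (norm_nonneg _) (norm_nonneg _)
  have hNc : CompleteSpace V.ker := V.isClosed_ker.completeSpace_coe
  have hN : FiniteDimensional ℂ V.ker := finiteDimensional_of_norm_le hc (C := C) fun x hx => by
    have hx' : V x = 0 := hx
    have := hC x
    rwa [hx', norm_zero, add_zero] at this
  set E := V.ker.starProjection with hE
  have hEs : star E = E := (isStarProjection_starProjection (U := V.ker)).isSelfAdjoint.star_eq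
  have hEV : ∀ x, V (E x) = 0 := fun x => Submodule.starProjection_apply_mem V.ker x
  have hE1 : ∀ x, V x = 0 → E x = x := fun x hx => Submodule.starProjection_eq_self_iff.2 hx
  set M := V + E * (j * j) with hM
  -- The range of `V` and the kernel of `V` are orthogonal for the inner product `⟪j x, j y⟫`.
  have hMi : ∀ z, M z = 0 → z = 0 := by
    intro z hz
    have hz' : V z + E ((j * j) z) = 0 := hz
    set n := E ((j * j) z) with hn
    have hVn : V n = 0 := hEV _
    have h1 : inner ℂ (V z) ((j * j) n) = 0 := by
      rw [← inner_map_left hJs, ← hJV, inner_star_left, hVn, inner_zero_right]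
    have h2 : n = 0 := by
      rw [eq_neg_of_add_eq_zero_left hz', inner_neg_left, neg_eq_zero] at h1
      have h3 : inner ℂ (j n) (j n) = 0 := by rw [inner_map_left hj]; exact h1
      exact hi ((inner_self_eq_zero.1 h3).trans (map_zero j).symm)
    rw [h2, add_zero] at hz'
    have h3 : inner ℂ (j z) (j z) = 0 := by
      have e : inner ℂ ((j * j) z) z = inner ℂ n z := by
        rw [hn, inner_map_left hEs, hE1 z hz']
      rw [← inner_map_left hj]
      change inner ℂ ((j * j) z) z = 0
      rw [e, h2, inner_zero_left]
    exact hi ((inner_self_eq_zero.1 h3).trans (map_zero j).symm)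
  have hMs : star M = star V + (j * j) * E := by rw [hM, star_add, star_mul, hJs, hEs]
  have hMunit : IsUnit M := by
    have hMi' : Function.Injective M := (injective_iff_map_eq_zero M).2 hMi
    obtain ⟨C', hC'⟩ := exists_norm_le_of_isCompactOperator hc hMi' (C := 2 * max C 0) fun z => by
      have e1 : V z = M z - E ((j * j) z) := by
        change _ = V z + E ((j * j) z) - _
        rw [add_sub_cancel_right]
      have e2 : ‖E ((j * j) z)‖ ≤ ‖(j * j) z‖ := Submodule.norm_starProjection_apply_le _ _
      have e3 : ‖V z‖ ≤ ‖M z‖ + ‖(j * j) z‖ := by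
        rw [e1]
        exact (norm_sub_le _ _).trans (by linarith)
      have e4 : 0 ≤ max C 0 := le_max_right _ _
      calc ‖z‖ ≤ C * (‖(j * j) z‖ + ‖V z‖) := hC z
        _ ≤ max C 0 * (‖(j * j) z‖ + ‖V z‖) := by gcongr; exact le_max_left _ _
        _ ≤ max C 0 * (‖(j * j) z‖ + (‖M z‖ + ‖(j * j) z‖)) := by gcongr
        _ ≤ max C 0 * (2 * (‖(j * j) z‖ + ‖M z‖)) := by
            gcongr
            linarith [norm_nonneg (M z)]
        _ = _ := by ring
    refine isUnit_of_norm_le hC' ((injective_iff_map_eq_zero (star M)).2 fun y hy => ?_)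
    rw [hMs] at hy
    have hy' : star V y + (j * j) (E y) = 0 := hy
    obtain ⟨z, rfl⟩ := hreg y (-E y) (by rw [map_neg, eq_neg_of_add_eq_zero_left hy'])
    rw [hJV, ← map_add] at hy'
    rw [hMi z (hJi (hy'.trans (map_zero _).symm)), map_zero]
  -- `S + F` acts as `M` on the range of `j`
  refine ⟨j * E * j, ?_, ?_⟩
  · have : (j * E * j).range ≤ V.ker.map (j : X →ₗ[ℂ] X) := by
      rintro _ ⟨x, rfl⟩
      exact ⟨E (j x), hEV _, rfl⟩
    exact Submodule.finiteDimensional_of_le this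
  set R := Ring.inverse M with hR
  have hMR : M * R = 1 := Ring.mul_inverse_cancel _ hMunit
  have hRM : R * M = 1 := Ring.inverse_mul_cancel _ hMunit
  have hjM : j * M = (S + j * E * j) * j := by
    rw [hM, mul_add, hV, add_mul]
    simp only [mul_assoc]
  have hS1 : star (S + j * E * j) = S + j * E * j := by
    rw [star_add, hS, star_mul, star_mul, hj, hEs, mul_assoc]
  have hJM : (j * j) * M = star M * (j * j) := by
    have := congrArg star hjM
    rw [star_mul, star_mul, hj, hS1] at this
    rw [mul_assoc, hjM, ← mul_assoc, ← this, mul_assoc]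
  have hJR : (j * j) * R = star R * (j * j) := by
    have e : star R * star M = 1 := by rw [← star_mul, hMR, star_one]
    calc (j * j) * R = star R * (star M * (j * j)) * R := by
          rw [← mul_assoc (star R), e, one_mul]
      _ = star R * (j * j) * (M * R) := by rw [← hJM]; simp only [mul_assoc]
      _ = _ := by rw [hMR, mul_one]
  have hbd : ∀ w, ‖w‖ ≤ ‖R‖ * ‖(S + j * E * j) w‖ := by
    intro w
    have hd : Dense (Set.range j) := denseRange_of_isSelfAdjoint hj hi
    refine isClosed_property (e := j) hd (isClosed_le continuous_norm
      (continuous_const.mul (S + j * E * j).continuous.norm)) ?_ w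
    intro z
    have e1 : R (M z) = z := DFunLike.congr_fun hRM z
    have e2 : j (M z) = (S + j * E * j) (j z) := DFunLike.congr_fun hjM z
    have := norm_apply_le_of_symmetrizable hj hJR (M z)
    rwa [e1, e2] at this
  refine isUnit_of_norm_le hbd ?_
  rw [hS1]
  refine (injective_iff_map_eq_zero _).2 fun y hy => norm_le_zero_iff.1 ?_
  have := hbd y
  rwa [hy, norm_zero, mul_zero] at this

end Lifting

/-! ### The Fredholm condition -/

section NecessaryFredholm

variable {H : Type*} [NormedAddCommGroup H] [InnerProductSpace ℂ H] [CompleteSpace H]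
  {A : H →ₗ.[ℂ] H} {Λ γ P Q : H →L[ℂ] H}

/-- `(1 + A²)^(-1/2)` is compact, as it is the product of a resolvent of `A` with a bounded
operator. -/
theorem IsDiscreteOp.isCompactOperator {j : H →L[ℂ] H} (hA : IsDiscreteOp A)
    (B : BoundedTransform A j Λ) : IsCompactOperator (j * j) := by
  obtain ⟨z, R, hR, hc⟩ := hA
  have h : j * j = R.comp (Λ - z • (j * j)) := by
    ext x
    obtain ⟨u, hu, hAu⟩ := (LinearPMap.mem_graph_iff _).1 ((B.mem_graph_iff (_, _)).2 ⟨x, rfl, rfl⟩)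
    have h1 := hR.2 u
    rw [hu, hAu] at h1
    exact h1.symm
  rw [h]
  exact hc.comp_clm _

/-- If `Q P Q + (1 - Q)` is invertible up to an operator of finite rank, and `γ` exchanges `P`
with `1 - P` and `Q` with `1 - Q`, then `(P, Q)` is a Fredholm pair. -/
theorem isFredholmPair_of_isUnit (hP : IsStarProjection P) (hQ : IsStarProjection Q)
    (hγ : γ * γ = -1) (hγP : γ * P = (1 - P) * γ) (hγQ : γ * Q = (1 - Q) * γ) {F : H →L[ℂ] H}
    (hF : FiniteDimensional ℂ F.range) (hu : IsUnit (foldedProj P Q + F)) :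
    IsFredholmPair P Q := by
  have hQQ : ∀ x, Q (Q x) = Q x := fun x => DFunLike.congr_fun hQ.isIdempotentElem.eq x
  have hPP : ∀ x, P (P x) = P x := fun x => DFunLike.congr_fun hP.isIdempotentElem.eq x
  set R := Ring.inverse (foldedProj P Q + F) with hR
  have hR1 : ∀ x, foldedProj P Q (R x) + F (R x) = x := fun x =>
    DFunLike.congr_fun (Ring.mul_inverse_cancel _ hu) x
  have hR2 : ∀ x, R (foldedProj P Q x + F x) = x := fun x =>
    DFunLike.congr_fun (Ring.inverse_mul_cancel _ hu) x
  have hS : ∀ x, foldedProj P Q x = Q (P (Q x)) + (x - Q x) := fun x => rfl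
  let T : P.range →L[ℂ] Q.range :=
    (Q.comp P.range.subtypeL).codRestrict Q.range (fun _ => LinearMap.mem_range_self _ _)
  let v : Q.range →L[ℂ] P.range :=
    (P.comp ((Q.comp R).comp Q.range.subtypeL)).codRestrict P.range
      (fun _ => LinearMap.mem_range_self _ _)
  have hTv : ((T : P.range →ₗ[ℂ] Q.range) ∘ₗ (v : Q.range →ₗ[ℂ] P.range) - .id).range.FG := by
    refine Submodule.fg_of_fg_map_injective Q.range.subtype Q.range.injective_subtype ?_
    have h1 : FiniteDimensional ℂ (F.range.map (Q : H →ₗ[ℂ] H)) := inferInstance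
    refine (Submodule.fg_iff_finiteDimensional _).2 (Submodule.finiteDimensional_of_le
      (S₂ := F.range.map (Q : H →ₗ[ℂ] H)) ?_)
    rintro _ ⟨_, ⟨y, rfl⟩, rfl⟩
    refine ⟨F (R (-y)), ⟨_, rfl⟩, ?_⟩
    change Q (F (R (-y))) = Q (P (Q (R y))) - y
    have hy : Q y = y := by
      obtain ⟨x, hx⟩ := y.2
      rw [← hx]
      exact hQQ x
    have h2 := congrArg Q (hR1 y)
    rw [hS, map_add, map_add, hQQ, map_sub, hQQ, sub_self, add_zero, hy] at h2
    rw [map_neg, map_neg, map_neg, eq_sub_of_add_eq h2, sub_sub_cancel_left]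
  have hker : (T : P.range →ₗ[ℂ] Q.range).ker.FG := by
    let γ' : P.range →ₗ[ℂ] H := (γ : H →ₗ[ℂ] H) ∘ₗ P.range.subtype
    have hγγ : ∀ x, γ (γ x) = -x := fun x => DFunLike.congr_fun hγ x
    have hγ' : Function.Injective γ' := by
      intro x y hxy
      have h1 : γ x = γ y := hxy
      have h2 := congrArg γ h1
      rw [hγγ, hγγ, neg_inj] at h2
      exact Subtype.ext h2
    refine Submodule.fg_of_fg_map_injective γ' hγ' ?_
    have h1 : FiniteDimensional ℂ (F.range.map (R : H →ₗ[ℂ] H)) := inferInstance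
    refine (Submodule.fg_iff_finiteDimensional _).2 (Submodule.finiteDimensional_of_le
      (S₂ := F.range.map (R : H →ₗ[ℂ] H)) ?_)
    rintro _ ⟨x, hx, rfl⟩
    refine ⟨F (γ x), ⟨_, rfl⟩, ?_⟩
    change R (F (γ x)) = γ x
    have hQx : Q x = 0 := congrArg (fun z : Q.range => (z : H)) hx
    have hPx : P x = x := by
      obtain ⟨y, hy⟩ := x.2
      rw [← hy]
      exact hPP y
    have h2 : γ (P x) = γ x - P (γ x) := DFunLike.congr_fun hγP (x : H)
    have h3 : γ (Q x) = γ x - Q (γ x) := DFunLike.congr_fun hγQ (x : H)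
    rw [hPx] at h2
    rw [hQx, map_zero] at h3
    have h4 : foldedProj P Q (γ x) = 0 := by
      rw [hS, ← sub_eq_zero.1 h3.symm, sub_eq_self.1 h2.symm, map_zero, sub_self, add_zero]
    have h5 := hR2 (γ x)
    rwa [h4, zero_add] at h5
  -- `T (v T - 1) = (T v - 1) T` has finite rank and `ker T` is finite-dimensional.
  have hvT : ((v : Q.range →ₗ[ℂ] P.range) ∘ₗ (T : P.range →ₗ[ℂ] Q.range) - .id).range.FG := by
    refine Submodule.fg_of_fg_map_of_fg_inf_ker (T : P.range →ₗ[ℂ] Q.range) ?_ ?_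
    · have := (Submodule.fg_iff_finiteDimensional _).1 hTv
      refine (Submodule.fg_iff_finiteDimensional _).2 (Submodule.finiteDimensional_of_le
        (S₂ := ((T : P.range →ₗ[ℂ] Q.range) ∘ₗ (v : Q.range →ₗ[ℂ] P.range) - .id).range) ?_)
      rintro _ ⟨_, ⟨x, rfl⟩, rfl⟩
      refine ⟨T x, ?_⟩
      change T (v (T x)) - T x = T (v (T x) - x)
      rw [map_sub]
    · have := (Submodule.fg_iff_finiteDimensional _).1 hker
      exact (Submodule.fg_iff_finiteDimensional _).2
        (Submodule.finiteDimensional_of_le inf_le_right)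
  exact ContinuousLinearMap.IsFredholm.of_isQuasiInverse (v := v)
    ⟨LinearMap.FiniteRangeSetoid.equiv_iff_hasFiniteRange.2 hvT,
      LinearMap.FiniteRangeSetoid.equiv_iff_hasFiniteRange.2 hTv⟩

/-- If `A` is discrete and the operator on `{f ∈ ℋ₁ | P f(0) = 0}` is self-adjoint, then `(P, Q)`
is a Fredholm pair. -/
theorem ModelData.isFredholmPair (hA : IsSelfAdjoint A) (hdisc : IsDiscreteOp A)
    (B : ModelData A (quarterPow A) Λ γ Q) (hPp : IsStarProjection P)
    (hP : star γ * P * γ = 1 - P) (hP0 : P ∈ OpZero A)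
    (hG : ∀ q, q ∈ sobolevGraph γ A P ↔
      ∀ p ∈ sobolevGraph γ A P, inner ℂ p.2 q.1 = inner ℂ p.1 q.2) :
    IsFredholmPair P Q := by
  obtain ⟨X, hX⟩ := exists_mul_quarterPow_eq hA hP0
  have hX' : quarterPow A * star X = P * quarterPow A := by
    have := congrArg star hX
    rwa [star_mul, star_mul, B.star_j, hPp.isSelfAdjoint.star_eq] at this
  have hQs := B.proj.isSelfAdjoint.star_eq
  have hQj := B.commute_proj.eq
  have hV : quarterPow A * (Q * star X * Q + (1 - Q)) = foldedProj P Q * quarterPow A := by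
    have e1 : quarterPow A * (Q * star X * Q) = Q * P * Q * quarterPow A := by
      rw [mul_assoc Q, ← mul_assoc, hQj, mul_assoc Q, ← mul_assoc (quarterPow A), hX',
        mul_assoc P, hQj]
      simp only [mul_assoc]
    rw [foldedProj, mul_add, e1, mul_sub, hQj, mul_one, add_mul, sub_mul, one_mul]
  obtain ⟨F, hF, hu⟩ := exists_isUnit_add_of_regular B.star_j B.injective_j
    (hdisc.isCompactOperator B.toBoundedTransform) (star_foldedProj hPp B.proj) hV
    fun y x hyx => B.exists_sq_eq_of_folded hPp hP hX hG (x := x) (by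
      rw [star_add, star_sub, star_one, star_mul, star_mul, star_star, hQs, ← mul_assoc] at hyx
      exact hyx)
  exact isFredholmPair_of_isUnit hPp B.proj B.γ_mul_γ (B.γ_mul_eq hP) B.γ_mul_proj hF hu

end NecessaryFredholm

end ModelOp

end

theorem mainTheorem1 {H : Type*} [NormedAddCommGroup H] [InnerProductSpace ℂ H] [CompleteSpace H]
    (A : H →ₗ.[ℂ] H) (hA : IsSelfAdjoint A)
    (γ : H →L[ℂ] H) (hγ_skew : star γ = -γ) (hγ_sq : γ * γ = -1)
    (hγ_dom : A.domain.map (γ : H →ₗ[ℂ] H) = A.domain)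
    (hγ_anti : ∀ x y : A.domain, (y : H) = γ x → γ (A x) + A y = 0)
    (Ψ : StarSubalgebra ℂ (H →L[ℂ] H))
    (hΨ_op : (Ψ : Set (H →L[ℂ] H)) ⊆ ModelOp.OpZero A)
    (hΨ_hol : ModelOp.HasHolomorphicCalculus (Ψ : Set (H →L[ℂ] H)))
    (Pplus : H →L[ℂ] H) (hPplus_mem : Pplus ∈ Ψ) (hPplus : IsStarProjection Pplus)
    (hPplus_symm : 1 - Pplus = star γ * Pplus * γ)
    (hPplus_ge : ModelOp.positiveProj A ≤ Pplus) (hPplus_le : Pplus ≤ ModelOp.nonnegProj A) :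
    (∀ P ∈ Ψ, IsStarProjection P → star γ * P * γ = 1 - P →
      ModelOp.IsFredholmPair P Pplus →
        ModelOp.IsEssentiallySelfAdjoint (ModelOp.modelOp γ A P) ∧
        ((ModelOp.modelOp γ A P).closure.domain : Set (ModelOp.L2Half H)) =
          ModelOp.sobolevDomain A P) ∧
    (ModelOp.IsDiscreteOp A →
      ∀ P ∈ Ψ, IsStarProjection P → IsSelfAdjoint (ModelOp.sobolevOp γ A P) →
        star γ * P * γ = 1 - P ∧ ModelOp.IsFredholmPair P Pplus) := by
  obtain ⟨Λ, B⟩ := ModelOp.exists_modelData hA hγ_skew hγ_sq hγ_dom hγ_anti hPplus hPplus_symm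
    hPplus_ge hPplus_le
  refine ⟨fun P hPΨ hPp hP hF => ?_, fun hdisc P hPΨ hPp hsa => ?_⟩
  · obtain ⟨h1, h2⟩ := ModelOp.isEssentiallySelfAdjoint_of_adjoint_le
      (D := ModelOp.modelOp γ A P) (S := ModelOp.sobolevOp γ A P)
      (by
        rw [ModelOp.modelOp_graph, ModelOp.sobolevOp_graph]
        exact ModelOp.modelGraph_le_sobolevGraph)
      (by
        rw [ModelOp.sobolevOp_graph]
        exact fun p hp q hq => B.symmetric hPp hP hp hq)
      (by
        rw [ModelOp.modelOp_graph, ModelOp.sobolevOp_graph]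
        exact fun u g hug =>
          B.mem_sobolevGraph_of_adjoint hA hΨ_op hΨ_hol hPplus_mem hPΨ hPp hP hF hug)
    refine ⟨h1, ?_⟩
    rw [h2, ModelOp.sobolevOp_domain]
  · have hP0 := hΨ_op hPΨ
    have hG := ModelOp.mem_graph_iff_of_isSelfAdjoint hsa
    rw [ModelOp.sobolevOp_graph] at hG
    have hP := B.star_mul_mul_eq hA hPp hP0 hG
    exact ⟨hP, B.isFredholmPair hA hdisc hPp hP hP0 hG⟩
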